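/- **Setting.** Let $\Lambda\subset\mathbb Z^d$ be a rectangle, $|x-y|=\sum_i|x_i-y_i|$, $u\in[-1,1]^\Lambda$, and let $H$ act on $\mathbb C^{|\Lambda|}\otimes\mathbb C^2$ by $H_{xx}=h_x=\begin{pmatrix}u_x&1\\1&-u_x\end{pmatrix}$, $H_{xy}=\gamma I_2$ if $|x-y|=1$, and $H_{xy}=0$ otherwise. Put $\psi=\tfrac23$, $\phi=\tfrac14$, $\varepsilon=\gamma^\phi$, $L_k=2^{k-1}$, $\varepsilon_k=\varepsilon^{L_k^\psi}$, and fix $E\in\mathbb R$. All blocks below are indexed by positions and have $2\times2$ entries; $|\cdot|$ is the operator norm of a $2\times 2$ matrix. **Construction.** Start with $R^{(0)}=\Lambda$ and $F^{(0)}_\lambda=H$; the multigraphs of $F^{(0)}_\lambda$ are its matrix elements $H_{xy}$, $|x-y|\le1$, each containing $x$ and $y$. Step $k\ge1$ is as follows. For $k=1$ the blocks are the single positions of $\Lambda$, all regarded as isolated. For $k\ge2$ the blocks are the components of $R^{(k-1)}$ formed with jumps of length at most $L_k$; a block is isolated if it has at most $L_k^{2\psi/5}$ positions, distance at least $4L_k$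 from every other component, and diameter at most $L_k$. For a block $B$ let $\tilde F^{(k-1)}_\lambda(B)$ be the sum of the multigraphs of $F^{(k-1)}_\lambda$ between positions of $B$ that contain only positions at distance $<L_{k-2}$ from $B$. An isolated block is resonant if $\operatorname{dist}(\operatorname{spec}\tilde F^{(k-1)}_E(B),E)\le\varepsilon_k$. Let $R^{(k)}$ be $R^{(k-1)}$ without its isolated non-resonant blocks. Write $F^{(k-1)}_\lambda=\begin{pmatrix}A^{(k)}&B^{(k)}\\C^{(k)}&D^{(k)}\end{pmatrix}$ with respect to $R^{(k)}$ and $R^{(k-1)}\setminus R^{(k)}$, and $D^{(k)}=W^{(k)}+V^{(k)}$ with $W^{(k)}=\bigoplus_B\tilde F^{(k-1)}_\lambda(B)$. Put $F^{(k)}_\lambda=A^{(k)}-B^{(k)}(D^{(k)}-\lambda)^{-1}C^{(k)}$. Expand $(D^{(k)}-\lambda)^{-1}$ in the Neumann series in $V^{(k)}$, and each element of $V^{(k)},B^{(k)},C^{(k)}$ in multigraphs of $F^{(k-1)}_\lambda$; the elements of $(W^{(k)}-\lambda)^{-1}$ (jumps inside a block) are not expanded. The resulting terms of $-B^{(k)}(D^{(k)}-\lambda)^{-1}C^{(k)}$,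 together with the multigraphs of $F^{(k-1)}_\lambda$ between positions of $R^{(k)}$, are the multigraphs of $F^{(k)}_\lambda$. A multigraph contains the positions of all blocks it passes through and of all its steps. **Kernel.** If $F^{(k)}_\lambda\varphi=\lambda\varphi$, then $(\varphi,-(D^{(k)}-\lambda)^{-1}C^{(k)}\varphi)$ is an eigenvector of $F^{(k-1)}_\lambda$ with eigenvalue $\lambda$. Let $G^{(k)}_\lambda$ be the composition of these extension maps for steps $k,k-1,\dots,1$, from functions on $R^{(k)}$ to functions on $\Lambda$ (both with values in $\mathbb C^2$). Apart from the identity block at $R^{(k)}$, it has a multigraph expansion, obtained by expanding the operators $-(D^{(j)}-\lambda)^{-1}C^{(j)}$, $j\le k$, as above. Let $\mathcal G^{(k)}_{x,y}$ be the sum of the absolute values of those multigraphs of $G^{(k)}_\lambda$ from $x$ to $y\in R^{(k)}$ that contain a factor from $(D^{(k)}-\lambda)^{-1}C^{(k)}$, i.e. of the multigraphs of $G_\lambda^{(k)}$ that are not multigraphs of $G_\lambda^{(k-1)}$ ($\mathcal G^{(k)}_{x,y}=0$ if there are none). **Theorem.** There are constants $c_d>0$ and $\gamma_0>0$, depending only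 on $d$, such that for all $0<\gamma\le\gamma_0$, all rectangles $\Lambda$, all $u\in[-1,1]^\Lambda$, all $E\in\mathbb R$, all $k\ge1$, and all real $\lambda$ with $|\lambda-E|\le\varepsilon_k/2$: the matrices $D^{(j)}-\lambda$, $1\le j\le k$, are invertible; the multigraph expansion of $G^{(k)}_\lambda$ converges absolutely to $G^{(k)}_\lambda$ minus its identity block; and, for all positions $x,y$, $$\mathcal G^{(k)}_{x,y}\le\Big(\frac\gamma\varepsilon\Big)^{(|x-y|\vee L_k)^\psi}2^{-k},\qquad \sum_{1\le j\le k}\mathcal G^{(j)}_{x,y}\le\Big(\frac\gamma\varepsilon\Big)^{(|x-y|\vee1)^\psi},$$ except that for nearest neighbours, $|x-y|=1$, the right-hand side of the second bound, and if $k=1$ also that of the first, is to be multiplied by $c_d$. -/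

import Mathlib

noncomputable section

/-- Positions of the lattice `ℤ^d`. -/
abbrev Pos (d : ℕ) : Type := Fin d → ℤ

/-- The metric `|x - y| = ∑ᵢ |xᵢ - yᵢ|`. -/
def posDist {d : ℕ} (x y : Pos d) : ℕ := ∑ i, (x i - y i).natAbs

/-- The exponent `ψ = 2/3`. -/
def psi : ℝ := 2 / 3

/-- The length scale `L_k = 2^(k-1)`; integer index, because `L_0` and `L_{-1}` occur. -/
def len (k : ℤ) : ℝ := (2 : ℝ) ^ (k - 1)

/-- `ε = γ^φ` with `φ = 1/4`. -/
def eps (γ : ℝ) : ℝ := γ ^ (1 / 4 : ℝ)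

/-- `ε_k = ε^(L_k^ψ)`. -/
def epsAt (γ : ℝ) (k : ℕ) : ℝ := eps γ ^ (len k ^ psi)

/-- The sites (a position together with one of its two internal states) over a set of positions. -/
abbrev Sites {d : ℕ} (X : Finset (Pos d)) : Type := {x : Pos d // x ∈ X} × Fin 2

/-- The inclusion of sites induced by an inclusion of sets of positions. -/
def incl {d : ℕ} {X Y : Finset (Pos d)} (h : Y ⊆ X) (s : Sites Y) : Sites X :=
  (⟨s.1.1, h s.1.2⟩, s.2)

/-- The Euclidean operator norm of a `2 × 2` block. -/
def blockNorm (A : Matrix (Fin 2) (Fin 2) ℝ) : ℝ :=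
  ‖Matrix.toEuclideanCLM (n := Fin 2) (𝕜 := ℝ) A‖

/-- The parameters: hopping strength, central energy, the corners of the rectangle, and the
values of the potential. -/
structure Setup (d : ℕ) where
  γ : ℝ
  E : ℝ
  lo : Pos d
  hi : Pos d
  u : Pos d → ℝ

namespace Setup
variable {d : ℕ} (S : Setup d)

/-- The rectangle `Λ`. -/
def box : Finset (Pos d) := Finset.Icc S.lo S.hi

/-- The `2 × 2` block of `H` between two positions: `h_x` on the diagonal, `γ I₂` between nearest
neighbours. -/
def hamBlock (x y : Pos d) : Matrix (Fin 2) (Fin 2) ℝ :=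
  if x = y then !![S.u x, 1; 1, -S.u x] else if posDist x y = 1 then S.γ • 1 else 0

/-- The Hamiltonian `H = H₀ + γ J ⊗ I₂` on the sites of `Λ`. -/
def ham : Matrix (Sites S.box) (Sites S.box) ℝ :=
  fun s t => S.hamBlock s.1 t.1 s.2 t.2

end Setup

/-- A family of (multi)graphs: each one goes from a source to a target, and has as value a
`2 × 2` matrix depending on the energy `λ`. -/
structure GraphFamily (d : ℕ) where
  Graph : Type
  src : Graph → Pos d
  tgt : Graph → Pos d
  val : ℝ → Graph → Matrix (Fin 2) (Fin 2) ℝ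

/-- The outcome of a step: the set `R` of positions that are kept, and the multigraphs of the Schur
complement living on `R`, with the set of positions that each of them contains. -/
structure Stage (d : ℕ) extends GraphFamily d where
  R : Finset (Pos d)
  supp : Graph → Finset (Pos d)

namespace Stage
variable {d : ℕ}

/-- The stage before the first step: all of `Λ`, with the matrix elements of `H` as graphs. -/
def initial (S : Setup d) : Stage d where
  Graph := {p : Pos d × Pos d // p.1 ∈ S.box ∧ p.2 ∈ S.box ∧ posDist p.1 p.2 ≤ 1}
  src p := p.1.1
  tgt p := p.1.2
  val _ p := S.hamBlock p.1.1 p.1.2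
  R := S.box
  supp p := {p.1.1, p.1.2}

/-- Connection length used to form the blocks of step `k`: the first step works with single
positions, step `k ≥ 2` with the components on scale `L_k = 2^(k-1)`. -/
def connLen (k : ℕ) : ℕ := if k = 1 then 0 else 2 ^ (k - 1)

/- In the rest of this namespace `T` is the outcome of step `k - 1`, on which step `k` operates. -/
variable (S : Setup d) (T : Stage d) (k : ℕ)

open Classical in
/-- The block of `x`: all positions of `R` reachable from `x` by jumps in `R` of length at most
`connLen k`. -/
def block (x : Pos d) : Finset (Pos d) :=
  T.R.filter fun y =>
    Relation.ReflTransGen (fun a b => b ∈ T.R ∧ posDist a b ≤ connLen k) x y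

/-- A block is isolated on scale `k ≥ 2` if it has small volume, is far from the other components,
and has small diameter. In the first step every single position is treated separately. -/
def Isolated (B : Finset (Pos d)) : Prop :=
  k = 1 ∨
    ((B.card : ℝ) ≤ len k ^ (2 * psi / 5) ∧
      (∀ x ∈ B, ∀ y ∈ T.R \ B, 4 * len k ≤ (posDist x y : ℝ)) ∧
      ∀ x ∈ B, ∀ y ∈ B, (posDist x y : ℝ) ≤ len k)

/-- The multigraph remains within a distance less than `L_{k-2}` of `B`. -/
def Local (B : Finset (Pos d)) (g : T.Graph) : Prop :=
  ∀ z ∈ T.supp g, ∃ b ∈ B, (posDist z b : ℝ) < len ((k : ℤ) - 2)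

/-- The truncated matrix of the block `B`: the sum of all local multigraphs between positions
of `B`. -/
def trunc (B : Finset (Pos d)) (l : ℝ) : Matrix (Sites B) (Sites B) ℝ :=
  fun s t =>
    ∑' g : {g : T.Graph // T.src g = s.1 ∧ T.tgt g = t.1 ∧ T.Local k B g},
      T.val l g.1 s.2 t.2

/-- The truncated matrix of `B` at the energy `E` has spectrum within `ε_k` of `E`. -/
def Resonant (B : Finset (Pos d)) : Prop :=
  ∃ μ ∈ spectrum ℝ (T.trunc k B S.E), |μ - S.E| ≤ epsAt S.γ k

open Classical in
/-- The positions removed in step `k`: those in isolated, non-resonant blocks. -/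
def removed : Finset (Pos d) :=
  T.R.filter fun x => T.Isolated k (T.block k x) ∧ ¬ T.Resonant S k (T.block k x)

/-- The positions kept in step `k`. -/
def kept : Finset (Pos d) := T.R \ T.removed S k

open Classical in
/-- The block matrix element of `(W - λ)⁻¹` between `x` and `y`, where `W` is the direct sum of the
truncated matrices of the blocks. -/
def invBlock (l : ℝ) (x y : Pos d) : Matrix (Fin 2) (Fin 2) ℝ :=
  if h : x ∈ T.block k x ∧ y ∈ T.block k x then
    fun i j => (T.trunc k (T.block k x) l - l • 1)⁻¹ (⟨x, h.1⟩, i) (⟨y, h.2⟩, j)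
  else 0

/-- The multigraph contributes to `V = D - W`: it joins removed positions, and it is not among the
multigraphs of the truncated matrix of a block. -/
def IsLong (g : T.Graph) : Prop :=
  T.src g ∈ T.removed S k ∧ T.tgt g ∈ T.removed S k ∧
    ¬ (T.tgt g ∈ T.block k (T.src g) ∧ T.Local k (T.block k (T.src g)) g)

/-- The multigraphs of `-(D - λ)⁻¹ C` that start at `x`: a jump inside the block of `x`, followed
either by a last step (a multigraph of `C`, from a removed to a kept position), or by a
multigraph of `V` and a walk of the same kind. -/
inductive Walk : Pos d → Type
  | last {x : Pos d} (c : T.Graph) (hx : x ∈ T.removed S k) (hj : T.src c ∈ T.block k x)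
      (hc : T.tgt c ∈ T.kept S k) : Walk x
  | step {x : Pos d} (v : T.Graph) (hx : x ∈ T.removed S k) (hj : T.src v ∈ T.block k x)
      (hv : T.IsLong S k v) (w : Walk (T.tgt v)) : Walk x

variable {S T k}

/-- The final position of a walk. -/
def Walk.tgt : {x : Pos d} → T.Walk S k x → Pos d
  | _, .last c _ _ _ => T.tgt c
  | _, .step _ _ _ _ w => w.tgt

open Classical in
/-- The positions contained in a walk: the blocks that it passes through, and the positions contained
in the multigraphs that are its steps. -/
def Walk.supp : {x : Pos d} → T.Walk S k x → Finset (Pos d)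
  | x, .last c _ _ _ => T.block k x ∪ T.supp c
  | x, .step v _ _ _ w => T.block k x ∪ T.supp v ∪ w.supp

/-- The value of a walk, a term of the Neumann series of `-(W + V - λ)⁻¹ C`. -/
def Walk.val (l : ℝ) : {x : Pos d} → T.Walk S k x → Matrix (Fin 2) (Fin 2) ℝ
  | x, .last c _ _ _ => -(T.invBlock k l x (T.src c) * T.val l c)
  | x, .step v _ _ _ w => -(T.invBlock k l x (T.src v) * T.val l v * w.val l)

variable (S T k)

open Classical in
/-- The result of step `k`. The multigraphs of `F^(k) = A - B (D - λ)⁻¹ C` are those of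
`F^(k-1)` between kept positions, and the new ones, which consist of a multigraph of `B` (from a kept
to a removed position) and a walk of `-(D - λ)⁻¹ C`. -/
def next : Stage d where
  Graph := {g : T.Graph // T.src g ∈ T.kept S k ∧ T.tgt g ∈ T.kept S k} ⊕
    (Σ b : {g : T.Graph // T.src g ∈ T.kept S k ∧ T.tgt g ∈ T.removed S k},
      T.Walk S k (T.tgt b.1))
  src := Sum.elim (fun g => T.src g.1) (fun p => T.src p.1.1)
  tgt := Sum.elim (fun g => T.tgt g.1) (fun p => p.2.tgt)
  val l := Sum.elim (fun g => T.val l g.1) (fun p => T.val l p.1.1 * p.2.val l)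
  R := T.kept S k
  supp := Sum.elim (fun g => T.supp g.1) (fun p => T.supp p.1.1 ∪ p.2.supp)

end Stage

namespace GraphFamily
variable {d : ℕ} (S : Setup d) (T : Stage d) (k : ℕ)

/-- Given the multigraphs `K` of the eigenfunction-generating kernel `G^(k-1)`, the multigraphs of
`G^(k)` that are new in step `k`: a walk of `-(D^(k) - λ)⁻¹ C^(k)`, possibly preceded by a multigraph
of `G^(k-1)`. -/
def kernelNew (K : GraphFamily d) : GraphFamily d where
  Graph := (Σ x : Pos d, T.Walk S k x) ⊕ (Σ g : K.Graph, T.Walk S k (K.tgt g))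
  src := Sum.elim (fun p => p.1) (fun p => K.src p.1)
  tgt := Sum.elim (fun p => p.2.tgt) (fun p => p.2.tgt)
  val l := Sum.elim (fun p => p.2.val l) (fun p => K.val l p.1 * p.2.val l)

/-- All multigraphs of `G^(k)` (apart from its identity block): those of `G^(k-1)` that end at a kept
position, and the new ones. -/
def kernelNext (K : GraphFamily d) : GraphFamily d where
  Graph := {g : K.Graph // K.tgt g ∈ T.kept S k} ⊕ (kernelNew S T k K).Graph
  src := Sum.elim (fun g => K.src g.1) (kernelNew S T k K).src
  tgt := Sum.elim (fun g => K.tgt g.1) (kernelNew S T k K).tgt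
  val l := Sum.elim (fun g => K.val l g.1) ((kernelNew S T k K).val l)

/-- The empty family. -/
def empty (d : ℕ) : GraphFamily d where
  Graph := Empty
  src := Empty.elim
  tgt := Empty.elim
  val _ := Empty.elim

/-- The sum of the absolute values of all multigraphs of the family from `x` to `y`. -/
def absSum (K : GraphFamily d) (l : ℝ) (x y : Pos d) : ENNReal :=
  ∑' g : {g : K.Graph // K.src g = x ∧ K.tgt g = y}, ENNReal.ofReal (blockNorm (K.val l g.1))

end GraphFamily

section Schur
variable {d : ℕ} {X Y : Finset (Pos d)}

/-- The upper left block, on `Y`. -/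
def cornerA (F : Matrix (Sites X) (Sites X) ℝ) (h : Y ⊆ X) : Matrix (Sites Y) (Sites Y) ℝ :=
  F.submatrix (incl h) (incl h)

/-- The upper right block. -/
def cornerB (F : Matrix (Sites X) (Sites X) ℝ) (h : Y ⊆ X) :
    Matrix (Sites Y) (Sites (X \ Y)) ℝ :=
  F.submatrix (incl h) (incl Finset.sdiff_subset)

/-- The lower left block. -/
def cornerC (F : Matrix (Sites X) (Sites X) ℝ) (h : Y ⊆ X) :
    Matrix (Sites (X \ Y)) (Sites Y) ℝ :=
  F.submatrix (incl Finset.sdiff_subset) (incl h)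

/-- The lower right block, on `X \ Y`. -/
def cornerD (F : Matrix (Sites X) (Sites X) ℝ) (Y : Finset (Pos d)) :
    Matrix (Sites (X \ Y)) (Sites (X \ Y)) ℝ :=
  F.submatrix (incl Finset.sdiff_subset) (incl Finset.sdiff_subset)

/-- The Schur complement `A - B (D - λ)⁻¹ C`. -/
def schurStep (F : Matrix (Sites X) (Sites X) ℝ) (h : Y ⊆ X) (l : ℝ) :
    Matrix (Sites Y) (Sites Y) ℝ :=
  cornerA F h - cornerB F h * (cornerD F Y - l • 1)⁻¹ * cornerC F h

/-- The matrix of `φ ↦ (φ, -(D - λ)⁻¹ C φ)`. -/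
def extendStep (F : Matrix (Sites X) (Sites X) ℝ) (h : Y ⊆ X) (l : ℝ) :
    Matrix (Sites X) (Sites Y) ℝ :=
  fun s t =>
    if hs : s.1.1 ∈ Y then (1 : Matrix (Sites Y) (Sites Y) ℝ) (⟨s.1.1, hs⟩, s.2) t
    else (-((cornerD F Y - l • 1)⁻¹ * cornerC F h))
      (⟨s.1.1, Finset.mem_sdiff.2 ⟨s.1.2, hs⟩⟩, s.2) t

end Schur

namespace Setup
variable {d : ℕ} (S : Setup d)

/-- The outcome of step `k`. -/
def stage : ℕ → Stage d
  | 0 => Stage.initial S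
  | k + 1 => (stage k).next S (k + 1)

/-- The resonant set `R^(k)`, with `R^(0) = Λ`. -/
def R (k : ℕ) : Finset (Pos d) := (S.stage k).R

theorem R_succ_subset (k : ℕ) : S.R (k + 1) ⊆ S.R k := Finset.sdiff_subset

/-- The Schur complement matrix `F_λ^(k)` on the sites of `R^(k)`, with `F_λ^(0) = H`. -/
def F (l : ℝ) : (k : ℕ) → Matrix (Sites (S.R k)) (Sites (S.R k)) ℝ
  | 0 => S.ham
  | k + 1 => schurStep (F l k) (S.R_succ_subset k) l

/-- The matrix `D^(k+1)`: the part of `F_λ^(k)` on the positions removed in step `k + 1`. -/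
def D (l : ℝ) (k : ℕ) :
    Matrix (Sites (S.R k \ S.R (k + 1))) (Sites (S.R k \ S.R (k + 1))) ℝ :=
  cornerD (S.F l k) (S.R (k + 1))

/-- The eigenfunction-generating kernel `G_λ^(k)`: the composition of the extension maps of the
first `k` steps, from functions on the sites of `R^(k)` to functions on the sites of `Λ`. -/
def G (l : ℝ) : (k : ℕ) → Matrix (Sites (S.R 0)) (Sites (S.R k)) ℝ
  | 0 => 1
  | k + 1 => G l k * extendStep (S.F l k) (S.R_succ_subset k) l

/-- All multigraphs of `G_λ^(k)` apart from its identity block. -/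
def kernelGraphs : ℕ → GraphFamily d
  | 0 => GraphFamily.empty d
  | k + 1 => GraphFamily.kernelNext S (S.stage k) (k + 1) (kernelGraphs k)

/-- The multigraphs of `G_λ^(k)` that are new in step `k`, that is, that use the operator
`(D^(k) - λ)⁻¹ C^(k)`. -/
def newKernelGraphs : ℕ → GraphFamily d
  | 0 => GraphFamily.empty d
  | k + 1 => GraphFamily.kernelNew S (S.stage k) (k + 1) (S.kernelGraphs k)

/-- `𝒢^(k)_{x,y}`: the sum of the absolute values of the multigraphs from `x` to `y` that step `k`
contributes to `G_λ^(k)`. -/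
def kernelSum (l : ℝ) (k : ℕ) (x y : Pos d) : ENNReal :=
  (S.newKernelGraphs k).absSum l x y

end Setup

end

/-! Write e for ε, so that γ = e^4 and γ/ε = e^3. Each multigraph g is weighed by its size times
e^(-4 reach(g)^ψ), where `reach` is the longest detour through a position that g contains. The claim
carried through the scales is that the weighted sum over all multigraphs starting at a given
position stays below C = 4·3^d + 1 (`CostBound`). For H this is a count: a hop has weight γ e^(-4) =
1, and a diagonal block has norm at most 4.

The mechanism is the strict subadditivity of t^ψ. Non-resonance of a block costs a resolvent of
order e^(-L_k^ψ). Merging two pieces whose lengths are at least fixed multiples of L_k into one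
piece saves a fixed multiple of L_k^ψ in the exponent of the weight. A step between blocks has
length at least 4 L_k by isolation, and a step inside a block that the truncation omits makes a
detour of at least L_k/2. Either way the saving is at least 1.2 L_k^ψ (`step_gain`), which beats the
resolvent and leaves e^(0.2 L_k^ψ). This also beats the combinatorial factor 2^k, since L_k^ψ grows
geometrically in k. Hence the Neumann series is geometric (`tsum_cost_le`), the new multigraphs of
step k contribute O(2^(-k)) (`tsum_new_le`), and the induction closes (`good_stages`).

Two points need extra care. Resonance is tested at E, while the resolvents are taken at λ.
`pairNorm` therefore adds to the size M times the change between the two energies, with M =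
ε_k/|λ-E|; being submultiplicative, it makes the same estimates yield Lipschitz bounds, so a
truncated matrix moves by at most a fraction of |λ-E| (`invBound`). Moreover, passing from distance
to the spectrum to a resolvent bound requires symmetric truncated matrices. Symmetry is inherited
(`Reversible.next`): if X solves (D-λ)X = -C then BX = -Xᵀ(D-λ)X, and this survives restriction to
multigraphs inside a given set of positions.

The kernel only has to decay like e^(3|x-y|^ψ). Lowering the exponent from 4 to 3 in the last step
of a walk pays for leaving its last block: for k ≥ 2 a factor e^(0.3 L_k^ψ) is left over, which
yields 2^(-k). For k = 1 the balance is exactly even, so walks consisting of a single hop gain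
nothing; they join nearest neighbours only and are the source of c_d. Composition over the scales
multiplies the bounds by factors 1 + θ_j with summable θ_j (`cost_kernelGraphs_le`). -/

noncomputable section

open scoped Matrix.Norms.L2Operator

/-- The algebra of blocks. -/
abbrev Mat2 : Type := Matrix (Fin 2) (Fin 2) ℝ

/-! ### The lattice metric. -/

section Metric
variable {d : ℕ}

theorem posDist_self (x : Pos d) : posDist x x = 0 := by simp [posDist]

theorem posDist_comm (x y : Pos d) : posDist x y = posDist y x := by
  unfold posDist
  refine Finset.sum_congr rfl fun i _ => ?_
  omega

theorem posDist_triangle (x y z : Pos d) : posDist x z ≤ posDist x y + posDist y z := by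
  unfold posDist
  rw [← Finset.sum_add_distrib]
  refine Finset.sum_le_sum fun i _ => ?_
  omega

theorem posDist_eq_zero {x y : Pos d} : posDist x y = 0 ↔ x = y := by
  unfold posDist
  rw [Finset.sum_eq_zero_iff]
  constructor
  · intro h
    funext i
    have := h i (Finset.mem_univ i)
    omega
  · rintro rfl i _
    simp

theorem one_le_posDist {x y : Pos d} (h : x ≠ y) : 1 ≤ posDist x y :=
  Nat.one_le_iff_ne_zero.2 fun h' => h (posDist_eq_zero.1 h')

end Metric

/-! ### Quantitative strict subadditivity of t^ψ. -/

section Psi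

theorem psi_pos : 0 < psi := by norm_num [psi]

theorem psi_le_one : psi ≤ 1 := by norm_num [psi]

/-- Increments of a concave function decrease: b and a + c are convex combinations of a and b + c
with complementary weights. -/
theorem rpow_psi_diff {a b c : ℝ} (ha : 0 ≤ a) (hab : a ≤ b) (hc : 0 ≤ c) :
    (b + c) ^ psi - b ^ psi ≤ (a + c) ^ psi - a ^ psi := by
  rcases hc.eq_or_lt with rfl | hc
  · simp
  have hconc := Real.concaveOn_rpow psi_pos.le psi_le_one
  have hpos : 0 < b - a + c := by linarith
  set t : ℝ := c / (b - a + c) with ht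
  have ht0 : 0 ≤ t := by positivity
  have ht1 : t ≤ 1 := by rw [ht, div_le_one hpos]; linarith
  have htm : t * (b - a + c) = c := by rw [ht]; field_simp
  have m1 : a ∈ Set.Ici (0 : ℝ) := ha
  have m2 : b + c ∈ Set.Ici (0 : ℝ) := by simp only [Set.mem_Ici]; linarith
  have h1 := hconc.2 m1 m2 (sub_nonneg.2 ht1) ht0 (by ring)
  have h2 := hconc.2 m1 m2 ht0 (sub_nonneg.2 ht1) (by ring)
  simp only [smul_eq_mul] at h1 h2
  have e1 : (1 - t) * a + t * (b + c) = a + c := by linear_combination htm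
  have e2 : t * a + (1 - t) * (b + c) = b := by linear_combination -htm
  rw [e1] at h1
  rw [e2] at h2
  linarith

theorem rpow_psi_add_le {a b : ℝ} (ha : 0 ≤ a) (hb : 0 ≤ b) :
    (a + b) ^ psi ≤ a ^ psi + b ^ psi := by
  have := rpow_psi_diff le_rfl ha hb
  rw [zero_add, Real.zero_rpow psi_pos.ne'] at this
  linarith

theorem rpow_psi_mono {a b : ℝ} (ha : 0 ≤ a) (hab : a ≤ b) : a ^ psi ≤ b ^ psi :=
  Real.rpow_le_rpow ha hab psi_pos.le

/-- Since ψ = 2/3, cubing turns numerical comparisons with ψ-th powers into rational arithmetic. -/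
theorem rpow_psi_cube {a : ℝ} (ha : 0 ≤ a) : (a ^ psi) ^ 3 = a ^ 2 := by
  rw [← Real.rpow_natCast, ← Real.rpow_mul ha, ← Real.rpow_natCast]
  norm_num [psi]

theorem rpow_psi_le {a c : ℝ} (ha : 0 ≤ a) (hc : 0 ≤ c) (h : a ^ 2 ≤ c ^ 3) : a ^ psi ≤ c := by
  rw [← rpow_psi_cube ha] at h
  exact le_of_pow_le_pow_left₀ (by norm_num) hc h

theorem le_rpow_psi {a c : ℝ} (ha : 0 ≤ a) (h : c ^ 3 ≤ a ^ 2) : c ≤ a ^ psi := by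
  rw [← rpow_psi_cube ha] at h
  exact le_of_pow_le_pow_left₀ (by norm_num) (Real.rpow_nonneg ha _) h

/-- By concavity the saving r^ψ + ρ^ψ - (r + ρ)^ψ grows with r and with ρ, so the worst case is r =
mL, ρ = nL, where homogeneity extracts L^ψ. -/
theorem rpow_psi_merge {m n r ρ L : ℝ} (hm : 0 ≤ m) (hn : 0 ≤ n) (hL : 0 ≤ L) (hr : m * L ≤ r)
    (hρ : n * L ≤ ρ) :
    (m ^ psi + n ^ psi - (m + n) ^ psi) * L ^ psi ≤ r ^ psi + ρ ^ psi - (r + ρ) ^ psi := by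
  have h1 := rpow_psi_diff (mul_nonneg hm hL) hr ((mul_nonneg hn hL).trans hρ)
  have h2 := rpow_psi_diff (mul_nonneg hn hL) hρ (mul_nonneg hm hL)
  have e1 := Real.mul_rpow hm hL (z := psi)
  have e2 := Real.mul_rpow hn hL (z := psi)
  have e3 := Real.mul_rpow (add_nonneg hm hn) hL (z := psi)
  rw [add_comm (n * L), ← add_mul] at h2
  rw [add_comm (m * L) ρ] at h1
  nlinarith

/-- The same monotonicity when the merged piece is lengthened by the diameter L of a block. -/
theorem rpow_psi_merge_jump {m n r ρ L : ℝ} (hm : 0 ≤ m) (hn : 0 ≤ n) (hL : 0 ≤ L)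
    (hr : m * L ≤ r) (hρ : n * L ≤ ρ) :
    (m ^ psi + n ^ psi - (m + n + 1) ^ psi) * L ^ psi ≤ r ^ psi + ρ ^ psi - (r + ρ + L) ^ psi := by
  have h1 := rpow_psi_diff (mul_nonneg hm hL) hr (add_nonneg ((mul_nonneg hn hL).trans hρ) hL)
  have h2 := rpow_psi_diff (mul_nonneg hn hL) hρ (add_nonneg (mul_nonneg hm hL) hL)
  have e1 := Real.mul_rpow hm hL (z := psi)
  have e2 := Real.mul_rpow hn hL (z := psi)
  have e3 := Real.mul_rpow (add_nonneg (add_nonneg hm hn) zero_le_one) hL (z := psi)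
  have f1 : n * L + (m * L + L) = (m + n + 1) * L := by ring
  have f2 : m * L + (ρ + L) = ρ + (m * L + L) := by ring
  have f3 : r + (ρ + L) = r + ρ + L := by ring
  rw [f1] at h2
  rw [f2, f3] at h1
  nlinarith

theorem two_rpow_psi_le : (2 : ℝ) ^ psi ≤ 1.5875 := rpow_psi_le (by norm_num) (by norm_num) (by norm_num)
theorem five_rpow_psi_le : (5 : ℝ) ^ psi ≤ 2.92402 :=
  rpow_psi_le (by norm_num) (by norm_num) (by norm_num)
theorem le_five_rpow_psi : 2.924 ≤ (5 : ℝ) ^ psi := le_rpow_psi (by norm_num) (by norm_num)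
theorem le_four_rpow_psi : 2.5198 ≤ (4 : ℝ) ^ psi := le_rpow_psi (by norm_num) (by norm_num)
theorem ten_rpow_psi_le : (10 : ℝ) ^ psi ≤ 4.6416 :=
  rpow_psi_le (by norm_num) (by norm_num) (by norm_num)
theorem le_half_rpow_psi : 0.629 ≤ (1 / 2 : ℝ) ^ psi := le_rpow_psi (by norm_num) (by norm_num)
theorem eleven_half_rpow_psi_le : (11 / 2 : ℝ) ^ psi ≤ 3.116 :=
  rpow_psi_le (by norm_num) (by norm_num) (by norm_num)

/-- A step inside a block of diameter `L`. -/
theorem merge_inside {r ρ L : ℝ} (hL : 0 ≤ L) (hr : 5 * L ≤ r) (hρ : 1 / 2 * L ≤ ρ) :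
    0.4 * L ^ psi ≤ r ^ psi + ρ ^ psi - (r + ρ) ^ psi := by
  -- The constant comes from 5^ψ + (1/2)^ψ - (11/2)^ψ ≥ 2.924 + 0.629 - 3.116 = 0.437.
  refine le_trans ?_ (rpow_psi_merge (by norm_num) (by norm_num) hL hr hρ)
  have h := Real.rpow_nonneg hL psi
  have e : (5 + 1 / 2 : ℝ) = 11 / 2 := by norm_num
  rw [e]
  have := le_five_rpow_psi
  have := le_half_rpow_psi
  have := eleven_half_rpow_psi_le
  gcongr
  linarith

/-- A step between two blocks. -/
theorem merge_outside {r ρ L : ℝ} (hL : 0 ≤ L) (hr : 5 * L ≤ r) (hρ : 4 * L ≤ ρ) :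
    0.8 * L ^ psi ≤ r ^ psi + ρ ^ psi - (r + ρ + L) ^ psi := by
  -- Here 5^ψ + 4^ψ - 10^ψ ≥ 2.924 + 2.5198 - 4.6416 = 0.8022.
  refine le_trans ?_ (rpow_psi_merge_jump (by norm_num) (by norm_num) hL hr hρ)
  have h := Real.rpow_nonneg hL psi
  have e : (5 + 4 + 1 : ℝ) = 10 := by norm_num
  rw [e]
  have := le_five_rpow_psi
  have := le_four_rpow_psi
  have := ten_rpow_psi_le
  gcongr
  linarith

/-- The first scale, where blocks are single positions and no diameter is lost: 2 - 2^ψ ≥ 0.4125. -/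
theorem merge_unit {r ρ : ℝ} (hr : 1 ≤ r) (hρ : 1 ≤ ρ) :
    0.41 ≤ r ^ psi + ρ ^ psi - (r + ρ) ^ psi := by
  have := rpow_psi_merge (m := 1) (n := 1) (L := 1) zero_le_one zero_le_one zero_le_one
    (by simpa using hr) (by simpa using hρ)
  have h2 := two_rpow_psi_le
  have e : (1 + 1 : ℝ) = 2 := by norm_num
  rw [e, Real.one_rpow] at this
  linarith

theorem exit_block {ρ L : ℝ} (hL : 0 ≤ L) (hρ : 4 * L ≤ ρ) :
    (ρ + L) ^ psi ≤ ρ ^ psi + 0.405 * L ^ psi := by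
  have h1 := rpow_psi_diff (mul_nonneg (by norm_num) hL) hρ hL
  have e1 := Real.mul_rpow (by norm_num : (0 : ℝ) ≤ 4) hL (z := psi)
  have e2 := Real.mul_rpow (by norm_num : (0 : ℝ) ≤ 5) hL (z := psi)
  have e3 : 4 * L + L = 5 * L := by ring
  rw [e3, e1, e2] at h1
  have h := Real.rpow_nonneg hL psi
  have := five_rpow_psi_le
  have := le_four_rpow_psi
  nlinarith

/-- Worst case ρ = 4L, with 4·4^ψ - 3·5^ψ ≥ 1.307. A coefficient above 1 is essential, because this
must outweigh one resolvent e^(-L^ψ). -/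
theorem exit_block_three {ρ L : ℝ} (hL : 0 ≤ L) (hρ : 4 * L ≤ ρ) :
    1.3 * L ^ psi ≤ 4 * ρ ^ psi - 3 * (ρ + L) ^ psi := by
  have h1 := rpow_psi_diff (mul_nonneg (by norm_num) hL) hρ hL
  have h2 := rpow_psi_mono (mul_nonneg (by norm_num) hL) hρ
  have e1 := Real.mul_rpow (by norm_num : (0 : ℝ) ≤ 4) hL (z := psi)
  have e2 := Real.mul_rpow (by norm_num : (0 : ℝ) ≤ 5) hL (z := psi)
  have e3 : 4 * L + L = 5 * L := by ring
  rw [e3, e1, e2] at h1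
  rw [e1] at h2
  have h := Real.rpow_nonneg hL psi
  have := five_rpow_psi_le
  have := le_four_rpow_psi
  nlinarith

end Psi

/-! ### Sums over subtypes as sums with indicator values. -/

section Pick
variable {M : Type*}

open Classical in
/-- The value `a` if `p` holds, and `0` otherwise. -/
def pick [Zero M] (p : Prop) (a : M) : M := if p then a else 0

@[simp] theorem pick_pos [Zero M] {p : Prop} (h : p) (a : M) : pick p a = a := if_pos h

@[simp] theorem pick_neg [Zero M] {p : Prop} (h : ¬ p) (a : M) : pick p a = 0 := if_neg h

@[simp] theorem pick_zero [Zero M] (p : Prop) : pick p (0 : M) = 0 := ite_self _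

theorem pick_and [Zero M] (p q : Prop) (a : M) : pick (p ∧ q) a = pick p (pick q a) := by
  by_cases hp : p <;> by_cases hq : q <;> simp [hp, hq]

theorem pick_neg_eq [NegZeroClass M] (p : Prop) (a : M) : pick p (-a) = -pick p a := by
  by_cases hp : p <;> simp [hp]

theorem pick_congr [Zero M] {p q : Prop} (h : p ↔ q) (a : M) : pick p a = pick q a := by
  rw [propext h]

theorem pick_of_imp [Zero M] {p : Prop} {a : M} (h : a ≠ 0 → p) : pick p a = a := by
  by_cases hp : p
  · exact pick_pos hp a
  · rw [pick_neg hp]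
    by_contra h'
    exact hp (h (Ne.symm h'))

theorem tsum_subtype_pick {ι : Type*} [AddCommMonoid M] [TopologicalSpace M] (p : ι → Prop)
    (f : ι → M) : ∑' g : {g : ι // p g}, f g.1 = ∑' g, pick (p g) (f g) := by
  classical
  refine (tsum_subtype {g | p g} f).trans (tsum_congr fun g => ?_)
  by_cases h : p g <;> simp [h]

theorem tsum_subtype_pick' {ι : Type*} [AddCommMonoid M] [TopologicalSpace M] {p : ι → Prop}
    (f : ι → M) (hf : ∀ g, f g ≠ 0 → p g) : ∑' g : {g : ι // p g}, f g.1 = ∑' g, f g := by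
  rw [tsum_subtype_pick p f]
  exact tsum_congr fun g => pick_of_imp (hf g)

/-- Sorts a term by the value of a label such as its end point. -/
theorem sum_pick_eq {α : Type*} [AddCommMonoid M] {B : Finset α} {a : α} {m : M} (h : m ≠ 0 → a ∈ B) :
    ∑ b ∈ B, pick (a = b) m = m := by
  classical
  by_cases hm : m = 0
  · simp [hm]
  · rw [Finset.sum_eq_single a]
    · simp
    · intro b _ hb
      exact pick_neg (Ne.symm hb) m
    · intro h'
      exact absurd (h hm) h'

end Pick

/-! ### Norms of 2 × 2 blocks and of pairs of blocks. -/

section Norms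

theorem blockNorm_eq (A : Mat2) : blockNorm A = ‖A‖ := rfl

theorem abs_entry_le_norm {n : Type*} [Fintype n] [DecidableEq n] (A : Matrix n n ℝ) (i j : n) :
    |A i j| ≤ ‖A‖ := by
  have h := Matrix.l2_opNorm_mulVec A (EuclideanSpace.single j 1)
  rw [PiLp.norm_single, norm_one, mul_one] at h
  refine le_trans ?_ h
  have h2 := PiLp.norm_apply_le (WithLp.toLp 2 (A.mulVec (EuclideanSpace.single j (1 : ℝ)).ofLp)) i
  simpa using h2

theorem norm_le_of_entries (A : Mat2) {c : ℝ} (h : ∀ i j, |A i j| ≤ c) : ‖A‖ ≤ 4 * c := by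
  have hc : 0 ≤ c := (abs_nonneg _).trans (h 0 0)
  rw [← blockNorm_eq, blockNorm]
  refine ContinuousLinearMap.opNorm_le_bound _ (by positivity) fun v => ?_
  have hv : ∀ i, |v i| ≤ ‖v‖ := fun i => PiLp.norm_apply_le v i
  have hw : ∀ i, |(Matrix.toEuclideanCLM (n := Fin 2) (𝕜 := ℝ) A v) i| ≤ 2 * c * ‖v‖ := by
    intro i
    have : (Matrix.toEuclideanCLM (n := Fin 2) (𝕜 := ℝ) A v) i = A i 0 * v 0 + A i 1 * v 1 := by
      rw [Matrix.ofLp_toEuclideanCLM]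
      simp [Matrix.mulVec, dotProduct, Fin.sum_univ_two]
    rw [this]
    refine (abs_add_le _ _).trans ?_
    rw [abs_mul, abs_mul]
    have h1 := mul_le_mul (h i 0) (hv 0) (abs_nonneg _) hc
    have h2 := mul_le_mul (h i 1) (hv 1) (abs_nonneg _) hc
    linarith
  rw [EuclideanSpace.norm_eq, Fin.sum_univ_two]
  apply Real.sqrt_le_iff.2
  refine ⟨by positivity, ?_⟩
  have h0 := sq_le_sq.2 ((hw 0).trans (le_abs_self _))
  have h1 := sq_le_sq.2 ((hw 1).trans (le_abs_self _))
  simp only [Real.norm_eq_abs, sq_abs]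
  nlinarith [sq_nonneg (c * ‖v‖)]

/-- A submultiplicative norm on pairs of blocks that controls their difference. -/
def pairNorm (M : ℝ) (A A' : Mat2) : ℝ := max ‖A‖ ‖A'‖ + M * ‖A - A'‖

theorem norm_le_pairNorm {M : ℝ} (hM : 0 ≤ M) (A A' : Mat2) : ‖A‖ ≤ pairNorm M A A' :=
  (le_max_left _ _).trans (le_add_of_nonneg_right (by positivity))

theorem norm_le_pairNorm' {M : ℝ} (hM : 0 ≤ M) (A A' : Mat2) : ‖A'‖ ≤ pairNorm M A A' :=
  (le_max_right _ _).trans (le_add_of_nonneg_right (by positivity))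

theorem mul_norm_sub_le_pairNorm {M : ℝ} (A A' : Mat2) : M * ‖A - A'‖ ≤ pairNorm M A A' :=
  le_add_of_nonneg_left ((norm_nonneg _).trans (le_max_left _ _))

theorem pairNorm_nonneg {M : ℝ} (hM : 0 ≤ M) (A A' : Mat2) : 0 ≤ pairNorm M A A' :=
  (norm_nonneg _).trans (norm_le_pairNorm hM A A')

theorem pairNorm_mono {M M' : ℝ} (h : M ≤ M') (A A' : Mat2) : pairNorm M A A' ≤ pairNorm M' A A' := by
  unfold pairNorm
  gcongr

theorem pairNorm_neg (M : ℝ) (A A' : Mat2) : pairNorm M (-A) (-A') = pairNorm M A A' := by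
  unfold pairNorm
  rw [norm_neg, norm_neg, ← neg_sub', norm_neg]

theorem pairNorm_self (M : ℝ) (A : Mat2) : pairNorm M A A = ‖A‖ := by
  simp [pairNorm]

/-- Leibniz rule: M‖AB - A'B'‖ is bounded by the two mixed terms in the expanded product, and the
remaining term is nonnegative. -/
theorem pairNorm_mul {M : ℝ} (hM : 0 ≤ M) (A A' B B' : Mat2) :
    pairNorm M (A * B) (A' * B') ≤ pairNorm M A A' * pairNorm M B B' := by
  have e : A * B - A' * B' = (A - A') * B + A' * (B - B') := by noncomm_ring
  have h1 : ‖A * B - A' * B'‖ ≤ ‖A - A'‖ * ‖B‖ + ‖A'‖ * ‖B - B'‖ := by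
    rw [e]
    exact (norm_add_le _ _).trans (add_le_add (norm_mul_le _ _) (norm_mul_le _ _))
  unfold pairNorm
  set a := max ‖A‖ ‖A'‖
  set b := max ‖B‖ ‖B'‖
  have ha : ‖A‖ ≤ a := le_max_left _ _
  have ha' : ‖A'‖ ≤ a := le_max_right _ _
  have hb : ‖B‖ ≤ b := le_max_left _ _
  have hb' : ‖B'‖ ≤ b := le_max_right _ _
  have hm : max ‖A * B‖ ‖A' * B'‖ ≤ a * b :=
    max_le ((norm_mul_le _ _).trans (by gcongr)) ((norm_mul_le _ _).trans (by gcongr))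
  have h2 : M * ‖A * B - A' * B'‖ ≤ M * ‖A - A'‖ * b + a * (M * ‖B - B'‖) := by
    refine (mul_le_mul_of_nonneg_left h1 hM).trans ?_
    have := mul_le_mul_of_nonneg_left hb (by positivity : 0 ≤ M * ‖A - A'‖)
    have := mul_le_mul_of_nonneg_right ha' (by positivity : 0 ≤ M * ‖B - B'‖)
    linarith
  have : 0 ≤ M * ‖A - A'‖ * (M * ‖B - B'‖) := by positivity
  linarith

theorem summable_of_tsum_ofReal_norm {ι : Type*} {f : ι → Mat2}
    (h : ∑' i, ENNReal.ofReal ‖f i‖ ≠ ⊤) : Summable f := by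
  refine Summable.of_norm ?_
  have := ENNReal.summable_toReal h
  simpa [ENNReal.toReal_ofReal (norm_nonneg _)] using this

end Norms

end

noncomputable section

/-! ### Blocks, and sums over walks. -/

section Blocks
variable {d : ℕ} {S : Setup d} {T : Stage d} {k : ℕ}

namespace Stage

theorem mem_block {x y : Pos d} : y ∈ T.block k x ↔ y ∈ T.R ∧
    Relation.ReflTransGen (fun a b => b ∈ T.R ∧ posDist a b ≤ connLen k) x y := by
  classical
  unfold block
  convert Finset.mem_filter

theorem block_subset (x : Pos d) : T.block k x ⊆ T.R :=
  fun _ hy => (mem_block.1 hy).1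

theorem self_mem_block {x : Pos d} (hx : x ∈ T.R) : x ∈ T.block k x :=
  mem_block.2 ⟨hx, Relation.ReflTransGen.refl⟩

theorem block_trans {x y z : Pos d} (hy : y ∈ T.block k x) (hz : z ∈ T.block k y) :
    z ∈ T.block k x :=
  mem_block.2 ⟨(mem_block.1 hz).1, (mem_block.1 hy).2.trans (mem_block.1 hz).2⟩

theorem block_symm {x y : Pos d} (hx : x ∈ T.R) (hy : y ∈ T.block k x) : x ∈ T.block k y := by
  refine mem_block.2 ⟨hx, ?_⟩
  have h := (mem_block.1 hy).2
  induction h with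
  | refl => exact Relation.ReflTransGen.refl
  | @tail b c hb hc ih =>
    have hbR : b ∈ T.R := by
      rcases Relation.ReflTransGen.cases_tail hb with h | ⟨_, _, h⟩
      · exact h ▸ hx
      · exact h.1
    exact (Relation.ReflTransGen.single ⟨hbR, posDist_comm b c ▸ hc.2⟩).trans
      (ih (mem_block.2 ⟨hbR, hb⟩))

theorem block_eq {x y : Pos d} (hx : x ∈ T.R) (hy : y ∈ T.block k x) :
    T.block k y = T.block k x := by
  ext z
  exact ⟨fun hz => block_trans hy hz, fun hz => block_trans (block_symm hx hy) hz⟩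

theorem mem_removed {x : Pos d} : x ∈ T.removed S k ↔
    x ∈ T.R ∧ T.Isolated k (T.block k x) ∧ ¬ T.Resonant S k (T.block k x) := by
  classical
  unfold removed
  convert Finset.mem_filter

theorem mem_kept {x : Pos d} : x ∈ T.kept S k ↔ x ∈ T.R ∧ x ∉ T.removed S k := by
  simp [kept]

theorem removed_subset : T.removed S k ⊆ T.R := fun _ hx => (mem_removed.1 hx).1

theorem sdiff_kept : T.R \ T.kept S k = T.removed S k :=
  Finset.sdiff_sdiff_eq_self removed_subset

/-- Blocks are removed as a whole, so a jump inside a block never leaves the removed set. -/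
theorem removed_of_mem_block {x y : Pos d} (hx : x ∈ T.removed S k) (hy : y ∈ T.block k x) :
    y ∈ T.removed S k := by
  have h := mem_removed.1 hx
  refine mem_removed.2 ⟨block_subset _ hy, ?_⟩
  rw [block_eq h.1 hy]
  exact h.2

theorem block_one {x y : Pos d} (hy : y ∈ T.block 1 x) : y = x := by
  have h := (mem_block.1 hy).2
  induction h with
  | refl => rfl
  | @tail b c hb hc ih =>
    have hbc : b = c := posDist_eq_zero.1 (by simpa [connLen] using hc.2)
    subst hbc
    exact ih hy

theorem connLen_of_ne_one (hk : k ≠ 1) : connLen k = 2 ^ (k - 1) := if_neg hk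

theorem len_eq_connLen (hk : 2 ≤ k) : len k = connLen k := by
  rw [connLen_of_ne_one (by omega), len, show (k : ℤ) - 1 = ((k - 1 : ℕ) : ℤ) by omega,
    zpow_natCast]
  push_cast
  rfl

theorem posDist_le_connLen (hk : 1 ≤ k) {x a b : Pos d} (hx : x ∈ T.removed S k)
    (ha : a ∈ T.block k x) (hb : b ∈ T.block k x) : posDist a b ≤ connLen k := by
  rcases hk.eq_or_lt with rfl | hk
  · rw [block_one ha, block_one hb, posDist_self]
    exact Nat.zero_le _
  · rcases (mem_removed.1 hx).2.1 with h | h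
    · omega
    · have := h.2.2 a ha b hb
      rw [len_eq_connLen hk] at this
      exact_mod_cast this

theorem four_connLen_le (hk : 2 ≤ k) {x a y : Pos d} (hx : x ∈ T.removed S k)
    (ha : a ∈ T.block k x) (hy : y ∈ T.R) (hyx : y ∉ T.block k x) :
    4 * connLen k ≤ posDist a y := by
  rcases (mem_removed.1 hx).2.1 with h | h
  · omega
  · have := h.2.1 a ha y (Finset.mem_sdiff.2 ⟨hy, hyx⟩)
    rw [len_eq_connLen hk] at this
    exact_mod_cast this

theorem one_le_len (hk : 1 ≤ k) : 1 ≤ len k := by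
  rw [len]
  exact one_le_zpow₀ (by norm_num) (by omega)

/-- Only the crude consequence of the volume condition that uses 2ψ/5 ≤ 1 is needed; 2^k is absorbed
later by e^(0.2 L_k^ψ). -/
theorem card_block_le (hk : 1 ≤ k) {x : Pos d} (hx : x ∈ T.removed S k) :
    ((T.block k x).card : ℝ) ≤ 2 ^ k := by
  rcases hk.eq_or_lt with rfl | hk
  · have : T.block 1 x ⊆ {x} := fun y hy => Finset.mem_singleton.2 (block_one hy)
    have := Finset.card_le_card this
    rw [Finset.card_singleton] at this
    have : ((T.block 1 x).card : ℝ) ≤ 1 := by exact_mod_cast this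
    linarith
  · rcases (mem_removed.1 hx).2.1 with h | h
    · omega
    · refine h.1.trans ?_
      refine (Real.rpow_le_rpow_of_exponent_le (one_le_len (by omega))
        (by norm_num [psi] : 2 * psi / 5 ≤ 1)).trans ?_
      rw [Real.rpow_one, len_eq_connLen hk, connLen_of_ne_one (by omega)]
      push_cast
      exact pow_le_pow_right₀ (by norm_num) (by omega)

/-- A walk is a last step, or a step followed by a walk. -/
def walkEquiv (S : Setup d) (T : Stage d) (k : ℕ) (x : Pos d) : T.Walk S k x ≃
    {c : T.Graph // x ∈ T.removed S k ∧ T.src c ∈ T.block k x ∧ T.tgt c ∈ T.kept S k} ⊕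
    (Σ v : {v : T.Graph // x ∈ T.removed S k ∧ T.src v ∈ T.block k x ∧ T.IsLong S k v},
      T.Walk S k (T.tgt v.1)) where
  toFun w := match w with
    | .last c hx hj hc => Sum.inl ⟨c, hx, hj, hc⟩
    | .step v hx hj hv w => Sum.inr ⟨⟨v, hx, hj, hv⟩, w⟩
  invFun s := match s with
    | Sum.inl c => .last c.1 c.2.1 c.2.2.1 c.2.2.2
    | Sum.inr p => .step p.1.1 p.1.2.1 p.1.2.2.1 p.1.2.2.2 p.2
  left_inv w := by cases w <;> rfl
  right_inv s := by rcases s with c | ⟨v, w⟩ <;> rfl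

theorem Walk.start_removed {x : Pos d} (w : T.Walk S k x) : x ∈ T.removed S k := by
  cases w <;> assumption

theorem Walk.tgt_kept {x : Pos d} (w : T.Walk S k x) : w.tgt ∈ T.kept S k := by
  induction w with
  | last c hx hj hc => exact hc
  | step v hx hj hv w ih => exact ih

/-- The number of steps before the last one. -/
def Walk.steps : {x : Pos d} → T.Walk S k x → ℕ
  | _, .last _ _ _ _ => 0
  | _, .step _ _ _ _ w => w.steps + 1

theorem tsum_walk (x : Pos d) (f : T.Walk S k x → ENNReal) :
    ∑' w, f w =
      ∑' c : {c : T.Graph // x ∈ T.removed S k ∧ T.src c ∈ T.block k x ∧ T.tgt c ∈ T.kept S k},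
        f (.last c.1 c.2.1 c.2.2.1 c.2.2.2) +
      ∑' v : {v : T.Graph // x ∈ T.removed S k ∧ T.src v ∈ T.block k x ∧ T.IsLong S k v},
        ∑' w : T.Walk S k (T.tgt v.1), f (.step v.1 v.2.1 v.2.2.1 v.2.2.2 w) := by
  rw [← (walkEquiv S T k x).symm.tsum_eq f, ENNReal.summable.tsum_sum ENNReal.summable]
  exact congrArg _ (ENNReal.tsum_sigma' _)

/-- A geometric bound for sums over walks. -/
theorem tsum_walk_le (c : ∀ x, T.Walk S k x → ENNReal) (f : Pos d → T.Graph → ENNReal)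
    (A : ENNReal)
    (hlast : ∀ x, ∑' g : {g : T.Graph // x ∈ T.removed S k ∧ T.src g ∈ T.block k x ∧
      T.tgt g ∈ T.kept S k}, c x (.last g.1 g.2.1 g.2.2.1 g.2.2.2) ≤ A)
    (hstep : ∀ x v hx hj hv w, c x (.step v hx hj hv w) ≤ f x v * c (T.tgt v) w)
    (hf : ∀ x, ∑' v : {v : T.Graph // x ∈ T.removed S k ∧ T.src v ∈ T.block k x ∧
      T.IsLong S k v}, f x v.1 ≤ 1 / 2) (x : Pos d) : ∑' w, c x w ≤ 2 * A := by
  classical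
  -- The total might be infinite a priori, so it cannot be absorbed into itself. Bounding the number
  -- of steps gives the recursion A + (1/2)(2A) = 2A.
  have key : ∀ n : ℕ, ∀ x, ∑' w : T.Walk S k x, (if w.steps < n then c x w else 0) ≤ 2 * A := by
    intro n
    induction n with
    | zero => intro x; simp
    | succ n ih =>
      intro x
      rw [tsum_walk, two_mul]
      refine add_le_add (le_trans (ENNReal.tsum_le_tsum fun g => ?_) (hlast x)) ?_
      · split_ifs <;> simp
      calc _ ≤ ∑' v : {v : T.Graph // x ∈ T.removed S k ∧ T.src v ∈ T.block k x ∧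
            T.IsLong S k v}, f x v.1 * (2 * A) := by
            refine ENNReal.tsum_le_tsum fun v => ?_
            refine le_trans ?_ (mul_le_mul_right (ih (T.tgt v.1)) (f x v.1))
            rw [← ENNReal.tsum_mul_left]
            refine ENNReal.tsum_le_tsum fun w => ?_
            simp only [Walk.steps, Nat.add_lt_add_iff_right]
            split_ifs
            · exact hstep _ _ _ _ _ _
            · simp
        _ ≤ 1 / 2 * (2 * A) := by
            rw [ENNReal.tsum_mul_right]
            exact mul_le_mul_left (hf x) _
        _ = A := by
            rw [← mul_assoc, ENNReal.div_mul_cancel (by simp) (by simp), one_mul]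
  rw [ENNReal.tsum_eq_iSup_sum]
  refine iSup_le fun s => ?_
  refine le_trans ?_ (key (s.sup Walk.steps + 1) x)
  refine le_trans (le_of_eq ?_) (ENNReal.sum_le_tsum s)
  refine Finset.sum_congr rfl fun w hw => ?_
  rw [if_pos (Nat.lt_succ_of_le (Finset.le_sup (f := Walk.steps) hw))]

/-- The contribution of the walks with at least two steps. -/
theorem tsum_walk_step_le (c : ∀ x, T.Walk S k x → ENNReal) (f : Pos d → T.Graph → ENNReal)
    (A q : ENNReal)
    (hstep : ∀ x v hx hj hv w, c x (.step v hx hj hv w) ≤ f x v * c (T.tgt v) w)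
    (hf : ∀ x, ∑' v : {v : T.Graph // x ∈ T.removed S k ∧ T.src v ∈ T.block k x ∧
      T.IsLong S k v}, f x v.1 ≤ q) (hA : ∀ x, ∑' w, c x w ≤ A) (x : Pos d) :
    ∑' v : {v : T.Graph // x ∈ T.removed S k ∧ T.src v ∈ T.block k x ∧ T.IsLong S k v},
      ∑' w : T.Walk S k (T.tgt v.1), c x (.step v.1 v.2.1 v.2.2.1 v.2.2.2 w) ≤ q * A := by
  calc _ ≤ ∑' v : {v : T.Graph // x ∈ T.removed S k ∧ T.src v ∈ T.block k x ∧
            T.IsLong S k v}, f x v.1 * A := by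
            refine ENNReal.tsum_le_tsum fun v => ?_
            refine le_trans ?_ (mul_le_mul_right (hA (T.tgt v.1)) (f x v.1))
            rw [← ENNReal.tsum_mul_left]
            exact ENNReal.tsum_le_tsum fun w => hstep _ _ _ _ _ _
        _ ≤ q * A := by
            rw [ENNReal.tsum_mul_right]
            exact mul_le_mul_left (hf x) _

/-- Sums over the multigraphs that start in a block. -/
theorem tsum_block_le (x : Pos d) (p : T.Graph → Prop) (hp : ∀ g, p g → T.src g ∈ T.block k x)
    (f : T.Graph → ENNReal) (A : ENNReal)
    (hA : ∀ a, ∑' g : {g : T.Graph // T.src g = a}, f g.1 ≤ A) :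
    ∑' g : {g : T.Graph // p g}, f g.1 ≤ (T.block k x).card * A := by
  classical
  have h1 : ∑' g : {g : T.Graph // p g}, f g.1 ≤
      ∑' g : T.Graph, ∑ a ∈ T.block k x, pick (T.src g = a) (f g) := by
    rw [tsum_subtype_pick p f]
    refine ENNReal.tsum_le_tsum fun g => ?_
    by_cases hg : p g
    · rw [pick_pos hg, sum_pick_eq fun _ => hp g hg]
    · rw [pick_neg hg]
      exact zero_le
  refine h1.trans ?_
  rw [Summable.tsum_finsetSum (fun _ _ => ENNReal.summable), ← nsmul_eq_mul]
  refine Finset.sum_le_card_nsmul _ _ _ fun a _ => ?_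
  rw [← tsum_subtype_pick (fun g => T.src g = a) f]
  exact hA a

end Stage

end Blocks

end

noncomputable section

/-! ### Lengths of multigraphs and walks, and the gain in the exponent. -/

section Reach
variable {d : ℕ} {S : Setup d} {T : Stage d} {k : ℕ}

namespace Stage

/-- The length of the longest detour through a position that the multigraph contains. -/
def reach (T : Stage d) (g : T.Graph) : ℕ :=
  (insert (T.src g) (T.supp g)).sup fun z => posDist (T.src g) z + posDist z (T.tgt g)

theorem le_reach {g : T.Graph} {z : Pos d} (hz : z ∈ T.supp g) :
    posDist (T.src g) z + posDist z (T.tgt g) ≤ T.reach g :=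
  Finset.le_sup (f := fun z => posDist (T.src g) z + posDist z (T.tgt g))
    (Finset.mem_insert_of_mem hz)

theorem posDist_le_reach (g : T.Graph) : posDist (T.src g) (T.tgt g) ≤ T.reach g := by
  have := Finset.le_sup (f := fun z => posDist (T.src g) z + posDist z (T.tgt g))
    (Finset.mem_insert_self (T.src g) (T.supp g))
  unfold reach
  simpa only [posDist_self, zero_add] using this

theorem reach_le {g : T.Graph} {n : ℕ} (h0 : posDist (T.src g) (T.tgt g) ≤ n)
    (h : ∀ z ∈ T.supp g, posDist (T.src g) z + posDist z (T.tgt g) ≤ n) : T.reach g ≤ n := by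
  refine Finset.sup_le fun z hz => ?_
  rcases Finset.mem_insert.1 hz with rfl | hz
  · simpa only [posDist_self, zero_add] using h0
  · exact h z hz

open Classical in
/-- The length of a walk: a visit to a block costs at most its diameter. -/
def Walk.wlen : {x : Pos d} → T.Walk S k x → ℕ
  | _, .last c _ _ _ => T.reach c + connLen k
  | _, .step v _ _ _ w =>
    w.wlen + T.reach v + if T.tgt v ∈ T.block k (T.src v) then 0 else connLen k

/-- The bound must hold from every position of the starting block: a nonlocal step may return to the
same block, and `wlen` charges no diameter for that. -/
theorem Walk.posDist_le_wlen (hk : 1 ≤ k) {x : Pos d} (w : T.Walk S k x) :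
    ∀ a ∈ T.block k x, posDist a w.tgt ≤ w.wlen := by
  induction w with
  | @last x c hx hj hc =>
    intro a ha
    have h1 := posDist_le_connLen hk hx ha hj
    have h2 := T.posDist_le_reach c
    have h3 := posDist_triangle a (T.src c) (T.tgt c)
    simp only [Walk.tgt, Walk.wlen]
    omega
  | @step x v hx hj hv w ih =>
    intro a ha
    have hxR := removed_subset hx
    simp only [Walk.tgt, Walk.wlen]
    split_ifs with h
    · rw [block_eq (removed_subset hv.1) h, block_eq hxR hj] at ih
      have := ih a ha
      omega
    · have h0 := ih _ (self_mem_block (removed_subset hv.2.1))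
      have h1 := posDist_le_connLen hk hx ha hj
      have h2 := T.posDist_le_reach v
      have h3 := posDist_triangle a (T.src v) (T.tgt v)
      have h4 := posDist_triangle a (T.tgt v) w.tgt
      omega

/-- The detour may begin at a suitable position b of the first block instead of at x; again this is
what lets a return to the same block be free. -/
theorem Walk.supp_le_wlen (hk : 1 ≤ k) {x : Pos d} (w : T.Walk S k x) :
    ∀ z ∈ w.supp, ∃ b ∈ T.block k x, posDist b z + posDist z w.tgt ≤ w.wlen := by
  induction w with
  | @last x c hx hj hc =>
    intro z hz
    simp only [Walk.supp, Finset.mem_union] at hz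
    rcases hz with hz | hz
    · refine ⟨z, hz, ?_⟩
      rw [posDist_self, zero_add]
      exact Walk.posDist_le_wlen hk _ z hz
    · refine ⟨_, hj, ?_⟩
      have := T.le_reach hz
      simp only [Walk.tgt, Walk.wlen]
      omega
  | @step x v hx hj hv w ih =>
    intro z hz
    simp only [Walk.supp, Finset.mem_union] at hz
    rcases hz with (hz | hz) | hz
    · refine ⟨z, hz, ?_⟩
      rw [posDist_self, zero_add]
      exact Walk.posDist_le_wlen hk _ z hz
    · refine ⟨_, hj, ?_⟩
      have h1 := T.le_reach hz
      have h2 := w.posDist_le_wlen hk _ (self_mem_block (removed_subset hv.2.1))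
      have h3 := posDist_triangle z (T.tgt v) w.tgt
      simp only [Walk.tgt, Walk.wlen]
      omega
    · obtain ⟨b, hb, hbz⟩ := ih z hz
      simp only [Walk.tgt, Walk.wlen]
      split_ifs with h
      · rw [block_eq (removed_subset hv.1) h, block_eq (removed_subset hx) hj] at hb
        exact ⟨b, hb, by omega⟩
      · refine ⟨_, hj, ?_⟩
        have h1 := posDist_le_connLen hk hv.2.1 (self_mem_block (removed_subset hv.2.1)) hb
        have h2 := T.posDist_le_reach v
        have h3 := posDist_triangle (T.src v) (T.tgt v) z
        have h4 := posDist_triangle (T.tgt v) b z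
        omega

theorem Walk.block_subset_supp {x : Pos d} (w : T.Walk S k x) : T.block k x ⊆ w.supp := by
  classical
  intro z hz
  cases w <;> simp [Walk.supp, hz]

/-- The extra diameter is the passage from the entry point to the position b supplied by
`supp_le_wlen`. -/
theorem next_reach_le (hk : 1 ≤ k)
    (p : Σ b : {g : T.Graph // T.src g ∈ T.kept S k ∧ T.tgt g ∈ T.removed S k},
      T.Walk S k (T.tgt b.1)) :
    (T.next S k).reach (Sum.inr p) ≤ T.reach p.1.1 + p.2.wlen + connLen k := by
  classical
  obtain ⟨⟨b, hb1, hb2⟩, w⟩ := p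
  have hself := self_mem_block (k := k) (removed_subset hb2)
  have h1 := w.posDist_le_wlen hk _ hself
  have h2 := T.posDist_le_reach b
  refine reach_le ?_ ?_
  · have h3 := posDist_triangle (T.src b) (T.tgt b) w.tgt
    simp only [next, Sum.elim_inr]
    omega
  · intro z hz
    simp only [next, Sum.elim_inr, Finset.mem_union] at hz ⊢
    rcases hz with hz | hz
    · have h3 := T.le_reach hz
      have h4 := posDist_triangle z (T.tgt b) w.tgt
      omega
    · obtain ⟨a, ha, haz⟩ := w.supp_le_wlen hk z hz
      have h3 := posDist_le_connLen hk hb2 hself ha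
      have h4 := posDist_triangle (T.src b) (T.tgt b) z
      have h5 := posDist_triangle (T.tgt b) a z
      omega

/-- The entry point is a contained position, so even a multigraph that returns to its source has a
reach no smaller than its entering distance. -/
theorem le_next_reach
    (p : Σ b : {g : T.Graph // T.src g ∈ T.kept S k ∧ T.tgt g ∈ T.removed S k},
      T.Walk S k (T.tgt b.1)) :
    posDist (T.src p.1.1) (T.tgt p.1.1) ≤ (T.next S k).reach (Sum.inr p) := by
  classical
  obtain ⟨⟨b, hb1, hb2⟩, w⟩ := p
  have hz : T.tgt b ∈ (T.next S k).supp (Sum.inr ⟨⟨b, hb1, hb2⟩, w⟩) := by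
    simp only [next, Sum.elim_inr, Finset.mem_union]
    exact Or.inr (w.block_subset_supp (self_mem_block (removed_subset hb2)))
  have := le_reach hz
  simp only [next, Sum.elim_inr] at this ⊢
  omega

theorem not_mem_block_of_kept {x y : Pos d} (hx : x ∈ T.removed S k) (hy : y ∈ T.kept S k) :
    y ∉ T.block k x :=
  fun h => (mem_kept.1 hy).2 (removed_of_mem_block hx h)

/-- Multigraphs that start in a removed block and end at a kept position. -/
theorem reach_exit (hk : 2 ≤ k) {x : Pos d} (hx : x ∈ T.removed S k) {c : T.Graph}
    (hj : T.src c ∈ T.block k x) (hc : T.tgt c ∈ T.kept S k) : 4 * connLen k ≤ T.reach c :=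
  (four_connLen_le hk hx hj (mem_kept.1 hc).1 (not_mem_block_of_kept hx hc)).trans
    (T.posDist_le_reach c)

theorem reach_enter (hk : 2 ≤ k) {b : T.Graph} (hb : T.src b ∈ T.kept S k)
    (hb' : T.tgt b ∈ T.removed S k) : 4 * connLen k ≤ posDist (T.src b) (T.tgt b) := by
  rw [posDist_comm]
  exact four_connLen_le hk hb' (self_mem_block (removed_subset hb')) (mem_kept.1 hb).1
    (not_mem_block_of_kept hb' hb)

theorem ne_of_kept {x y : Pos d} (hx : x ∈ T.removed S k) (hy : y ∈ T.kept S k) : x ≠ y :=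
  fun h => (mem_kept.1 hy).2 (h ▸ hx)

theorem one_le_reach_exit {x : Pos d} (hx : x ∈ T.removed S k) {c : T.Graph}
    (hj : T.src c ∈ T.block k x) (hc : T.tgt c ∈ T.kept S k) : 1 ≤ T.reach c :=
  (one_le_posDist (ne_of_kept (removed_of_mem_block hx hj) hc)).trans (T.posDist_le_reach c)

theorem reach_outside (hk : 2 ≤ k) {v : T.Graph} (hv : T.IsLong S k v)
    (h : T.tgt v ∉ T.block k (T.src v)) : 4 * connLen k ≤ T.reach v :=
  (four_connLen_le hk hv.1 (self_mem_block (removed_subset hv.1)) (removed_subset hv.2.1) h).trans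
    (T.posDist_le_reach v)

/-- A nonlocal multigraph contains a position at distance at least L_{k-2} = L_k/4 from both of its
end points. -/
theorem len_le_reach_inside {v : T.Graph} (hv : T.IsLong S k v)
    (h : T.tgt v ∈ T.block k (T.src v)) : 1 / 2 * len k ≤ T.reach v := by
  have hl : ¬ T.Local k (T.block k (T.src v)) v := fun h' => hv.2.2 ⟨h, h'⟩
  unfold Local at hl
  push Not at hl
  obtain ⟨z, hz, hzb⟩ := hl
  have h1 := hzb _ (self_mem_block (removed_subset hv.1))
  have h2 := hzb _ h
  have h3 : ((posDist (T.src v) z + posDist z (T.tgt v) : ℕ) : ℝ) ≤ T.reach v := by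
    exact_mod_cast T.le_reach hz
  rw [posDist_comm z] at h1
  push_cast at h3
  have h4 : (1 / 2 : ℝ) * len k = 2 * len ((k : ℤ) - 2) := by
    simp only [len]
    rw [show (k : ℤ) - 1 = ((k : ℤ) - 2 - 1) + 2 by ring, zpow_add₀ (by norm_num)]
    norm_num
    ring
  linarith

theorem one_le_reach_long (hk : 1 ≤ k) {v : T.Graph} (hv : T.IsLong S k v) : 1 ≤ T.reach v := by
  by_cases h : T.tgt v ∈ T.block k (T.src v)
  · have h1 := len_le_reach_inside hv h
    have h2 := one_le_len hk
    by_contra h3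
    have h4 : T.reach v = 0 := by omega
    rw [h4] at h1
    norm_num at h1
    linarith
  · refine (one_le_posDist ?_).trans (T.posDist_le_reach v)
    intro h'
    exact h (h' ▸ self_mem_block (removed_subset hv.1))

/-- The last step leaves an isolated block, at least 4 L_k, and its block adds L_k; earlier steps
only lengthen the walk. -/
theorem Walk.le_wlen (hk : 2 ≤ k) {x : Pos d} (w : T.Walk S k x) : 5 * connLen k ≤ w.wlen := by
  induction w with
  | last c hx hj hc =>
    have := reach_exit hk hx hj hc
    simp only [Walk.wlen]
    omega
  | step v hx hj hv w ih =>
    simp only [Walk.wlen]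
    omega

theorem Walk.one_le_wlen {x : Pos d} (w : T.Walk S k x) : 1 ≤ w.wlen := by
  induction w with
  | last c hx hj hc =>
    have := one_le_reach_exit hx hj hc
    simp only [Walk.wlen]
    omega
  | step v hx hj hv w ih =>
    simp only [Walk.wlen]
    omega

theorem len_one : len ((1 : ℕ) : ℤ) = 1 := by simp [len]

theorem Walk.len_le_wlen (hk : 1 ≤ k) {x : Pos d} (w : T.Walk S k x) : len k ≤ w.wlen := by
  rcases hk.eq_or_lt with rfl | hk
  · rw [len_one]
    exact_mod_cast w.one_le_wlen
  · rw [len_eq_connLen hk]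
    have := w.le_wlen hk
    exact_mod_cast (by omega : connLen k ≤ w.wlen)

theorem len_le_next_reach (hk : 1 ≤ k)
    (p : Σ b : {g : T.Graph // T.src g ∈ T.kept S k ∧ T.tgt g ∈ T.removed S k},
      T.Walk S k (T.tgt b.1)) : len k ≤ (T.next S k).reach (Sum.inr p) := by
  have h := le_next_reach p
  rcases hk.eq_or_lt with rfl | hk
  · rw [len_one]
    exact_mod_cast (one_le_posDist (ne_of_kept p.1.2.2 p.1.2.1).symm).trans h
  · rw [len_eq_connLen hk]
    have := reach_enter hk p.1.2.1 p.1.2.2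
    exact_mod_cast (by omega : connLen k ≤ (T.next S k).reach (Sum.inr p))

/-- Prefixing one step saves 0.4 L_k^ψ in each of α ≥ 3 copies. The 1.2 must exceed 1, the exponent
of the resolvent; α ≤ 4 allows the stronger weight of the step to be used. -/
theorem step_gain (hk : 1 ≤ k) {x : Pos d} (v : T.Graph) (hx : x ∈ T.removed S k)
    (hj : T.src v ∈ T.block k x) (hv : T.IsLong S k v) (w : T.Walk S k (T.tgt v)) {α : ℝ}
    (h3 : 3 ≤ α) (h4 : α ≤ 4) :
    1.2 * len k ^ psi + α * ((Walk.step v hx hj hv w).wlen : ℝ) ^ psi ≤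
      α * (w.wlen : ℝ) ^ psi + 4 * (T.reach v : ℝ) ^ psi := by
  have hρ : 0 ≤ (T.reach v : ℝ) ^ psi := by positivity
  have hL : 0 ≤ len k ^ psi := Real.rpow_nonneg (zero_le_one.trans (one_le_len hk)) _
  suffices h : 0.4 * len k ^ psi ≤ (w.wlen : ℝ) ^ psi + (T.reach v : ℝ) ^ psi -
      ((Walk.step v hx hj hv w).wlen : ℝ) ^ psi by nlinarith
  rcases hk.eq_or_lt with rfl | hk
  · have := merge_unit (r := w.wlen) (ρ := T.reach v) (by exact_mod_cast w.one_le_wlen)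
      (by exact_mod_cast one_le_reach_long hk hv)
    have e : (Walk.step v hx hj hv w).wlen = w.wlen + T.reach v := by
      simp [Walk.wlen, connLen]
    rw [e, len_one, Real.one_rpow]
    push_cast
    linarith
  · have hr : (5 : ℝ) * len k ≤ w.wlen := by
      rw [len_eq_connLen hk]
      exact_mod_cast w.le_wlen hk
    have hL0 := zero_le_one.trans (one_le_len (by omega : 1 ≤ k))
    simp only [Walk.wlen]
    split_ifs with h
    · have := merge_inside hL0 hr (len_le_reach_inside hv h)
      push_cast
      rw [add_zero]
      linarith
    · have := merge_outside hL0 hr (ρ := T.reach v) (by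
        rw [len_eq_connLen hk]
        exact_mod_cast reach_outside hk hv h)
      rw [len_eq_connLen hk] at this hL ⊢
      push_cast
      linarith

/-- With α = 3 the final step keeps one spare copy of its own weight, which pays for the diameter of
the last block and for its resolvent. -/
theorem exit_gain (hk : 2 ≤ k) {x : Pos d} (c : T.Graph) (hx : x ∈ T.removed S k)
    (hj : T.src c ∈ T.block k x) (hc : T.tgt c ∈ T.kept S k) :
    1.3 * len k ^ psi + 3 * ((Walk.last c hx hj hc).wlen : ℝ) ^ psi ≤
      4 * (T.reach c : ℝ) ^ psi := by
  have := exit_block_three (zero_le_one.trans (one_le_len (by omega : 1 ≤ k))) (ρ := T.reach c) (by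
    rw [len_eq_connLen hk]
    exact_mod_cast reach_exit hk hx hj hc)
  simp only [Walk.wlen]
  rw [len_eq_connLen hk] at this ⊢
  push_cast
  linarith

/-- On the first scale there is no diameter to pay, and the spare copy gives 1, exactly the exponent
of the resolvent. -/
theorem exit_gain_one {x : Pos d} (c : T.Graph) (hx : x ∈ T.removed S 1)
    (hj : T.src c ∈ T.block 1 x) (hc : T.tgt c ∈ T.kept S 1) :
    1 + 3 * ((Walk.last c hx hj hc).wlen : ℝ) ^ psi ≤ 4 * (T.reach c : ℝ) ^ psi := by
  have h : (1 : ℝ) ≤ T.reach c := by exact_mod_cast one_le_reach_exit hx hj hc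
  have := Real.one_le_rpow h psi_pos.le
  simp only [Walk.wlen, connLen, if_true, add_zero]
  linarith

/-- The loss, in units of `L_k ^ ψ`, in the weight of a walk when it leaves its last block. -/
def exitLoss (k : ℕ) : ℝ := if k = 1 then 0 else 1.62

/-- With α = 4 there is no spare copy, so leaving the block costs 4·0.405 = 1.62 units. The debt is
settled in `enter_gain`. -/
theorem exit_loss (hk : 1 ≤ k) {x : Pos d} (c : T.Graph) (hx : x ∈ T.removed S k)
    (hj : T.src c ∈ T.block k x) (hc : T.tgt c ∈ T.kept S k) :
    4 * ((Walk.last c hx hj hc).wlen : ℝ) ^ psi ≤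
      4 * (T.reach c : ℝ) ^ psi + exitLoss k * len k ^ psi := by
  rcases hk.eq_or_lt with rfl | hk
  · simp [Walk.wlen, connLen, exitLoss]
  have := exit_block (zero_le_one.trans (one_le_len (by omega : 1 ≤ k))) (ρ := T.reach c) (by
    rw [len_eq_connLen hk]
    exact_mod_cast reach_exit hk hx hj hc)
  simp only [Walk.wlen, exitLoss, if_neg (show k ≠ 1 by omega)]
  rw [len_eq_connLen hk] at this ⊢
  push_cast
  linarith

/-- Joining the entering step to the walk saves at least 4·0.8 = 3.2 units for k ≥ 2, which covers
the exit loss 1.62 and 1.5 more; for k = 1 it saves 4·0.41 = 1.64. -/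
theorem enter_gain (hk : 1 ≤ k)
    (p : Σ b : {g : T.Graph // T.src g ∈ T.kept S k ∧ T.tgt g ∈ T.removed S k},
      T.Walk S k (T.tgt b.1)) :
    (exitLoss k + 1.5) * len k ^ psi + 4 * ((T.next S k).reach (Sum.inr p) : ℝ) ^ psi ≤
      4 * (T.reach p.1.1 : ℝ) ^ psi + 4 * (p.2.wlen : ℝ) ^ psi := by
  have h := next_reach_le hk p
  have h1 := rpow_psi_mono (Nat.cast_nonneg _) (Nat.cast_le (α := ℝ).2 h)
  have hL0 := zero_le_one.trans (one_le_len hk)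
  have hL := Real.rpow_nonneg hL0 psi
  push_cast at h1
  rcases hk.eq_or_lt with rfl | hk
  · have hb := (one_le_posDist (ne_of_kept p.1.2.2 p.1.2.1).symm).trans
      (T.posDist_le_reach p.1.1)
    have := merge_unit (r := p.2.wlen) (ρ := T.reach p.1.1) (by exact_mod_cast p.2.one_le_wlen)
      (by exact_mod_cast hb)
    simp only [connLen, if_true, Nat.cast_zero, add_zero] at h1
    rw [len_one, Real.one_rpow, exitLoss, if_pos rfl]
    rw [add_comm (p.2.wlen : ℝ)] at this
    linarith
  · have hr : (5 : ℝ) * len k ≤ p.2.wlen := by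
      rw [len_eq_connLen hk]
      exact_mod_cast p.2.le_wlen hk
    have hb := (reach_enter hk p.1.2.1 p.1.2.2).trans (T.posDist_le_reach p.1.1)
    have := merge_outside hL0 hr (ρ := T.reach p.1.1) (by
      rw [len_eq_connLen hk]
      exact_mod_cast hb)
    rw [exitLoss, if_neg (by omega)]
    rw [← len_eq_connLen hk, add_comm (T.reach p.1.1 : ℝ)] at h1
    linarith

end Stage

end Reach

end

noncomputable section

open scoped Matrix.Norms.L2Operator

/-! ### Resolvents of symmetric matrices. -/

section Resolvent
variable {n : Type*} [Fintype n] [DecidableEq n]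

/-- Schur's test: Cauchy–Schwarz with weights |A i j|, and symmetry turns column sums into row sums.
-/
theorem norm_le_of_symm_row_sums {A : Matrix n n ℝ} (hA : A.IsSymm) {R : ℝ}
    (hR : 0 ≤ R) (h : ∀ i, ∑ j, |A i j| ≤ R) : ‖A‖ ≤ R := by
  rw [Matrix.cstar_norm_def]
  refine ContinuousLinearMap.opNorm_le_bound _ hR fun v => ?_
  rw [EuclideanSpace.norm_eq, EuclideanSpace.norm_eq, ← Real.sqrt_sq hR,
    ← Real.sqrt_mul (sq_nonneg R)]
  apply Real.sqrt_le_sqrt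
  have h1 : ∀ i, ‖(Matrix.toEuclideanCLM (n := n) (𝕜 := ℝ) A v) i‖ ^ 2 ≤
      R * ∑ j, |A i j| * v j ^ 2 := by
    intro i
    have e : (Matrix.toEuclideanCLM (n := n) (𝕜 := ℝ) A v) i = ∑ j, A i j * v j := by
      rw [Matrix.ofLp_toEuclideanCLM]
      rfl
    rw [e, Real.norm_eq_abs, sq_abs]
    refine (Finset.sum_sq_le_sum_mul_sum_of_sq_le_mul Finset.univ (f := fun j => |A i j|)
      (g := fun j => |A i j| * v j ^ 2) (fun _ _ => abs_nonneg _) (fun _ _ => by positivity)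
      (fun j _ => le_of_eq ?_)).trans ?_
    · rw [← mul_assoc, abs_mul_abs_self]
      ring
    · exact mul_le_mul_of_nonneg_right (h i) (Finset.sum_nonneg fun _ _ => by positivity)
  calc _ ≤ ∑ i, R * ∑ j, |A i j| * v j ^ 2 := Finset.sum_le_sum fun i _ => h1 i
    _ = R * ∑ j, (∑ i, |A j i|) * v j ^ 2 := by
      rw [← Finset.mul_sum, Finset.sum_comm]
      congr 1
      refine Finset.sum_congr rfl fun j _ => ?_
      rw [Finset.sum_mul]
      exact Finset.sum_congr rfl fun i _ => by rw [hA.apply]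
    _ ≤ R * ∑ j, R * v j ^ 2 := by
      gcongr with j
      exact h j
    _ = R ^ 2 * ∑ i, ‖v i‖ ^ 2 := by
      rw [← Finset.mul_sum, ← mul_assoc, sq]
      simp

/-- Parseval in an orthonormal eigenbasis of A; this is where symmetry is indispensable. -/
theorem norm_sub_ge_of_spectrum {A : Matrix n n ℝ} (hA : A.IsSymm) {E ε : ℝ} (hε : 0 ≤ ε)
    (h : ∀ μ ∈ spectrum ℝ A, ε ≤ |μ - E|) (v : EuclideanSpace ℝ n) :
    ε * ‖v‖ ≤ ‖Matrix.toEuclideanCLM (n := n) (𝕜 := ℝ) (A - E • 1) v‖ := by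
  have hH : A.IsHermitian := by
    rw [Matrix.IsHermitian, Matrix.conjTranspose_eq_transpose_of_trivial]
    exact hA
  set T := Matrix.toEuclideanCLM (n := n) (𝕜 := ℝ) (A - E • 1) with hT
  have hsymm : (A - E • 1).transpose = A - E • 1 := by
    rw [Matrix.transpose_sub, Matrix.transpose_smul, Matrix.transpose_one, hA]
  have key : ∀ i, inner ℝ (hH.eigenvectorBasis i) (T v) =
      (hH.eigenvalues i - E) * inner ℝ (hH.eigenvectorBasis i) v := by
    intro i
    have e1 : inner ℝ (hH.eigenvectorBasis i) (T v) = inner ℝ (T (hH.eigenvectorBasis i)) v := by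
      have hadj : star T = T := by
        rw [hT, ← map_star, Matrix.star_eq_conjTranspose,
          Matrix.conjTranspose_eq_transpose_of_trivial, hsymm]
      rw [← ContinuousLinearMap.adjoint_inner_left, ← ContinuousLinearMap.star_eq_adjoint, hadj]
    have e2 : T (hH.eigenvectorBasis i) = (hH.eigenvalues i - E) • hH.eigenvectorBasis i := by
      rw [hT, map_sub, map_smul, map_one, sub_smul, _root_.sub_apply]
      congr 1
      ext j
      rw [Matrix.ofLp_toEuclideanCLM, hH.mulVec_eigenvectorBasis]
      rfl
    rw [e1, e2, real_inner_smul_left]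
  have h2 : (ε * ‖v‖) ^ 2 ≤ ‖T v‖ ^ 2 := by
    rw [mul_pow, ← hH.eigenvectorBasis.sum_sq_norm_inner_right v,
      ← hH.eigenvectorBasis.sum_sq_norm_inner_right (T v), Finset.mul_sum]
    refine Finset.sum_le_sum fun i _ => ?_
    rw [key i, norm_mul, mul_pow]
    have := h _ (hH.eigenvalues_mem_spectrum_real i)
    rw [Real.norm_eq_abs (hH.eigenvalues i - E)]
    gcongr
  exact le_of_sq_le_sq h2 (norm_nonneg _)

theorem isUnit_and_norm_inv_le {B : Matrix n n ℝ} {c : ℝ} (hc : 0 < c)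
    (h : ∀ v, c * ‖v‖ ≤ ‖Matrix.toEuclideanCLM (n := n) (𝕜 := ℝ) B v‖) :
    IsUnit B ∧ ‖B⁻¹‖ ≤ 1 / c := by
  have hu : IsUnit B := by
    rw [← Matrix.mulVec_injective_iff_isUnit]
    intro v w hvw
    have h1 := h (WithLp.toLp 2 (v - w))
    have h2 : Matrix.toEuclideanCLM (n := n) (𝕜 := ℝ) B (WithLp.toLp 2 (v - w)) = 0 := by
      rw [Matrix.toEuclideanCLM_toLp, Matrix.mulVec_sub, sub_eq_zero.2 hvw]
      rfl
    rw [h2, norm_zero] at h1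
    have h3 : ‖(WithLp.toLp 2 (v - w) : EuclideanSpace ℝ n)‖ = 0 :=
      le_antisymm (nonpos_of_mul_nonpos_right h1 hc) (norm_nonneg _)
    have h4 := congrArg WithLp.ofLp (norm_eq_zero.1 h3)
    exact sub_eq_zero.1 h4
  refine ⟨hu, ?_⟩
  rw [Matrix.cstar_norm_def]
  refine ContinuousLinearMap.opNorm_le_bound _ (by positivity) fun v => ?_
  have h1 := h (Matrix.toEuclideanCLM (n := n) (𝕜 := ℝ) B⁻¹ v)
  rw [← _root_.mul_apply_eq_comp, ← map_mul,
    Matrix.mul_nonsing_inv _ ((Matrix.isUnit_iff_isUnit_det _).1 hu), map_one] at h1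
  rw [one_div, inv_mul_eq_div, le_div_iff₀ hc, mul_comm]
  exact h1

/-- Stability of the resolvent of a family of symmetric matrices near an energy that is at distance
`ε` from the spectrum. -/
theorem resolvent_bounds {A A' : Matrix n n ℝ} (hA : A.IsSymm) (hA' : A'.IsSymm) {l E ε : ℝ}
    (hε : 0 < ε) (hl : |l - E| ≤ ε / 2) (hrow : ∀ i, ∑ j, |(A - A') i j| ≤ |l - E| / 2)
    (hspec : ∀ μ ∈ spectrum ℝ A', ε ≤ |μ - E|) :
    IsUnit (A - l • 1) ∧ IsUnit (A' - E • 1) ∧ ‖(A - l • 1)⁻¹‖ ≤ 4 / ε ∧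
      ‖(A' - E • 1)⁻¹‖ ≤ 4 / ε ∧
      ‖(A - l • 1)⁻¹ - (A' - E • 1)⁻¹‖ ≤ 6 * |l - E| / ε ^ 2 := by
  have hd : ‖A - A'‖ ≤ |l - E| / 2 :=
    norm_le_of_symm_row_sums (hA.sub hA') (by positivity) hrow
  have hd2 : ‖(A - l • 1) - (A' - E • 1)‖ ≤ 3 / 2 * |l - E| := by
    -- Over an empty index set `1` equals `0`, so its norm is not 1.
    rcases isEmpty_or_nonempty n with hn | hn
    · rw [Subsingleton.elim ((A - l • 1) - (A' - E • 1)) 0, norm_zero]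
      positivity
    have e : (A - l • 1) - (A' - E • 1) = (A - A') - (l - E) • 1 := by
      rw [sub_smul]
      abel
    rw [e]
    refine (norm_sub_le _ _).trans ?_
    rw [norm_smul, norm_one, mul_one, Real.norm_eq_abs]
    linarith
  have h1 := isUnit_and_norm_inv_le hε (norm_sub_ge_of_spectrum hA' hε.le hspec)
  have h2 : IsUnit (A - l • 1) ∧ ‖(A - l • 1)⁻¹‖ ≤ 1 / (ε / 4) := by
    refine isUnit_and_norm_inv_le (by positivity) fun v => ?_
    have e : A' - E • 1 = (A - l • 1) - ((A - l • 1) - (A' - E • 1)) := by abel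
    have h3 := norm_sub_ge_of_spectrum hA' hε.le hspec v
    rw [e, map_sub, _root_.sub_apply] at h3
    have h4 := norm_sub_le (Matrix.toEuclideanCLM (n := n) (𝕜 := ℝ) (A - l • 1) v)
      (Matrix.toEuclideanCLM (n := n) (𝕜 := ℝ) ((A - l • 1) - (A' - E • 1)) v)
    have h5 := (Matrix.toEuclideanCLM (n := n) (𝕜 := ℝ)
      ((A - l • 1) - (A' - E • 1))).le_opNorm v
    rw [← Matrix.cstar_norm_def] at h5
    -- The perturbation is at most (3/2)(ε/2) = 3ε/4, leaving ε/4 of the spectral gap.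
    have h6 : ‖(A - l • 1) - (A' - E • 1)‖ * ‖v‖ ≤ (3 / 4 * ε) * ‖v‖ := by
      gcongr
      linarith
    linarith
  have e4 : 1 / (ε / 4) = 4 / ε := by field_simp
  rw [e4] at h2
  refine ⟨h2.1, h1.1, h2.2, h1.2.trans (by gcongr; norm_num), ?_⟩
  have e : (A - l • 1)⁻¹ - (A' - E • 1)⁻¹ =
      (A - l • 1)⁻¹ * (((A' - E • 1) - (A - l • 1)) * (A' - E • 1)⁻¹) := by
    rw [sub_mul, Matrix.mul_nonsing_inv _ ((Matrix.isUnit_iff_isUnit_det _).1 h1.1), mul_sub,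
      mul_one, ← mul_assoc, Matrix.nonsing_inv_mul _ ((Matrix.isUnit_iff_isUnit_det _).1 h2.1),
      one_mul]
  rw [e]
  refine (norm_mul_le _ _).trans ?_
  have h3 : ‖((A' - E • 1) - (A - l • 1)) * (A' - E • 1)⁻¹‖ ≤ 3 / 2 * |l - E| * (1 / ε) := by
    refine (norm_mul_le _ _).trans ?_
    rw [norm_sub_rev]
    gcongr
    exact h1.2
  calc _ ≤ 4 / ε * (3 / 2 * |l - E| * (1 / ε)) := by
        gcongr
        exact h2.2
    _ = _ := by
        field_simp
        ring

/-- Blocks inherit the matrix bounds up to a factor 4, giving 16/ε for the size and 24/ε for the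
weighted difference. If δ = 0 the factor ε/|δ| is 0 by convention and the second part disappears. -/
theorem pairNorm_resolvent {A A' : Mat2} {B B' : Matrix n n ℝ} {δ ε : ℝ} (hε : 0 < ε)
    (hB : ‖B‖ ≤ 4 / ε) (hB' : ‖B'‖ ≤ 4 / ε) (hd : ‖B - B'‖ ≤ 6 * |δ| / ε ^ 2) (f g : Fin 2 → n)
    (hA : ∀ i j, A i j = B (f i) (g j)) (hA' : ∀ i j, A' i j = B' (f i) (g j)) :
    pairNorm (ε / |δ|) A A' ≤ 40 / ε := by
  have h1 : ‖A‖ ≤ 4 * (4 / ε) :=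
    norm_le_of_entries A fun i j => hA i j ▸ (abs_entry_le_norm B _ _).trans hB
  have h2 : ‖A'‖ ≤ 4 * (4 / ε) :=
    norm_le_of_entries A' fun i j => hA' i j ▸ (abs_entry_le_norm B' _ _).trans hB'
  have h3 : ‖A - A'‖ ≤ 4 * (6 * |δ| / ε ^ 2) := by
    refine norm_le_of_entries _ fun i j => ?_
    rw [Matrix.sub_apply, hA, hA', ← Matrix.sub_apply]
    exact (abs_entry_le_norm _ _ _).trans hd
  have h4 : ε / |δ| * ‖A - A'‖ ≤ 24 / ε := by
    rcases eq_or_ne δ 0 with rfl | hδ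
    · rw [abs_zero, div_zero, zero_mul]
      positivity
    · have : 0 < |δ| := abs_pos.2 hδ
      calc _ ≤ ε / |δ| * (4 * (6 * |δ| / ε ^ 2)) := by gcongr
        _ = 24 / ε := by
          field_simp
          ring
  have h5 : max ‖A‖ ‖A'‖ ≤ 16 / ε := max_le (h1.trans_eq (by ring)) (h2.trans_eq (by ring))
  calc _ ≤ 16 / ε + 24 / ε := add_le_add h5 h4
    _ = 40 / ε := by ring

end Resolvent

end

noncomputable section

open scoped Matrix.Norms.L2Operator

/-! ### First-step decomposition of walk sums. -/

section Fixpoint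

/-- Summability is only required fibrewise, since finitely many labels occur. -/
theorem tsum_fiber {ι α : Type*} (τ : ι → α) (B : Finset α) (f : ι → Mat2)
    (h : ∀ i, f i ≠ 0 → τ i ∈ B) (hs : ∀ b ∈ B, Summable fun i => pick (τ i = b) (f i)) :
    ∑' i, f i = ∑ b ∈ B, ∑' i, pick (τ i = b) (f i) := by
  rw [← Summable.tsum_finsetSum hs]
  exact tsum_congr fun i => (sum_pick_eq (h i)).symm

theorem summable_fiber {ι α : Type*} (τ : ι → α) (B : Finset α) (f : ι → Mat2)
    (h : ∀ i, f i ≠ 0 → τ i ∈ B) (hs : ∀ b ∈ B, Summable fun i => pick (τ i = b) (f i)) :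
    Summable f := by
  exact (summable_sum hs).congr fun i => sum_pick_eq (h i)

variable {d : ℕ} {S : Setup d} {T : Stage d} {k : ℕ} {l : ℝ}

namespace Stage

/-- The multigraph contains only positions in `Z`. -/
def Inside (T : Stage d) (Z : Set (Pos d)) (g : T.Graph) : Prop := ∀ z ∈ T.supp g, z ∈ Z

/-- The walk contains only positions in `Z`. -/
def Walk.Inside (Z : Set (Pos d)) {x : Pos d} (w : T.Walk S k x) : Prop := ∀ z ∈ w.supp, z ∈ Z

/-- The sum of the multigraphs from `x` to `y` that contain only positions in `Z`. -/
def gsum (T : Stage d) (Z : Set (Pos d)) (l : ℝ) (x y : Pos d) : Mat2 :=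
  ∑' g : T.Graph, pick (T.src g = x ∧ T.tgt g = y ∧ T.Inside Z g) (T.val l g)

/-- The sum of the multigraphs of `V` from `x` to `y` that contain only positions in `Z`. -/
def vsum (S : Setup d) (T : Stage d) (k : ℕ) (Z : Set (Pos d)) (l : ℝ) (x y : Pos d) : Mat2 :=
  ∑' g : T.Graph, pick (T.src g = x ∧ T.tgt g = y ∧ T.Inside Z g ∧ T.IsLong S k g) (T.val l g)

/-- The sum of the walks from `x` to `y` that contain only positions in `Z`. -/
def wsum (S : Setup d) (T : Stage d) (k : ℕ) (Z : Set (Pos d)) (l : ℝ) (x y : Pos d) : Mat2 :=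
  ∑' w : T.Walk S k x, pick (w.tgt = y ∧ w.Inside Z) (w.val l)

/-- The sums of multigraphs from a given position converge absolutely. -/
def AbsConv (T : Stage d) (l : ℝ) : Prop :=
  ∀ x, ∑' g : {g : T.Graph // T.src g = x}, ENNReal.ofReal ‖T.val l g.1‖ ≠ ⊤

/-- The sums of walks from a given position converge absolutely. -/
def WalkConv (S : Setup d) (T : Stage d) (k : ℕ) (l : ℝ) : Prop :=
  ∀ x, ∑' w : T.Walk S k x, ENNReal.ofReal ‖w.val l‖ ≠ ⊤

theorem AbsConv.summable (hT : T.AbsConv l) (x : Pos d) (p : T.Graph → Prop) :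
    Summable fun g => pick (T.src g = x ∧ p g) (T.val l g) := by
  refine summable_of_tsum_ofReal_norm ?_
  refine ne_top_of_le_ne_top (hT x) ?_
  rw [tsum_subtype_pick (fun g => T.src g = x) fun g => ENNReal.ofReal ‖T.val l g‖]
  refine ENNReal.tsum_le_tsum fun g => ?_
  by_cases h1 : T.src g = x <;> by_cases h2 : p g <;> simp [h1, h2]

theorem WalkConv.summable (hW : WalkConv S T k l) (x : Pos d) (p : T.Walk S k x → Prop) :
    Summable fun w => pick (p w) (w.val l) := by
  refine summable_of_tsum_ofReal_norm ?_
  refine ne_top_of_le_ne_top (hW x) ?_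
  refine ENNReal.tsum_le_tsum fun g => ?_
  by_cases h2 : p g <;> simp [h2]

theorem wsum_eq_zero_of_not_removed {Z : Set (Pos d)} {x : Pos d} (hx : x ∉ T.removed S k)
    (y : Pos d) : wsum S T k Z l x y = 0 := by
  have : IsEmpty (T.Walk S k x) := ⟨fun w => hx w.start_removed⟩
  exact tsum_empty

/-- A walk contains its entire starting block, so none is admissible if the block is not inside Z.
-/
theorem wsum_eq_zero_of_not_subset {Z : Set (Pos d)} {x : Pos d}
    (hx : ¬ ∀ z ∈ T.block k x, z ∈ Z) (y : Pos d) : wsum S T k Z l x y = 0 := by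
  refine (tsum_congr fun w => ?_).trans tsum_zero
  refine pick_neg (fun h => hx fun z hz => ?_) _
  exact h.2 z (w.block_subset_supp hz)

theorem tsum_walk_mat (x : Pos d) {f : T.Walk S k x → Mat2} (hf : Summable f) :
    ∑' w, f w =
      ∑' c : {c : T.Graph // x ∈ T.removed S k ∧ T.src c ∈ T.block k x ∧ T.tgt c ∈ T.kept S k},
        f (.last c.1 c.2.1 c.2.2.1 c.2.2.2) +
      ∑' v : {v : T.Graph // x ∈ T.removed S k ∧ T.src v ∈ T.block k x ∧ T.IsLong S k v},
        ∑' w : T.Walk S k (T.tgt v.1), f (.step v.1 v.2.1 v.2.2.1 v.2.2.2 w) := by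
  have hf' := (walkEquiv S T k x).symm.summable_iff.2 hf
  have hr := hf'.comp_injective Sum.inr_injective
  rw [← (walkEquiv S T k x).symm.tsum_eq f]
  refine (Summable.tsum_sum (hf'.comp_injective Sum.inl_injective) hr).trans ?_
  exact congrArg _ hr.tsum_sigma

/-- Sums over multigraphs that start in a finite set, with a prefactor that depends on the starting
point and a suffix that depends on the end point. -/
theorem tsum_start_end (hT : T.AbsConv l) (B B' : Finset (Pos d)) (p : T.Graph → Prop)
    (hp : ∀ g, p g → T.tgt g ∈ B') (J X : Pos d → Mat2) :
    ∑' g : {g : T.Graph // T.src g ∈ B ∧ p g}, J (T.src g.1) * (T.val l g.1 * X (T.tgt g.1)) =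
      ∑ a ∈ B, J a * ∑ b ∈ B',
        (∑' g : T.Graph, pick (T.src g = a ∧ T.tgt g = b ∧ p g) (T.val l g)) * X b := by
  have s1 : ∀ a b, Summable fun g : T.Graph =>
      pick (T.src g = a ∧ T.tgt g = b ∧ p g) (T.val l g) * X b :=
    fun a b => (hT.summable a _).mul_right _
  have e1 : ∀ a b, (fun g : T.Graph => pick (T.tgt g = b)
      (pick (T.src g = a ∧ p g) (T.val l g) * X (T.tgt g))) =
      fun g => pick (T.src g = a ∧ T.tgt g = b ∧ p g) (T.val l g) * X b := by
    intro a b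
    funext g
    by_cases h1 : T.tgt g = b
    · simp [h1]
    · simp [h1]
  have m1 : ∀ a (g : T.Graph), pick (T.src g = a ∧ p g) (T.val l g) * X (T.tgt g) ≠ 0 →
      T.tgt g ∈ B' := by
    intro a g h
    by_contra h'
    exact h (by rw [pick_neg fun h2 => h' (hp g h2.2), zero_mul])
  have s2 : ∀ a, Summable fun g : T.Graph =>
      pick (T.src g = a ∧ p g) (T.val l g) * X (T.tgt g) := by
    intro a
    refine summable_fiber T.tgt B' _ (m1 a) fun b _ => ?_
    rw [e1]
    exact s1 a b
  have e2 : ∀ a ∈ B, (fun g : T.Graph => pick (T.src g = a)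
      (pick (T.src g ∈ B ∧ p g) (J (T.src g) * (T.val l g * X (T.tgt g))))) =
      fun g => J a * (pick (T.src g = a ∧ p g) (T.val l g) * X (T.tgt g)) := by
    intro a ha
    funext g
    by_cases h1 : T.src g = a
    · subst h1
      by_cases h2 : p g <;> simp [h2, ha]
    · simp [h1]
  rw [tsum_subtype_pick _ fun g => J (T.src g) * (T.val l g * X (T.tgt g)),
    tsum_fiber T.src B]
  · refine Finset.sum_congr rfl fun a ha => ?_
    rw [e2 a ha, (s2 a).tsum_mul_left, tsum_fiber T.tgt B' _ (m1 a) fun b _ => by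
      rw [e1]
      exact s1 a b]
    congr 1
    refine Finset.sum_congr rfl fun b _ => ?_
    rw [e1, (hT.summable a _).tsum_mul_right]
  · intro g hg
    by_contra h
    exact hg (pick_neg (fun h' => h h'.1) _)
  · intro a ha
    rw [e2 a ha]
    exact (s2 a).mul_left _

theorem tsum_last_steps (hT : T.AbsConv l) {Z : Set (Pos d)} {x : Pos d}
    (hx : x ∈ T.removed S k) {y : Pos d} (hy : y ∈ T.kept S k) :
    ∑' c : {c : T.Graph // x ∈ T.removed S k ∧ T.src c ∈ T.block k x ∧ T.tgt c ∈ T.kept S k},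
      pick (T.tgt c.1 = y ∧ T.Inside Z c.1) (-(T.invBlock k l x (T.src c.1) * T.val l c.1)) =
      -∑ a ∈ T.block k x, T.invBlock k l x a * T.gsum Z l a y := by
  have h := tsum_start_end hT (T.block k x) {y} (fun g => T.tgt g = y ∧ T.Inside Z g)
    (fun g h => Finset.mem_singleton.2 h.1) (T.invBlock k l x) (fun _ => 1)
  simp only [mul_one, Finset.sum_singleton] at h
  rw [tsum_subtype_pick _ fun c => pick (T.tgt c = y ∧ T.Inside Z c)
    (-(T.invBlock k l x (T.src c) * T.val l c))]
  rw [tsum_subtype_pick _ fun g => T.invBlock k l x (T.src g) * T.val l g] at h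
  simp only [pick_neg_eq, tsum_neg, ← pick_and]
  congr 1
  refine Eq.trans (tsum_congr fun c => pick_congr ?_ _) (h.trans ?_)
  · constructor
    · rintro ⟨⟨_, h2, _⟩, h4, h5⟩
      exact ⟨h2, h4, h5⟩
    · rintro ⟨h2, h4, h5⟩
      exact ⟨⟨hx, h2, h4 ▸ hy⟩, h4, h5⟩
  · refine Finset.sum_congr rfl fun a _ => congrArg _ (tsum_congr fun g => pick_congr ?_ _)
    tauto

theorem tsum_inner_steps (hT : T.AbsConv l) {Z : Set (Pos d)} {x : Pos d}
    (hx : x ∈ T.removed S k) (X : Pos d → Mat2) :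
    ∑' v : {v : T.Graph // x ∈ T.removed S k ∧ T.src v ∈ T.block k x ∧ T.IsLong S k v},
      pick (T.Inside Z v.1)
        (-(T.invBlock k l x (T.src v.1) * T.val l v.1 * X (T.tgt v.1))) =
      -∑ a ∈ T.block k x, T.invBlock k l x a *
        ∑ b ∈ T.removed S k, vsum S T k Z l a b * X b := by
  have h := tsum_start_end hT (T.block k x) (T.removed S k)
    (fun g => T.Inside Z g ∧ T.IsLong S k g)
    (fun g h => h.2.2.1) (T.invBlock k l x) X
  rw [tsum_subtype_pick _ fun v => pick (T.Inside Z v)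
    (-(T.invBlock k l x (T.src v) * T.val l v * X (T.tgt v)))]
  rw [tsum_subtype_pick _ fun g => T.invBlock k l x (T.src g) * (T.val l g * X (T.tgt g))] at h
  simp only [pick_neg_eq, tsum_neg, ← pick_and, mul_assoc]
  congr 1
  refine Eq.trans (tsum_congr fun c => pick_congr ?_ _) h
  tauto

/-- The first-step decomposition of the sums over walks. -/
theorem wsum_eq (hT : T.AbsConv l) (hW : WalkConv S T k l) {Z : Set (Pos d)} {x : Pos d}
    (hx : x ∈ T.removed S k) (hZ : ∀ z ∈ T.block k x, z ∈ Z) {y : Pos d} (hy : y ∈ T.kept S k) :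
    wsum S T k Z l x y = -∑ a ∈ T.block k x, T.invBlock k l x a *
      (T.gsum Z l a y + ∑ b ∈ T.removed S k, vsum S T k Z l a b * wsum S T k Z l b y) := by
  simp only [mul_add, Finset.sum_add_distrib, neg_add]
  rw [← tsum_last_steps hT hx hy, ← tsum_inner_steps hT hx fun b => wsum S T k Z l b y]
  refine (tsum_walk_mat x (hW.summable x fun w => w.tgt = y ∧ w.Inside Z)).trans ?_
  congr 1
  · refine tsum_congr fun c => pick_congr ?_ _
    refine and_congr_right fun _ => ?_
    change (∀ z ∈ T.block k x ∪ T.supp c.1, z ∈ Z) ↔ ∀ z ∈ T.supp c.1, z ∈ Z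
    simp only [Finset.mem_union]
    exact ⟨fun h z hz => h z (Or.inr hz), fun h z hz => hz.elim (hZ z) (h z)⟩
  · refine tsum_congr fun v => ?_
    by_cases hv : T.Inside Z v.1
    · rw [pick_pos hv, wsum, ← (hW.summable _ _).tsum_mul_left, ← tsum_neg]
      refine tsum_congr fun w => ?_
      have hiff : (Walk.step v.1 v.2.1 v.2.2.1 v.2.2.2 w).Inside Z ↔ w.Inside Z := by
        change (∀ z ∈ T.block k x ∪ T.supp v.1 ∪ w.supp, z ∈ Z) ↔ ∀ z ∈ w.supp, z ∈ Z
        simp only [Finset.mem_union]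
        exact ⟨fun h z hz => h z (Or.inr hz),
          fun h z hz => hz.elim (fun hz => hz.elim (hZ z) (hv z)) (h z)⟩
      rw [hiff]
      change pick (w.tgt = y ∧ w.Inside Z)
        (-(T.invBlock k l x (T.src v.1) * T.val l v.1 * w.val l)) = _
      by_cases hw : w.tgt = y ∧ w.Inside Z
      · rw [pick_pos hw, pick_pos hw]
      · rw [pick_neg hw, pick_neg hw, mul_zero, neg_zero]
    · rw [pick_neg hv]
      refine (tsum_congr fun w => ?_).trans tsum_zero
      refine pick_neg (fun h => hv fun z hz => h.2 z ?_) _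
      change z ∈ T.block k x ∪ T.supp v.1 ∪ w.supp
      simp [hz]

end Stage

end Fixpoint

end

noncomputable section

open scoped Matrix.Norms.L2Operator

/-! ### Reversal symmetry of the multigraph sums. -/

section Symmetry
variable {d : ℕ} {S : Setup d} {T : Stage d} {k : ℕ} {l : ℝ}

namespace Stage

/-- The positions at distance less than `L_{k-2}` of `B`. -/
def near (k : ℕ) (B : Finset (Pos d)) : Set (Pos d) :=
  {z | ∃ b ∈ B, (posDist z b : ℝ) < len ((k : ℤ) - 2)}

theorem hasSum_apply {ι : Type*} {f : ι → Mat2} (hf : Summable f) (i j : Fin 2) :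
    HasSum (fun x => f x i j) ((∑' x, f x) i j) :=
  Pi.hasSum.1 (Pi.hasSum.1 hf.hasSum i) j

theorem AbsConv.hasSum_gsum (hT : T.AbsConv l) (Z : Set (Pos d)) (x y : Pos d) (i j : Fin 2) :
    HasSum (fun g : {g : T.Graph // T.src g = x ∧ T.tgt g = y ∧ T.Inside Z g} =>
      T.val l g.1 i j) (T.gsum Z l x y i j) := by
  have h : HasSum _ (T.gsum Z l x y i j) :=
    hasSum_apply (hT.summable x fun g => T.tgt g = y ∧ T.Inside Z g) i j
  refine (hasSum_subtype_iff_indicator (s := {g | T.src g = x ∧ T.tgt g = y ∧ T.Inside Z g})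
    (f := fun g => T.val l g i j)).2 ?_
  convert h using 1
  funext g
  by_cases hg : T.src g = x ∧ T.tgt g = y ∧ T.Inside Z g
  · rw [Set.indicator_of_mem (by exact hg), pick_pos hg]
  · rw [Set.indicator_of_notMem (by exact hg), pick_neg hg]
    rfl

theorem trunc_apply (hT : T.AbsConv l) (B : Finset (Pos d)) (s t : Sites B) :
    T.trunc k B l s t = T.gsum (near k B) l s.1 t.1 s.2 t.2 :=
  (hT.hasSum_gsum (near k B) s.1 t.1 s.2 t.2).tsum_eq

/-- Reversal symmetry of the sums of multigraphs. -/
def Reversible (T : Stage d) (l : ℝ) : Prop :=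
  ∀ (Z : Set (Pos d)) (x y : Pos d), T.gsum Z l x y = (T.gsum Z l y x).transpose

/-- The truncation restricts the positions contained in a multigraph, which is why `Reversible`
quantifies over all sets Z. -/
theorem trunc_isSymm (hT : T.AbsConv l) (hR : T.Reversible l) (B : Finset (Pos d)) :
    (T.trunc k B l).IsSymm := by
  ext s t
  rw [Matrix.transpose_apply, trunc_apply hT, trunc_apply hT, hR]
  rfl

/-- The resolvents of the truncated matrices of the removed blocks exist. -/
def BlockInv (S : Setup d) (T : Stage d) (k : ℕ) (l : ℝ) : Prop :=
  ∀ x ∈ T.removed S k, IsUnit (T.trunc k (T.block k x) l - l • 1)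

theorem mul_apply_sites {B : Finset (Pos d)} {M N : Matrix (Sites B) (Sites B) ℝ}
    {f g : Pos d → Pos d → Mat2} (hM : ∀ s t : Sites B, M s t = f s.1 t.1 s.2 t.2)
    (hN : ∀ s t : Sites B, N s t = g s.1 t.1 s.2 t.2) (s t : Sites B) :
    (M * N) s t = (∑ b ∈ B, f s.1 b * g b t.1) s.2 t.2 := by
  rw [Matrix.mul_apply, Fintype.sum_prod_type, Finset.univ_eq_attach, Matrix.sum_apply,
    ← Finset.sum_attach B fun b => (f s.1 b * g b t.1) s.2 t.2]
  refine Finset.sum_congr rfl fun b _ => ?_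
  rw [Matrix.mul_apply]
  exact Finset.sum_congr rfl fun m _ => by rw [hM, hN]

theorem smul_one_apply_sites (B : Finset (Pos d)) (c : ℝ) (s t : Sites B) :
    (c • (1 : Matrix (Sites B) (Sites B) ℝ)) s t = (pick (s.1.1 = t.1.1) (c • 1) : Mat2) s.2 t.2 := by
  obtain ⟨⟨x, hx⟩, i⟩ := s
  obtain ⟨⟨y, hy⟩, j⟩ := t
  by_cases h : x = y
  · subst h
    rw [pick_pos rfl]
    simp [Matrix.one_apply]
  · rw [pick_neg h]
    simp [h]

theorem trunc_sub_apply (hT : T.AbsConv l) (B : Finset (Pos d)) (s t : Sites B) :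
    (T.trunc k B l - l • 1) s t =
      (T.gsum (near k B) l s.1 t.1 - pick (s.1.1 = t.1.1) (l • 1)) s.2 t.2 := by
  rw [Matrix.sub_apply, trunc_apply hT, smul_one_apply_sites]
  rfl

theorem invBlock_apply {x : Pos d} (hx : x ∈ T.R) (s t : Sites (T.block k x)) :
    (T.trunc k (T.block k x) l - l • 1)⁻¹ s t = T.invBlock k l s.1 t.1 s.2 t.2 := by
  have hb : T.block k s.1 = T.block k x := block_eq hx s.1.2
  have hh : (s.1.1 ∈ T.block k s.1 ∧ t.1.1 ∈ T.block k s.1) := by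
    rw [hb]
    exact ⟨s.1.2, t.1.2⟩
  have e3 : T.invBlock k l s.1 t.1 = _ := dif_pos hh
  have aux : ∀ (B B' : Finset (Pos d)) (e : B = B') (h1 : s.1.1 ∈ B) (h2 : t.1.1 ∈ B),
      (T.trunc k B l - l • 1)⁻¹ (⟨s.1, h1⟩, s.2) (⟨t.1, h2⟩, t.2) =
      (T.trunc k B' l - l • 1)⁻¹ (⟨s.1, e ▸ h1⟩, s.2) (⟨t.1, e ▸ h2⟩, t.2) := by
    rintro B B' rfl h1 h2
    rfl
  exact ((congrFun (congrFun e3 s.2) t.2).trans (aux _ _ hb _ _)).symm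

theorem block_mul_inv (hT : T.AbsConv l) (hI : BlockInv S T k l) {x y a : Pos d}
    (hx : x ∈ T.removed S k) (hy : y ∈ T.block k x) (ha : a ∈ T.block k x) :
    ∑ b ∈ T.block k x, (T.gsum (near k (T.block k x)) l y b - pick (y = b) (l • 1)) *
      T.invBlock k l b a = pick (y = a) 1 := by
  ext i j
  have h1 := mul_apply_sites (f := fun y b => T.gsum (near k (T.block k x)) l y b -
    pick (y = b) (l • 1)) (trunc_sub_apply hT (T.block k x)) (invBlock_apply (l := l) (removed_subset hx))
    (⟨y, hy⟩, i) (⟨a, ha⟩, j)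
  have h2 := smul_one_apply_sites (T.block k x) 1 (⟨y, hy⟩, i) (⟨a, ha⟩, j)
  rw [Matrix.mul_nonsing_inv _ ((Matrix.isUnit_iff_isUnit_det _).1 (hI x hx))] at h1
  rw [one_smul, one_smul] at h2
  exact h1.symm.trans h2

theorem inv_mul_block (hT : T.AbsConv l) (hI : BlockInv S T k l) {x y a : Pos d}
    (hx : x ∈ T.removed S k) (hy : y ∈ T.block k x) (ha : a ∈ T.block k x) :
    ∑ b ∈ T.block k x, T.invBlock k l y b *
      (T.gsum (near k (T.block k x)) l b a - pick (b = a) (l • 1)) = pick (y = a) 1 := by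
  ext i j
  have h1 := mul_apply_sites (g := fun y b => T.gsum (near k (T.block k x)) l y b -
    pick (y = b) (l • 1)) (invBlock_apply (l := l) (removed_subset hx)) (trunc_sub_apply hT (T.block k x))
    (⟨y, hy⟩, i) (⟨a, ha⟩, j)
  have h2 := smul_one_apply_sites (T.block k x) 1 (⟨y, hy⟩, i) (⟨a, ha⟩, j)
  rw [Matrix.nonsing_inv_mul _ ((Matrix.isUnit_iff_isUnit_det _).1 (hI x hx))] at h1
  rw [one_smul, one_smul] at h2
  exact h1.symm.trans h2

/-- The part `D - λ` of the sums of multigraphs that contain only positions in `Z`; all of the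
truncated matrices of the blocks are included. -/
def dsum (S : Setup d) (T : Stage d) (k : ℕ) (Z : Set (Pos d)) (l : ℝ) (x y : Pos d) : Mat2 :=
  pick (y ∈ T.block k x) (T.gsum (near k (T.block k x)) l x y - pick (x = y) (l • 1)) +
    vsum S T k Z l x y

/-- V = D - W, with the restriction to Z imposed on both sides: the subtracted multigraphs are those
that are both inside Z and local. -/
theorem vsum_eq (hT : T.AbsConv l) {Z : Set (Pos d)} {x y : Pos d} (hx : x ∈ T.removed S k)
    (hy : y ∈ T.removed S k) : vsum S T k Z l x y =
      T.gsum Z l x y - pick (y ∈ T.block k x) (T.gsum (Z ∩ near k (T.block k x)) l x y) := by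
  rw [eq_sub_iff_add_eq]
  by_cases h : y ∈ T.block k x
  · rw [pick_pos h]
    unfold vsum gsum
    rw [← (hT.summable x _).tsum_add (hT.summable x _)]
    refine tsum_congr fun g => ?_
    by_cases h1 : T.src g = x ∧ T.tgt g = y ∧ T.Inside Z g
    · obtain ⟨rfl, rfl, h1⟩ := h1
      by_cases h2 : T.Inside (near k (T.block k (T.src g))) g
      · exact (congrArg₂ _ (pick_neg (fun h' => h'.2.2.2.2.2 ⟨h, h2⟩) _)
          (pick_pos ⟨rfl, rfl, fun z hz => ⟨h1 z hz, h2 z hz⟩⟩ _)).trans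
          ((zero_add _).trans (pick_pos ⟨rfl, rfl, h1⟩ _).symm)
      · exact (congrArg₂ _ (pick_pos ⟨rfl, rfl, h1, hx, hy, fun h' => h2 h'.2⟩ _)
          (pick_neg (fun h' => h2 fun z hz => (h'.2.2 z hz).2) _)).trans
          ((add_zero _).trans (pick_pos ⟨rfl, rfl, h1⟩ _).symm)
    · exact (congrArg₂ _ (pick_neg (fun h' => h1 ⟨h'.1, h'.2.1, h'.2.2.1⟩) _)
        (pick_neg (fun h' => h1 ⟨h'.1, h'.2.1, fun z hz => (h'.2.2 z hz).1⟩) _)).trans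
        ((add_zero _).trans (pick_neg h1 _).symm)
  · rw [pick_neg h, add_zero]
    refine tsum_congr fun g => pick_congr ?_ _
    constructor
    · rintro ⟨h1, h2, h3, -⟩
      exact ⟨h1, h2, h3⟩
    · rintro ⟨rfl, rfl, h3⟩
      exact ⟨rfl, rfl, h3, hx, hy, fun h' => h h'.1⟩

theorem pick_transpose (p : Prop) (A : Mat2) : (pick p A).transpose = pick p A.transpose := by
  by_cases hp : p <;> simp [hp]

/-- V is a difference of reversible sums, and the two ends of a multigraph inside a block see the
same block, hence the same truncation. -/
theorem dsum_symm (hT : T.AbsConv l) (hR : T.Reversible l) {Z : Set (Pos d)} {x y : Pos d}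
    (hx : x ∈ T.removed S k) (hy : y ∈ T.removed S k) :
    dsum S T k Z l x y = (dsum S T k Z l y x).transpose := by
  unfold dsum
  rw [vsum_eq hT hx hy, vsum_eq hT hy hx, Matrix.transpose_add, Matrix.transpose_sub]
  simp only [pick_transpose, Matrix.transpose_sub, Matrix.transpose_smul, Matrix.transpose_one]
  by_cases h : y ∈ T.block k x
  · have h' : x ∈ T.block k y := block_symm (removed_subset hx) h
    rw [pick_pos h, pick_pos h', pick_pos h, pick_pos h', block_eq (removed_subset hx) h,
      ← hR, ← hR, ← hR, pick_congr eq_comm]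
  · have h' : x ∉ T.block k y := fun h' => h (block_symm (removed_subset hy) h')
    rw [pick_neg h, pick_neg h', pick_neg h, pick_neg h', ← hR]

theorem sum_block_pick {x : Pos d} (f : Pos d → Mat2) (hx : x ∈ T.removed S k) :
    ∑ b ∈ T.removed S k, pick (b ∈ T.block k x) (f b) = ∑ b ∈ T.block k x, f b := by
  symm
  rw [← Finset.sum_subset (s₁ := T.block k x) (fun b hb => removed_of_mem_block hx hb)]
  · exact Finset.sum_congr rfl fun b hb => (pick_pos hb _).symm
  · intro b _ hb
    exact pick_neg hb _

theorem pick_mul (p : Prop) (A B : Mat2) : pick p A * B = pick p (A * B) := by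
  by_cases hp : p <;> simp [hp]

/-- The sums over walks solve `(D - λ) X = -C`. -/
theorem dsum_mul_wsum (hT : T.AbsConv l) (hW : WalkConv S T k l) (hI : BlockInv S T k l)
    {Z : Set (Pos d)} {x : Pos d} (hx : x ∈ T.removed S k) (hZ : ∀ z ∈ T.block k x, z ∈ Z)
    {y : Pos d} (hy : y ∈ T.kept S k) :
    ∑ b ∈ T.removed S k, dsum S T k Z l x b * wsum S T k Z l b y = -T.gsum Z l x y := by
  have hxR := removed_subset hx
  unfold dsum
  simp only [add_mul, Finset.sum_add_distrib, pick_mul]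
  rw [sum_block_pick (fun b => (T.gsum (near k (T.block k x)) l x b - pick (x = b) (l • 1)) *
    wsum S T k Z l b y) hx]
  -- Apply the first-step decomposition on the whole block of x; multiplying by W - λ then cancels
  -- the block resolvent.
  have e1 : ∀ b ∈ T.block k x, wsum S T k Z l b y = -∑ a ∈ T.block k x, T.invBlock k l b a *
      (T.gsum Z l a y + ∑ c ∈ T.removed S k, vsum S T k Z l a c * wsum S T k Z l c y) := by
    intro b hb
    rw [← block_eq hxR hb]
    refine wsum_eq hT hW (removed_of_mem_block hx hb) ?_ hy
    rw [block_eq hxR hb]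
    exact hZ
  rw [Finset.sum_congr rfl fun b hb => congrArg _ (e1 b hb)]
  simp only [mul_neg, Finset.mul_sum (T.block k x), ← mul_assoc, Finset.sum_neg_distrib]
  rw [Finset.sum_comm]
  simp only [← Finset.sum_mul]
  rw [Finset.sum_congr rfl fun a ha => by
    rw [block_mul_inv hT hI hx (self_mem_block hxR) ha]]
  simp only [pick_mul, one_mul]
  rw [Finset.sum_eq_single x]
  · rw [pick_pos rfl]
    abel
  · intro b _ hb
    exact pick_neg (Ne.symm hb) _
  · intro h
    exact absurd (self_mem_block hxR) h

/-- The multigraphs of the next stage. -/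
theorem gsum_next (hT : T.AbsConv l) (hW : WalkConv S T k l) (hT' : (T.next S k).AbsConv l)
    {Z : Set (Pos d)} {x y : Pos d} (hx : x ∈ T.kept S k) (hy : y ∈ T.kept S k) :
    (T.next S k).gsum Z l x y = T.gsum Z l x y +
      ∑ b ∈ T.removed S k, T.gsum Z l x b * wsum S T k Z l b y := by
  have hs := hT'.summable x fun g => (T.next S k).tgt g = y ∧ (T.next S k).Inside Z g
  have hr := hs.comp_injective Sum.inr_injective
  refine (Summable.tsum_sum (hs.comp_injective Sum.inl_injective) hr).trans ?_
  refine congrArg₂ _ ?_ (hr.tsum_sigma.trans ?_)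
  · refine (tsum_subtype_pick' (p := fun g => T.src g ∈ T.kept S k ∧ T.tgt g ∈ T.kept S k)
      (fun g => pick (T.src g = x ∧ T.tgt g = y ∧ T.Inside Z g) (T.val l g)) ?_)
    intro g hg
    by_contra h
    refine hg (pick_neg ?_ _)
    rintro ⟨rfl, rfl, -⟩
    exact h ⟨hx, hy⟩
  · have h := tsum_start_end hT {x} (T.removed S k)
      (fun g => T.Inside Z g ∧ T.tgt g ∈ T.removed S k) (fun g h => h.2) (fun _ => 1)
      fun b => wsum S T k Z l b y
    simp only [one_mul, Finset.sum_singleton] at h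
    have e1 : ∀ b ∈ T.removed S k, (∑' g : T.Graph, pick (T.src g = x ∧ T.tgt g = b ∧
        T.Inside Z g ∧ T.tgt g ∈ T.removed S k) (T.val l g)) = T.gsum Z l x b := by
      intro b hb
      refine tsum_congr fun g => pick_congr ?_ _
      constructor
      · rintro ⟨h1, h2, h3, -⟩
        exact ⟨h1, h2, h3⟩
      · rintro ⟨h1, rfl, h3⟩
        exact ⟨h1, rfl, h3, hb⟩
    rw [Finset.sum_congr rfl fun b hb => by rw [e1 b hb]] at h
    rw [← h, tsum_subtype_pick _ fun g => T.val l g * wsum S T k Z l (T.tgt g) y]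
    refine Eq.trans (tsum_congr fun b => ?_) ((tsum_subtype_pick
      (fun g => T.src g ∈ T.kept S k ∧ T.tgt g ∈ T.removed S k) (fun g =>
        pick (T.src g = x ∧ T.Inside Z g) (T.val l g * wsum S T k Z l (T.tgt g) y))).trans ?_)
    · change ∑' w : T.Walk S k (T.tgt b.1), pick (T.src b.1 = x ∧ w.tgt = y ∧
        (∀ z ∈ T.supp b.1 ∪ w.supp, z ∈ Z)) (T.val l b.1 * w.val l) = _
      by_cases hb : T.src b.1 = x ∧ T.Inside Z b.1
      · rw [pick_pos hb, wsum, ← (hW.summable _ _).tsum_mul_left]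
        refine tsum_congr fun w => ?_
        have hiff : (T.src b.1 = x ∧ w.tgt = y ∧ (∀ z ∈ T.supp b.1 ∪ w.supp, z ∈ Z)) ↔
            (w.tgt = y ∧ w.Inside Z) := by
          simp only [Finset.mem_union]
          exact ⟨fun h => ⟨h.2.1, fun z hz => h.2.2 z (Or.inr hz)⟩,
            fun h => ⟨hb.1, h.1, fun z hz => hz.elim (hb.2 z) (h.2 z)⟩⟩
        rw [hiff]
        by_cases hw : w.tgt = y ∧ w.Inside Z
        · rw [pick_pos hw, pick_pos hw]
        · rw [pick_neg hw, pick_neg hw, mul_zero]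
      · rw [pick_neg hb]
        refine (tsum_congr fun w => ?_).trans tsum_zero
        refine pick_neg (fun h => hb ⟨h.1, fun z hz => h.2.2 z ?_⟩) _
        exact Finset.mem_union_left _ hz
    · refine tsum_congr fun g => ?_
      rw [← pick_and]
      refine pick_congr ?_ _
      rw [Finset.mem_singleton]
      constructor
      · rintro ⟨⟨_, h1⟩, h2, h3⟩
        exact ⟨h2, h3, h1⟩
      · rintro ⟨rfl, h3, h1⟩
        exact ⟨⟨hx, h1⟩, rfl, h3⟩

theorem gsum_next_eq_zero {Z : Set (Pos d)} {x y : Pos d}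
    (h : ¬ (x ∈ T.kept S k ∧ y ∈ T.kept S k)) : (T.next S k).gsum Z l x y = 0 := by
  refine (tsum_congr fun g => ?_).trans tsum_zero
  refine pick_neg (fun h' => h ?_) _
  rcases g with g | ⟨b, w⟩
  · exact ⟨h'.1 ▸ g.2.1, h'.2.1 ▸ g.2.2⟩
  · exact ⟨h'.1 ▸ b.2.1, h'.2.1 ▸ w.tgt_kept⟩

/-- No multigraph is reversed individually. With X the matrix of walk sums, symmetry of the old sums
gives B = -Xᵀ(D-λ), so the new part BX is -Xᵀ(D-λ)X, a symmetric expression. -/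
theorem Reversible.next (hT : T.AbsConv l) (hW : WalkConv S T k l) (hI : BlockInv S T k l)
    (hT' : (T.next S k).AbsConv l) (hR : T.Reversible l) : (T.next S k).Reversible l := by
  intro Z x y
  by_cases h : x ∈ T.kept S k ∧ y ∈ T.kept S k
  swap
  · rw [gsum_next_eq_zero h, gsum_next_eq_zero fun h' => h h'.symm, Matrix.transpose_zero]
  have key : ∀ x ∈ T.kept S k, ∀ y ∈ T.kept S k,
      ∑ b ∈ T.removed S k, T.gsum Z l x b * wsum S T k Z l b y =
      -∑ b ∈ T.removed S k, ∑ a ∈ T.removed S k, (wsum S T k Z l a x).transpose *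
        dsum S T k Z l a b * wsum S T k Z l b y := by
    intro x hx y hy
    rw [← Finset.sum_neg_distrib]
    refine Finset.sum_congr rfl fun b hb => ?_
    -- The equation for X is available only for blocks inside Z; for the other blocks the factor X
    -- vanishes.
    by_cases hZ : ∀ z ∈ T.block k b, z ∈ Z
    · rw [← Finset.sum_mul, ← neg_mul]
      congr 1
      have h1 := congrArg Matrix.transpose (dsum_mul_wsum hT hW hI hb hZ hx)
      rw [Matrix.transpose_neg, ← hR, Matrix.transpose_sum] at h1
      rw [eq_comm, neg_eq_iff_eq_neg, ← h1]
      refine Finset.sum_congr rfl fun a ha => ?_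
      rw [Matrix.transpose_mul, ← dsum_symm hT hR ha hb]
    · simp [wsum_eq_zero_of_not_subset hZ]
  rw [gsum_next hT hW hT' h.1 h.2, gsum_next hT hW hT' h.2 h.1, Matrix.transpose_add, ← hR]
  congr 1
  rw [key x h.1 y h.2, key y h.2 x h.1, Matrix.transpose_neg, Matrix.transpose_sum,
    Finset.sum_comm]
  congr 1
  refine Finset.sum_congr rfl fun b hb => ?_
  rw [Matrix.transpose_sum]
  refine Finset.sum_congr rfl fun a ha => ?_
  rw [Matrix.transpose_mul, Matrix.transpose_mul, Matrix.transpose_transpose,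
    ← dsum_symm hT hR hb ha, mul_assoc]

end Stage

end Symmetry

end

noncomputable section

open scoped Matrix.Norms.L2Operator

/-! ### Weighted sums of multigraphs and walks. -/

section Estimates
variable {d : ℕ} {S : Setup d} {T : Stage d} {k : ℕ} {e l E M β C : ℝ}

namespace Stage

/-- The weighted size of a multigraph at the energies `l` and `E`. -/
def gcost (T : Stage d) (e l E M : ℝ) (g : T.Graph) : ENNReal :=
  ENNReal.ofReal (pairNorm M (T.val l g) (T.val E g) * e ^ (-(4 * (T.reach g : ℝ) ^ psi)))

/-- The weighted size of a walk at the energies `l` and `E`. -/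
def Walk.cost (e l E M α : ℝ) {x : Pos d} (w : T.Walk S k x) : ENNReal :=
  ENNReal.ofReal (pairNorm M (w.val l) (w.val E) * e ^ (-(α * (w.wlen : ℝ) ^ psi)))

/-- A bound for the weighted sums of the multigraphs that start at a given position. -/
def CostBound (T : Stage d) (e l E M C : ℝ) : Prop :=
  ∀ a, ∑' g : {g : T.Graph // T.src g = a}, T.gcost e l E M g.1 ≤ ENNReal.ofReal C

/-- A bound for the resolvents of the removed blocks. -/
def InvBound (S : Setup d) (T : Stage d) (k : ℕ) (l E M β : ℝ) : Prop :=
  ∀ x ∈ T.removed S k, ∀ a ∈ T.block k x,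
    pairNorm M (T.invBlock k l x a) (T.invBlock k E x a) ≤ β

theorem rpow_neg_le (he : 0 < e) (he1 : e ≤ 1) {δ a b : ℝ} (h : δ + a ≤ b) :
    e ^ (-a) ≤ e ^ δ * e ^ (-b) := by
  rw [← Real.rpow_add he]
  exact Real.rpow_le_rpow_of_exponent_ge he he1 (by linarith)

theorem ofReal_norm_val_le_gcost (he : 0 < e) (he1 : e ≤ 1) (hM : 0 ≤ M) (g : T.Graph) :
    ENNReal.ofReal (pairNorm M (T.val l g) (T.val E g)) ≤ T.gcost e l E M g := by
  refine ENNReal.ofReal_le_ofReal ?_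
  refine le_mul_of_one_le_right (pairNorm_nonneg hM _ _) ?_
  refine Real.one_le_rpow_of_pos_of_le_one_of_nonpos he he1 ?_
  have : 0 ≤ (T.reach g : ℝ) ^ psi := by positivity
  linarith

/-- The weights are at least 1, so dropping them only lowers the sum. -/
theorem CostBound.absConv (he : 0 < e) (he1 : e ≤ 1) (hM : 0 ≤ M) (hC : T.CostBound e l E M C) :
    T.AbsConv l ∧ T.AbsConv E := by
  refine ⟨fun x => ?_, fun x => ?_⟩ <;>
  · refine ne_top_of_le_ne_top (ne_top_of_le_ne_top ENNReal.ofReal_ne_top (hC x)) ?_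
    refine ENNReal.tsum_le_tsum fun g => le_trans ?_ (ofReal_norm_val_le_gcost he he1 hM g.1)
    first
    | exact ENNReal.ofReal_le_ofReal (norm_le_pairNorm hM _ _)
    | exact ENNReal.ofReal_le_ofReal (norm_le_pairNorm' hM _ _)

theorem CostBound.mono {M' C' : ℝ} (he : 0 < e) (h : M' ≤ M) (h' : C ≤ C')
    (hC : T.CostBound e l E M C) : T.CostBound e l E M' C' := by
  intro x
  refine le_trans (ENNReal.tsum_le_tsum fun g => ?_)
    ((hC x).trans (ENNReal.ofReal_le_ofReal h'))
  refine ENNReal.ofReal_le_ofReal ?_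
  have := Real.rpow_pos_of_pos he (-(4 * (T.reach g.1 : ℝ) ^ psi))
  have := pairNorm_mono h (T.val l g.1) (T.val E g.1)
  gcongr

theorem cost_last_le (he : 0 < e) (he1 : e ≤ 1) (hM : 0 ≤ M) (hβ : 0 ≤ β)
    (hI : InvBound S T k l E M β) {α δ : ℝ} {x : Pos d} (c : T.Graph) (hx : x ∈ T.removed S k)
    (hj : T.src c ∈ T.block k x) (hc : T.tgt c ∈ T.kept S k)
    (h : δ + α * ((Walk.last c hx hj hc).wlen : ℝ) ^ psi ≤ 4 * (T.reach c : ℝ) ^ psi) :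
    (Walk.last c hx hj hc).cost e l E M α ≤
      ENNReal.ofReal (β * e ^ δ) * T.gcost e l E M c := by
  have h1 := Real.rpow_pos_of_pos he δ
  rw [Walk.cost, gcost, ← ENNReal.ofReal_mul (by positivity)]
  refine ENNReal.ofReal_le_ofReal ?_
  have h2 : pairNorm M ((Walk.last c hx hj hc).val l) ((Walk.last c hx hj hc).val E) ≤
      β * pairNorm M (T.val l c) (T.val E c) := by
    simp only [Walk.val]
    rw [pairNorm_neg]
    exact (pairNorm_mul hM _ _ _ _).trans
      (mul_le_mul_of_nonneg_right (hI x hx _ hj) (pairNorm_nonneg hM _ _))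
  have h3 := rpow_neg_le he he1 h
  have h4 := pairNorm_nonneg hM (T.val l c) (T.val E c)
  calc _ ≤ (β * pairNorm M (T.val l c) (T.val E c)) *
        (e ^ δ * e ^ (-(4 * (T.reach c : ℝ) ^ psi))) := by
        gcongr
    _ = _ := by ring

/-- The combined factor β e^(1.2 L_k^ψ) is resolvent bound times gain; with β = 40 e^(-L_k^ψ) it is
small. -/
theorem cost_step_le (hk : 1 ≤ k) (he : 0 < e) (he1 : e ≤ 1) (hM : 0 ≤ M) (hβ : 0 ≤ β)
    (hI : InvBound S T k l E M β) {α : ℝ} (h3 : 3 ≤ α) (h4 : α ≤ 4) {x : Pos d} (v : T.Graph)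
    (hx : x ∈ T.removed S k) (hj : T.src v ∈ T.block k x) (hv : T.IsLong S k v)
    (w : T.Walk S k (T.tgt v)) :
    (Walk.step v hx hj hv w).cost e l E M α ≤
      ENNReal.ofReal (β * e ^ (1.2 * len k ^ psi)) * T.gcost e l E M v * w.cost e l E M α := by
  have h1 := Real.rpow_pos_of_pos he (1.2 * len k ^ psi)
  have p1 := pairNorm_nonneg hM (T.val l v) (T.val E v)
  have p2 := pairNorm_nonneg hM (w.val l) (w.val E)
  have p3 := Real.rpow_pos_of_pos he (-(4 * (T.reach v : ℝ) ^ psi))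
  have p4 := Real.rpow_pos_of_pos he (-(α * (w.wlen : ℝ) ^ psi))
  simp only [Walk.cost, gcost]
  rw [← ENNReal.ofReal_mul (by positivity), ← ENNReal.ofReal_mul (by positivity)]
  refine ENNReal.ofReal_le_ofReal ?_
  have h2 : pairNorm M ((Walk.step v hx hj hv w).val l) ((Walk.step v hx hj hv w).val E) ≤
      β * pairNorm M (T.val l v) (T.val E v) * pairNorm M (w.val l) (w.val E) := by
    simp only [Walk.val]
    rw [pairNorm_neg]
    refine (pairNorm_mul hM _ _ _ _).trans (mul_le_mul_of_nonneg_right ?_ p2)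
    exact (pairNorm_mul hM _ _ _ _).trans (mul_le_mul_of_nonneg_right (hI x hx _ hj) p1)
  have h5 := rpow_neg_le he he1 (step_gain hk v hx hj hv w h3 h4)
  have h6 : e ^ (-(α * (w.wlen : ℝ) ^ psi + 4 * (T.reach v : ℝ) ^ psi)) =
      e ^ (-(α * (w.wlen : ℝ) ^ psi)) * e ^ (-(4 * (T.reach v : ℝ) ^ psi)) := by
    rw [← Real.rpow_add he]
    congr 1
    ring
  rw [h6] at h5
  calc _ ≤ (β * pairNorm M (T.val l v) (T.val E v) * pairNorm M (w.val l) (w.val E)) *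
        (e ^ (1.2 * len k ^ psi) * (e ^ (-(α * (w.wlen : ℝ) ^ psi)) *
          e ^ (-(4 * (T.reach v : ℝ) ^ psi)))) := by
        gcongr
    _ = _ := by ring

/-- A jump ends at an arbitrary position of its block, which costs the number of those positions. -/
theorem CostBound.block (hk : 1 ≤ k) (hC : T.CostBound e l E M C) {x : Pos d}
    (p : T.Graph → Prop) (hp : ∀ g, p g → x ∈ T.removed S k ∧ T.src g ∈ T.block k x) :
    ∑' g : {g : T.Graph // p g}, T.gcost e l E M g.1 ≤ ENNReal.ofReal (2 ^ k * C) := by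
  by_cases hx : x ∈ T.removed S k
  · refine (tsum_block_le x p (fun g hg => (hp g hg).2) _ _ hC).trans ?_
    rw [ENNReal.ofReal_mul (by positivity)]
    gcongr
    rw [← ENNReal.ofReal_natCast]
    exact ENNReal.ofReal_le_ofReal (card_block_le hk hx)
  · have : IsEmpty {g : T.Graph // p g} := ⟨fun g => hx (hp g.1 g.2).1⟩
    rw [tsum_empty]
    exact zero_le

theorem tsum_long_le (hk : 1 ≤ k) (hβ : 0 ≤ β) (he : 0 < e)
    (hC : T.CostBound e l E M C) {q : ℝ}
    (hq : 2 ^ k * (β * e ^ (1.2 * len k ^ psi)) * C ≤ q) (x : Pos d) :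
    ∑' v : {v : T.Graph // x ∈ T.removed S k ∧ T.src v ∈ T.block k x ∧ T.IsLong S k v},
      ENNReal.ofReal (β * e ^ (1.2 * len k ^ psi)) * T.gcost e l E M v.1 ≤ ENNReal.ofReal q := by
  have h1 := Real.rpow_pos_of_pos he (1.2 * len k ^ psi)
  rw [ENNReal.tsum_mul_left]
  refine (mul_le_mul_right (hC.block hk _ fun g hg => ⟨hg.1, hg.2.1⟩) _).trans ?_
  rw [← ENNReal.ofReal_mul (by positivity)]
  exact ENNReal.ofReal_le_ofReal (le_trans (le_of_eq (by ring)) hq)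

theorem tsum_last_le (hk : 1 ≤ k) (he : 0 < e) (he1 : e ≤ 1) (hM : 0 ≤ M) (hβ : 0 ≤ β)
    (hI : InvBound S T k l E M β) (hC : T.CostBound e l E M C) {α δ : ℝ}
    (hδ : ∀ (x : Pos d) (c : T.Graph) (hx : x ∈ T.removed S k) (hj : T.src c ∈ T.block k x)
      (hc : T.tgt c ∈ T.kept S k),
      δ + α * ((Walk.last c hx hj hc).wlen : ℝ) ^ psi ≤ 4 * (T.reach c : ℝ) ^ psi) (x : Pos d) :
    ∑' c : {c : T.Graph // x ∈ T.removed S k ∧ T.src c ∈ T.block k x ∧ T.tgt c ∈ T.kept S k},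
      (Walk.last c.1 c.2.1 c.2.2.1 c.2.2.2).cost e l E M α ≤
      ENNReal.ofReal (2 ^ k * (β * e ^ δ) * C) := by
  have h1 := Real.rpow_pos_of_pos he δ
  calc _ ≤ ∑' c : {c : T.Graph // x ∈ T.removed S k ∧ T.src c ∈ T.block k x ∧
        T.tgt c ∈ T.kept S k}, ENNReal.ofReal (β * e ^ δ) * T.gcost e l E M c.1 :=
        ENNReal.tsum_le_tsum fun c =>
          cost_last_le he he1 hM hβ hI c.1 c.2.1 c.2.2.1 c.2.2.2 (hδ x c.1 c.2.1 c.2.2.1 c.2.2.2)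
    _ ≤ ENNReal.ofReal (β * e ^ δ) * ENNReal.ofReal (2 ^ k * C) := by
        rw [ENNReal.tsum_mul_left]
        exact mul_le_mul_right (hC.block hk (fun c => x ∈ T.removed S k ∧
          T.src c ∈ T.block k x ∧ T.tgt c ∈ T.kept S k) fun g hg => ⟨hg.1, hg.2.1⟩) _
    _ = _ := by
        rw [← ENNReal.ofReal_mul (by positivity)]
        congr 1
        ring

/-- The weighted sums over walks. -/
theorem tsum_cost_le (hk : 1 ≤ k) (he : 0 < e) (he1 : e ≤ 1) (hM : 0 ≤ M) (hβ : 0 ≤ β)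
    (hI : InvBound S T k l E M β) (hC : T.CostBound e l E M C)
    (hq : 2 ^ k * (β * e ^ (1.2 * len k ^ psi)) * C ≤ 1 / 2) {α δ : ℝ} (h3 : 3 ≤ α) (h4 : α ≤ 4)
    (hδ : ∀ (x : Pos d) (c : T.Graph) (hx : x ∈ T.removed S k) (hj : T.src c ∈ T.block k x)
      (hc : T.tgt c ∈ T.kept S k),
      δ + α * ((Walk.last c hx hj hc).wlen : ℝ) ^ psi ≤ 4 * (T.reach c : ℝ) ^ psi) (x : Pos d) :
    ∑' w : T.Walk S k x, w.cost e l E M α ≤ ENNReal.ofReal (2 * (2 ^ k * (β * e ^ δ) * C)) := by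
  have h1 := Real.rpow_pos_of_pos he δ
  rw [ENNReal.ofReal_mul (by norm_num), ENNReal.ofReal_ofNat]
  have hf : ∀ x, ∑' v : {v : T.Graph // x ∈ T.removed S k ∧ T.src v ∈ T.block k x ∧
      T.IsLong S k v}, ENNReal.ofReal (β * e ^ (1.2 * len k ^ psi)) * T.gcost e l E M v.1 ≤
      1 / 2 := by
    intro x
    refine (tsum_long_le hk hβ he hC hq x).trans ?_
    rw [ENNReal.ofReal_div_of_pos (by norm_num)]
    simp
  exact tsum_walk_le (S := S) (fun x w => w.cost e l E M α)
    (fun _ v => ENNReal.ofReal (β * e ^ (1.2 * len k ^ psi)) * T.gcost e l E M v) _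
    (tsum_last_le hk he he1 hM hβ hI hC hδ)
    (fun x v hx hj hv w => cost_step_le hk he he1 hM hβ hI h3 h4 v hx hj hv w) hf x

theorem ofReal_pairNorm_le_cost (he : 0 < e) (he1 : e ≤ 1) (hM : 0 ≤ M) {α : ℝ} (hα : 0 ≤ α)
    {x : Pos d} (w : T.Walk S k x) :
    ENNReal.ofReal (pairNorm M (w.val l) (w.val E)) ≤ w.cost e l E M α := by
  refine ENNReal.ofReal_le_ofReal ?_
  refine le_mul_of_one_le_right (pairNorm_nonneg hM _ _) ?_
  refine Real.one_le_rpow_of_pos_of_le_one_of_nonpos he he1 ?_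
  have : 0 ≤ α * (w.wlen : ℝ) ^ psi := by positivity
  linarith

theorem walkConv_of_cost (he : 0 < e) (he1 : e ≤ 1) (hM : 0 ≤ M) {α : ℝ} (hα : 0 ≤ α)
    (h : ∀ x, ∑' w : T.Walk S k x, w.cost e l E M α ≠ ⊤) :
    WalkConv S T k l ∧ WalkConv S T k E := by
  refine ⟨fun x => ?_, fun x => ?_⟩ <;>
  · refine ne_top_of_le_ne_top (h x) ?_
    refine ENNReal.tsum_le_tsum fun w => le_trans ?_ (ofReal_pairNorm_le_cost he he1 hM hα w)
    first
    | exact ENNReal.ofReal_le_ofReal (norm_le_pairNorm hM _ _)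
    | exact ENNReal.ofReal_le_ofReal (norm_le_pairNorm' hM _ _)

/-- Sums over the multigraphs of the next stage that start at a given position. -/
theorem tsum_next_le (a : Pos d) (f : (T.next S k).Graph → ENNReal) (f0 : T.Graph → ENNReal)
    (h : ∀ g, f (Sum.inl g) ≤ f0 g.1) (A : ENNReal)
    (hA : ∑' b : {g : T.Graph // T.src g = a ∧ T.src g ∈ T.kept S k ∧ T.tgt g ∈ T.removed S k},
      ∑' w : T.Walk S k (T.tgt b.1), f (Sum.inr ⟨⟨b.1, b.2.2⟩, w⟩) ≤ A) :
    ∑' g : {g : (T.next S k).Graph // (T.next S k).src g = a}, f g.1 ≤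
      ∑' g : {g : T.Graph // T.src g = a}, f0 g.1 + A := by
  rw [tsum_subtype_pick _ f]
  refine (Summable.tsum_sum (ENNReal.summable) ENNReal.summable).trans_le ?_
  refine add_le_add ?_ (le_trans ?_ hA)
  · rw [tsum_subtype_pick _ f0]
    refine le_trans (ENNReal.tsum_le_tsum fun g => ?_) (ENNReal.tsum_comp_le_tsum_of_injective
      (f := fun g : {g : T.Graph // T.src g ∈ T.kept S k ∧ T.tgt g ∈ T.kept S k} => g.1)
      Subtype.val_injective _)
    by_cases hg : T.src g.1 = a
    · rw [pick_pos hg]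
      exact (pick_pos (show (T.next S k).src (Sum.inl g) = a from hg) _).trans_le (h g)
    · exact (pick_neg (show ¬ (T.next S k).src (Sum.inl g) = a from hg) _).trans_le zero_le
  · refine (ENNReal.tsum_sigma' _).trans_le ?_
    let ι : {g : T.Graph // T.src g = a ∧ T.src g ∈ T.kept S k ∧ T.tgt g ∈ T.removed S k} →
      {g : T.Graph // T.src g ∈ T.kept S k ∧ T.tgt g ∈ T.removed S k} := fun b => ⟨b.1, b.2.2⟩
    have hι : Function.Injective ι := fun b b' hb =>
      Subtype.ext (congrArg (fun z => z.1) hb : (ι b).1 = (ι b').1)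
    have hsupp : Function.support (fun b => ∑' w : T.Walk S k (T.tgt b.1),
        pick ((T.next S k).src (Sum.inr ⟨b, w⟩) = a) (f (Sum.inr ⟨b, w⟩))) ⊆ Set.range ι := by
      intro b hb
      by_contra hn
      refine hb (ENNReal.tsum_eq_zero.2 fun w => pick_neg (fun h' => hn ?_) _)
      exact ⟨⟨b.1, h', b.2⟩, rfl⟩
    refine (hι.tsum_eq hsupp).symm.trans_le ?_
    refine ENNReal.tsum_le_tsum fun b => ENNReal.tsum_le_tsum fun w => ?_
    exact (pick_pos (show (T.next S k).src (Sum.inr ⟨ι b, w⟩) = a from b.2.1) _).le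

theorem gcost_next_le (hk : 1 ≤ k) (he : 0 < e) (he1 : e ≤ 1) (hM : 0 ≤ M)
    (p : Σ b : {g : T.Graph // T.src g ∈ T.kept S k ∧ T.tgt g ∈ T.removed S k},
      T.Walk S k (T.tgt b.1)) :
    (T.next S k).gcost e l E M (Sum.inr p) ≤
      ENNReal.ofReal (e ^ ((exitLoss k + 1.5) * len k ^ psi)) * T.gcost e l E M p.1.1 *
        p.2.cost e l E M 4 := by
  have h1 := Real.rpow_pos_of_pos he ((exitLoss k + 1.5) * len k ^ psi)
  have p1 := pairNorm_nonneg hM (T.val l p.1.1) (T.val E p.1.1)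
  have p2 := pairNorm_nonneg hM (p.2.val l) (p.2.val E)
  have p3 := Real.rpow_pos_of_pos he (-(4 * (T.reach p.1.1 : ℝ) ^ psi))
  have p4 := Real.rpow_pos_of_pos he (-(4 * (p.2.wlen : ℝ) ^ psi))
  simp only [Walk.cost, gcost]
  rw [← ENNReal.ofReal_mul (by positivity), ← ENNReal.ofReal_mul (by positivity)]
  refine ENNReal.ofReal_le_ofReal ?_
  have h2 : pairNorm M ((T.next S k).val l (Sum.inr p)) ((T.next S k).val E (Sum.inr p)) ≤
      pairNorm M (T.val l p.1.1) (T.val E p.1.1) * pairNorm M (p.2.val l) (p.2.val E) :=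
    pairNorm_mul hM _ _ _ _
  have h5 := rpow_neg_le he he1 (enter_gain hk p)
  have h6 : e ^ (-(4 * (T.reach p.1.1 : ℝ) ^ psi + 4 * (p.2.wlen : ℝ) ^ psi)) =
      e ^ (-(4 * (T.reach p.1.1 : ℝ) ^ psi)) * e ^ (-(4 * (p.2.wlen : ℝ) ^ psi)) := by
    rw [← Real.rpow_add he]
    congr 1
    ring
  rw [h6] at h5
  calc _ ≤ (pairNorm M (T.val l p.1.1) (T.val E p.1.1) * pairNorm M (p.2.val l) (p.2.val E)) *
        (e ^ ((exitLoss k + 1.5) * len k ^ psi) * (e ^ (-(4 * (T.reach p.1.1 : ℝ) ^ psi)) *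
          e ^ (-(4 * (p.2.wlen : ℝ) ^ psi)))) := by
        gcongr
    _ = _ := by ring

/-- The weighted sum of the multigraphs that are new in step `k`. -/
theorem tsum_new_le (hk : 1 ≤ k) (he : 0 < e) (he1 : e ≤ 1) (hM : 0 ≤ M)
    (hC0 : 0 ≤ C) (hI : InvBound S T k l E M (40 * e ^ (-(len k ^ psi))))
    (hC : T.CostBound e l E M C)
    (hq : 2 ^ k * (40 * e ^ (-(len k ^ psi)) * e ^ (1.2 * len k ^ psi)) * C ≤ 1 / 2)
    (a : Pos d) :
    ∑' b : {g : T.Graph // T.src g = a ∧ T.src g ∈ T.kept S k ∧ T.tgt g ∈ T.removed S k},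
      ∑' w : T.Walk S k (T.tgt b.1), (T.next S k).gcost e l E M (Sum.inr ⟨⟨b.1, b.2.2⟩, w⟩) ≤
      ENNReal.ofReal (80 * 2 ^ k * C ^ 2 * e ^ (0.5 * len k ^ psi)) := by
  have p0 := Real.rpow_pos_of_pos he (-(len k ^ psi))
  have p1 := Real.rpow_pos_of_pos he ((exitLoss k + 1.5) * len k ^ psi)
  have hw := tsum_cost_le hk he he1 hM (by positivity) hI hC hq (by norm_num) le_rfl
    (δ := -(exitLoss k * len k ^ psi))
    (fun x c hx hj hc => by linarith [exit_loss hk c hx hj hc])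
  set A := 2 * (2 ^ k * (40 * e ^ (-(len k ^ psi)) * e ^ (-(exitLoss k * len k ^ psi))) * C) with hA
  calc _ ≤ ∑' b : {g : T.Graph // T.src g = a ∧ T.src g ∈ T.kept S k ∧ T.tgt g ∈ T.removed S k},
        ENNReal.ofReal (e ^ ((exitLoss k + 1.5) * len k ^ psi)) * T.gcost e l E M b.1 *
          ENNReal.ofReal A := by
        refine ENNReal.tsum_le_tsum fun b => ?_
        refine le_trans ?_ (mul_le_mul_right (hw (T.tgt b.1))
          (ENNReal.ofReal (e ^ ((exitLoss k + 1.5) * len k ^ psi)) * T.gcost e l E M b.1))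
        rw [← ENNReal.tsum_mul_left]
        exact ENNReal.tsum_le_tsum fun w => gcost_next_le hk he he1 hM ⟨⟨b.1, b.2.2⟩, w⟩
    _ ≤ ENNReal.ofReal (e ^ ((exitLoss k + 1.5) * len k ^ psi)) * ENNReal.ofReal C *
          ENNReal.ofReal A := by
        rw [ENNReal.tsum_mul_right, ENNReal.tsum_mul_left]
        gcongr
        refine le_trans ?_ (hC a)
        exact ENNReal.tsum_comp_le_tsum_of_injective
          (f := fun b : {g : T.Graph // T.src g = a ∧ T.src g ∈ T.kept S k ∧
            T.tgt g ∈ T.removed S k} => (⟨b.1, b.2.1⟩ : {g : T.Graph // T.src g = a}))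
          (fun b b' hb => Subtype.ext (congrArg (fun z => z.1) hb))
          (fun g => T.gcost e l E M g.1)
    _ = _ := by
        -- In units of L_k^ψ: gain exitLoss + 1.5 on entering, minus 1 for the last resolvent, minus
        -- exitLoss on leaving, makes 0.5.
        have e1 : e ^ ((exitLoss k + 1.5) * len k ^ psi) * (e ^ (-(len k ^ psi)) *
            e ^ (-(exitLoss k * len k ^ psi))) = e ^ (0.5 * len k ^ psi) := by
          rw [← Real.rpow_add he, ← Real.rpow_add he]
          congr 1
          ring
        rw [← ENNReal.ofReal_mul p1.le, ← ENNReal.ofReal_mul (by positivity), hA, ← e1]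
        congr 1
        ring

end Stage

end Estimates

end

noncomputable section

open scoped Matrix.Norms.L2Operator

/-! ### One step of the induction on scales. -/

section Induction
variable {d : ℕ} {S : Setup d} {T : Stage d} {k : ℕ} {e l E M C : ℝ}

namespace Stage

/-- A Lipschitz bound in the energy for the sums of multigraphs from a given position. -/
def LipBound (T : Stage d) (l E c : ℝ) : Prop :=
  ∀ a, ∑' g : {g : T.Graph // T.src g = a}, ENNReal.ofReal ‖T.val l g.1 - T.val E g.1‖ ≤
    ENNReal.ofReal c

theorem ofReal_norm_tsum_le {ι : Type*} (f : ι → Mat2) :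
    ENNReal.ofReal ‖∑' i, f i‖ ≤ ∑' i, ENNReal.ofReal ‖f i‖ := by
  by_cases h : ∑' i, ENNReal.ofReal ‖f i‖ = ⊤
  · rw [h]
    exact le_top
  have hs : Summable fun i => ‖f i‖ := by
    have := ENNReal.summable_toReal h
    simpa [ENNReal.toReal_ofReal (norm_nonneg _)] using this
  rw [← ENNReal.ofReal_tsum_of_nonneg (fun _ => norm_nonneg _) hs]
  exact ENNReal.ofReal_le_ofReal (norm_tsum_le_tsum_norm hs)

/-- Each multigraph has one end point, so summing over end points counts it at most once, whatever
restriction Z is imposed. -/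
theorem LipBound.row_sum (hl : T.AbsConv l) (hE : T.AbsConv E) {c : ℝ} (hc : 0 ≤ c)
    (hL : T.LipBound l E c)
    (B : Finset (Pos d)) (Z : Set (Pos d)) (x : Pos d) :
    ∑ y ∈ B, ‖T.gsum Z l x y - T.gsum Z E x y‖ ≤ c := by
  rw [← ENNReal.ofReal_le_ofReal_iff hc, ENNReal.ofReal_sum_of_nonneg fun _ _ => norm_nonneg _]
  refine le_trans ?_ (hL x)
  have h1 : ∀ y, ENNReal.ofReal ‖T.gsum Z l x y - T.gsum Z E x y‖ ≤ ∑' g : T.Graph,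
      pick (T.tgt g = y) (pick (T.src g = x) (ENNReal.ofReal ‖T.val l g - T.val E g‖)) := by
    intro y
    unfold gsum
    rw [← (hl.summable x _).tsum_sub (hE.summable x _)]
    refine (ofReal_norm_tsum_le _).trans (ENNReal.tsum_le_tsum fun g => ?_)
    by_cases h : T.src g = x ∧ T.tgt g = y ∧ T.Inside Z g
    · rw [pick_pos h, pick_pos h, pick_pos h.2.1, pick_pos h.1]
    · rw [pick_neg h, pick_neg h, sub_zero, norm_zero, ENNReal.ofReal_zero]
      exact zero_le
  refine (Finset.sum_le_sum fun y _ => h1 y).trans ?_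
  rw [← Summable.tsum_finsetSum fun _ _ => ENNReal.summable,
    tsum_subtype_pick _ fun g => ENNReal.ofReal ‖T.val l g - T.val E g‖]
  refine ENNReal.tsum_le_tsum fun g => ?_
  by_cases h : T.tgt g ∈ B
  · rw [sum_pick_eq fun _ => h]
  · rw [Finset.sum_eq_zero]
    · exact zero_le
    · intro y hy
      exact pick_neg (fun h' : T.tgt g = y => h (h' ▸ hy)) _

theorem invBound (he : 0 < e) (hlE : |l - E| ≤ e ^ (len k ^ psi) / 2)
    (hS : S.E = E) (hSe : eps S.γ = e)
    (hl : T.AbsConv l) (hE : T.AbsConv E) (hRl : T.Reversible l) (hRE : T.Reversible E)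
    (hL : T.LipBound l E (|l - E| / 4)) :
    BlockInv S T k l ∧ BlockInv S T k E ∧
      InvBound S T k l E (e ^ (len k ^ psi) / |l - E|) (40 * e ^ (-(len k ^ psi))) := by
  have hε : 0 < e ^ (len k ^ psi) := Real.rpow_pos_of_pos he _
  have key : ∀ x ∈ T.removed S k, _ := fun x (hx : x ∈ T.removed S k) =>
    resolvent_bounds (trunc_isSymm (k := k) hl hRl (T.block k x))
      (trunc_isSymm (k := k) hE hRE (T.block k x)) hε hlE (by
        intro s
        rw [Fintype.sum_prod_type, Finset.univ_eq_attach]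
        have h1 := hL.row_sum hl hE (by positivity) (T.block k x) (near k (T.block k x)) s.1
        rw [← Finset.sum_attach] at h1
        -- The two internal states double the row sums: |l - E|/4 becomes the |l - E|/2 required by
        -- `resolvent_bounds`.
        refine le_trans (Finset.sum_le_sum fun y _ => ?_)
          ((Finset.mul_sum _ _ (2 : ℝ)).symm.trans_le
            ((mul_le_mul_of_nonneg_left h1 zero_le_two).trans_eq (by ring)))
        rw [Fin.sum_univ_two, two_mul]
        refine add_le_add ?_ ?_ <;>
        · rw [Matrix.sub_apply, trunc_apply hl, trunc_apply hE, ← Matrix.sub_apply]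
          exact abs_entry_le_norm _ _ _) (by
        intro μ hμ
        by_contra h
        refine (mem_removed.1 hx).2.2 ⟨μ, hS ▸ hμ, ?_⟩
        rw [epsAt, hSe, hS]
        exact (not_le.1 h).le)
  refine ⟨fun x hx => (key x hx).1, fun x hx => (key x hx).2.1, fun x hx a ha => ?_⟩
  obtain ⟨-, -, h3, h4, h5⟩ := key x hx
  have hxx := self_mem_block (k := k) (removed_subset hx)
  rw [Real.rpow_neg he.le, ← div_eq_mul_inv]
  refine pairNorm_resolvent hε h3 h4 h5 (fun i => (⟨x, hxx⟩, i)) (fun j => (⟨a, ha⟩, j)) ?_ ?_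
  · intro i j
    have e3 : T.invBlock k l x a = _ := dif_pos ⟨hxx, ha⟩
    rw [e3]
  · intro i j
    have e3 : T.invBlock k E x a = _ := dif_pos ⟨hxx, ha⟩
    rw [e3]

/-- The change in energy is at most |l-E|/ε_k times the `pairNorm`. A new multigraph has reach at
least L_k, so its weight absorbs 1/ε_k. -/
theorem ofReal_norm_sub_next_le (hk : 1 ≤ k) (he : 0 < e) (he1 : e ≤ 1)
    (p : Σ b : {g : T.Graph // T.src g ∈ T.kept S k ∧ T.tgt g ∈ T.removed S k},
      T.Walk S k (T.tgt b.1)) :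
    ENNReal.ofReal ‖(T.next S k).val l (Sum.inr p) - (T.next S k).val E (Sum.inr p)‖ ≤
      ENNReal.ofReal |l - E| *
        (T.next S k).gcost e l E (e ^ (len k ^ psi) / |l - E|) (Sum.inr p) := by
  have hε : 0 < e ^ (len k ^ psi) := Real.rpow_pos_of_pos he _
  unfold gcost
  rw [← ENNReal.ofReal_mul (abs_nonneg _)]
  refine ENNReal.ofReal_le_ofReal ?_
  set A := (T.next S k).val l (Sum.inr p)
  rcases eq_or_ne l E with rfl | hlE
  · rw [sub_self, sub_self, norm_zero, abs_zero, zero_mul]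
  have hpos : 0 < |l - E| := abs_pos.2 (sub_ne_zero.2 hlE)
  set A' := (T.next S k).val E (Sum.inr p)
  have h1 := mul_norm_sub_le_pairNorm (M := e ^ (len k ^ psi) / |l - E|) A A'
  have h2 : 1 ≤ e ^ (-(len k ^ psi)) * e ^ (-(4 * ((T.next S k).reach (Sum.inr p) : ℝ) ^ psi)) *
      e ^ (len k ^ psi) * e ^ (len k ^ psi) := by
    rw [← Real.rpow_add he, ← Real.rpow_add he, ← Real.rpow_add he]
    refine Real.one_le_rpow_of_pos_of_le_one_of_nonpos he he1 ?_
    have h3 := rpow_psi_mono (zero_le_one.trans (one_le_len hk)) (len_le_next_reach hk p)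
    have h4 : 0 ≤ len k ^ psi := Real.rpow_nonneg (zero_le_one.trans (one_le_len hk)) _
    linarith
  have h5 : e ^ (-(len k ^ psi)) * e ^ (len k ^ psi) = 1 := by
    rw [← Real.rpow_add he, neg_add_cancel, Real.rpow_zero]
  set w := e ^ (-(4 * ((T.next S k).reach (Sum.inr p) : ℝ) ^ psi))
  have h6 : 1 ≤ w * e ^ (len k ^ psi) := by
    calc _ ≤ _ := h2
      _ = (e ^ (-(len k ^ psi)) * e ^ (len k ^ psi)) * (w * e ^ (len k ^ psi)) := by ring
      _ = _ := by rw [h5, one_mul]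
  have hw : 0 ≤ w := Real.rpow_nonneg he.le _
  calc ‖A - A'‖ ≤ ‖A - A'‖ * (w * e ^ (len k ^ psi)) :=
        le_mul_of_one_le_right (norm_nonneg _) h6
    _ = |l - E| * ((e ^ (len k ^ psi) / |l - E| * ‖A - A'‖) * w) := by
        field_simp
    _ ≤ _ := by gcongr

/-- The facts about a stage that are carried through the induction. -/
structure Good (T : Stage d) (e l E M C c : ℝ) : Prop where
  cost : T.CostBound e l E M C
  lip : T.LipBound l E c
  rev_l : T.Reversible l
  rev_E : T.Reversible E

/-- The facts about a step. -/
structure GoodStep (S : Setup d) (T : Stage d) (k : ℕ) (e l E C : ℝ) : Prop where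
  cost : T.CostBound e l E (e ^ (len k ^ psi) / |l - E|) C
  inv_l : BlockInv S T k l
  inv_E : BlockInv S T k E
  inv : InvBound S T k l E (e ^ (len k ^ psi) / |l - E|) (40 * e ^ (-(len k ^ psi)))
  small : 2 ^ k * (40 * e ^ (-(len k ^ psi)) * e ^ (1.2 * len k ^ psi)) * C ≤ 1 / 2

theorem GoodStep.walkConv (hk : 1 ≤ k) (he : 0 < e) (he1 : e ≤ 1) (h : GoodStep S T k e l E C) :
    WalkConv S T k l ∧ WalkConv S T k E := by
  have hε : 0 < e ^ (len k ^ psi) := Real.rpow_pos_of_pos he _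
  have p0 := Real.rpow_pos_of_pos he (-(len k ^ psi))
  refine walkConv_of_cost (α := 4) he he1 (M := e ^ (len k ^ psi) / |l - E|) (by positivity)
    (by norm_num) fun x => ?_
  exact ne_top_of_le_ne_top ENNReal.ofReal_ne_top
    (tsum_cost_le hk he he1 (by positivity) (by positivity) h.inv h.cost h.small (by norm_num)
      le_rfl (δ := -(exitLoss k * len k ^ psi))
      (fun x c hx hj hc => by linarith [exit_loss hk c hx hj hc]) x)

/-- Old multigraphs keep their values, so both constants only grow by the contribution η of the new
ones. -/
theorem GoodStep.good_next (hk : 1 ≤ k) (he : 0 < e) (he1 : e ≤ 1) (hC0 : 0 ≤ C) {c : ℝ}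
    (hc0 : 0 ≤ c) (h : GoodStep S T k e l E C) (hL : T.LipBound l E c) (hRl : T.Reversible l)
    (hRE : T.Reversible E) {η : ℝ} (hη : 80 * 2 ^ k * C ^ 2 * e ^ (0.5 * len k ^ psi) ≤ η) :
    (T.next S k).Good e l E (e ^ (len k ^ psi) / |l - E|) (C + η) (c + η * |l - E|) := by
  have hε : 0 < e ^ (len k ^ psi) := Real.rpow_pos_of_pos he _
  have hM : 0 ≤ e ^ (len k ^ psi) / |l - E| := by positivity
  have hη0 : 0 ≤ η := le_trans (by
    have := Real.rpow_pos_of_pos he (0.5 * len k ^ psi)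
    positivity) hη
  have hnew := fun a => (tsum_new_le hk he he1 hM hC0 h.inv h.cost h.small a).trans
    (ENNReal.ofReal_le_ofReal hη)
  have hcost : (T.next S k).CostBound e l E (e ^ (len k ^ psi) / |l - E|) (C + η) := by
    intro a
    rw [ENNReal.ofReal_add hC0 hη0]
    refine (tsum_next_le a _ (T.gcost e l E (e ^ (len k ^ psi) / |l - E|)) (fun g => ?_) _
      (hnew a)).trans (add_le_add_left (h.cost a) _)
    exact le_of_eq rfl
  have hconv := h.cost.absConv he he1 hM
  have hconv' := hcost.absConv he he1 hM
  have hW := h.walkConv hk he he1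
  refine ⟨hcost, fun a => ?_, hRl.next hconv.1 hW.1 h.inv_l hconv'.1,
    hRE.next hconv.2 hW.2 h.inv_E hconv'.2⟩
  rw [ENNReal.ofReal_add hc0 (by positivity)]
  refine (tsum_next_le a (fun g => ENNReal.ofReal ‖(T.next S k).val l g - (T.next S k).val E g‖)
    (fun g => ENNReal.ofReal ‖T.val l g - T.val E g‖) (fun g => le_of_eq rfl)
    (ENNReal.ofReal (η * |l - E|)) ?_).trans (add_le_add_left (hL a) _)
  rw [mul_comm, ENNReal.ofReal_mul (abs_nonneg _)]
  refine le_trans ?_ (mul_le_mul_right (hnew a) _)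
  rw [← ENNReal.tsum_mul_left]
  refine ENNReal.tsum_le_tsum fun b => ?_
  rw [← ENNReal.tsum_mul_left]
  exact ENNReal.tsum_le_tsum fun w => ofReal_norm_sub_next_le hk he he1 ⟨⟨b.1, b.2.2⟩, w⟩

end Stage

end Induction

end

noncomputable section

open scoped Matrix.Norms.L2Operator

/-! ### Smallness of ε, the initial stage, and the induction. -/

section Start
variable {d : ℕ}

theorem eps_pow_four {γ : ℝ} (hγ : 0 < γ) : eps γ ^ 4 = γ := by
  rw [eps, ← Real.rpow_natCast, ← Real.rpow_mul hγ.le]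
  norm_num

theorem eps_pos {γ : ℝ} (hγ : 0 < γ) : 0 < eps γ := Real.rpow_pos_of_pos hγ _

/-- Bernoulli's inequality for (3/2)^(k-1) ≤ (2^ψ)^(k-1). Linear growth is all that is needed
against 4^k. -/
theorem half_le_len_rpow {k : ℕ} (hk : 1 ≤ k) : (k : ℝ) / 2 ≤ len k ^ psi := by
  obtain ⟨n, rfl⟩ : ∃ n, k = n + 1 := ⟨k - 1, by omega⟩
  have e1 : len ((n + 1 : ℕ) : ℤ) = 2 ^ n := by
    rw [len, show ((n + 1 : ℕ) : ℤ) - 1 = (n : ℤ) by push_cast; ring, zpow_natCast]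
  have e2 : ((2 : ℝ) ^ n) ^ psi = ((2 : ℝ) ^ psi) ^ n := by
    rw [← Real.rpow_natCast, ← Real.rpow_natCast, ← Real.rpow_mul zero_le_two,
      ← Real.rpow_mul zero_le_two, mul_comm]
  have h1 : (1 + 1 / 2 : ℝ) ≤ (2 : ℝ) ^ psi := le_rpow_psi (by norm_num) (by norm_num)
  have h2 := one_add_mul_le_pow (a := (1 / 2 : ℝ)) (by norm_num) n
  have h3 := pow_le_pow_left₀ (by norm_num) h1 n
  rw [e1, e2]
  push_cast
  linarith

theorem exists_small {K : ℝ} (hK : 1 ≤ K) : ∃ e₀ : ℝ, 0 < e₀ ∧ e₀ ≤ 1 ∧ ∀ e : ℝ, 0 < e → e ≤ e₀ →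
    ∀ k : ℕ, 1 ≤ k → K * 4 ^ k * e ^ (0.2 * len k ^ psi) ≤ 1 := by
  have hK0 : 0 < 4 * K := by linarith
  -- The exponent 10 makes e^0.1 ≤ 1/(4K), while 0.2 L_k^ψ ≥ 0.1 k; hence K·4^k is compensated by
  -- (4K)^(-k).
  refine ⟨((4 * K) ^ 10)⁻¹, by positivity, inv_le_one_of_one_le₀ (one_le_pow₀ (by linarith)), ?_⟩
  intro e he hle k hk
  have he1 : e ≤ 1 := hle.trans (inv_le_one_of_one_le₀ (one_le_pow₀ (by linarith)))
  have h1 : e ^ (0.1 : ℝ) ≤ (4 * K)⁻¹ := by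
    refine (Real.rpow_le_rpow he.le hle (by norm_num)).trans (le_of_eq ?_)
    rw [← inv_pow, ← Real.rpow_natCast, ← Real.rpow_mul (by positivity)]
    norm_num
  have h2 : e ^ (0.2 * len k ^ psi) ≤ (e ^ (0.1 : ℝ)) ^ k := by
    rw [← Real.rpow_natCast, ← Real.rpow_mul he.le]
    refine Real.rpow_le_rpow_of_exponent_ge he he1 ?_
    have := half_le_len_rpow hk
    linarith
  have h3 : (e ^ (0.1 : ℝ)) ^ k ≤ ((4 * K)⁻¹) ^ k :=
    pow_le_pow_left₀ (Real.rpow_nonneg he.le _) h1 k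
  have h4 : K ≤ K ^ k := le_self_pow₀ hK (by omega)
  calc _ ≤ K ^ k * 4 ^ k * ((4 * K)⁻¹) ^ k := by
        gcongr
        exact h2.trans h3
    _ = 1 := by
        rw [inv_pow, ← mul_pow, mul_comm K, mul_inv_cancel₀]
        positivity

variable {S : Setup d} {e l E M C : ℝ}

theorem hamBlock_transpose (x y : Pos d) : (S.hamBlock x y).transpose = S.hamBlock y x := by
  unfold Setup.hamBlock
  by_cases h : x = y
  · subst h
    rw [if_pos rfl]
    ext i j
    fin_cases i <;> fin_cases j <;> simp
  · rw [if_neg h, if_neg (Ne.symm h), posDist_comm x y]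
    split_ifs
    · rw [Matrix.transpose_smul, Matrix.transpose_one]
    · simp

namespace Stage

theorem initial_reversible : (initial S).Reversible l := by
  intro Z x y
  unfold gsum
  rw [Matrix.transpose_tsum]
  let σ : (initial S).Graph ≃ (initial S).Graph :=
    { toFun := fun g => ⟨(g.1.2, g.1.1), g.2.2.1, g.2.1, posDist_comm g.1.1 g.1.2 ▸ g.2.2.2⟩
      invFun := fun g => ⟨(g.1.2, g.1.1), g.2.2.1, g.2.1, posDist_comm g.1.1 g.1.2 ▸ g.2.2.2⟩
      left_inv := fun g => rfl
      right_inv := fun g => rfl }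
  rw [← σ.tsum_eq]
  refine tsum_congr fun g => ?_
  have h1 : (initial S).Inside Z (σ g) ↔ (initial S).Inside Z g := by
    change (∀ z ∈ ({g.1.2, g.1.1} : Finset (Pos d)), z ∈ Z) ↔
      ∀ z ∈ ({g.1.1, g.1.2} : Finset (Pos d)), z ∈ Z
    rw [Finset.pair_comm]
  have h2 : ((initial S).src (σ g) = x ∧ (initial S).tgt (σ g) = y ∧
      (initial S).Inside Z (σ g)) ↔
      ((initial S).src g = y ∧ (initial S).tgt g = x ∧ (initial S).Inside Z g) := by
    rw [h1]
    change (g.1.2 = x ∧ g.1.1 = y ∧ _) ↔ (g.1.1 = y ∧ g.1.2 = x ∧ _)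
    tauto
  rw [pick_congr h2, pick_transpose]
  congr 1
  exact (hamBlock_transpose _ _).symm

theorem initial_reach (g : (initial S).Graph) :
    (initial S).reach g ≤ posDist g.1.1 g.1.2 := by
  refine reach_le le_rfl fun z hz => ?_
  change z ∈ ({g.1.1, g.1.2} : Finset (Pos d)) at hz
  change posDist g.1.1 z + posDist z g.1.2 ≤ _
  rcases Finset.mem_insert.1 hz with rfl | hz
  · rw [posDist_self, zero_add]
  · rw [Finset.mem_singleton.1 hz, posDist_self, add_zero]

/-- The coefficient 4 in the weights is chosen for this: a hop has reach at most 1 and γ = e^4. -/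
theorem initial_gcost_le (hγ : 0 < S.γ) (he : eps S.γ = e) (he1 : e ≤ 1)
    (hu : ∀ x ∈ S.box, |S.u x| ≤ 1) (g : (initial S).Graph) :
    (initial S).gcost e l E M g ≤ ENNReal.ofReal 4 := by
  have he0 : 0 < e := he ▸ eps_pos hγ
  refine ENNReal.ofReal_le_ofReal ?_
  have h0 : pairNorm M ((initial S).val l g) ((initial S).val E g) = ‖S.hamBlock g.1.1 g.1.2‖ :=
    pairNorm_self _ _
  rw [h0]
  have hr := initial_reach g
  have hr1 : posDist g.1.1 g.1.2 ≤ 1 := g.2.2.2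
  by_cases hg : g.1.1 = g.1.2
  · rw [hg, posDist_self] at hr
    have e1 : ((initial S).reach g : ℝ) = 0 := by exact_mod_cast Nat.le_zero.1 hr
    rw [e1, Real.zero_rpow psi_pos.ne', mul_zero, neg_zero, Real.rpow_zero, mul_one]
    refine (norm_le_of_entries _ (c := 1) fun i j => ?_).trans (by norm_num)
    unfold Setup.hamBlock
    rw [if_pos hg]
    have := hu _ g.2.1
    fin_cases i <;> fin_cases j <;> simp [this]
  · have hd : posDist g.1.1 g.1.2 = 1 := le_antisymm hr1 (one_le_posDist hg)
    have e1 : S.hamBlock g.1.1 g.1.2 = S.γ • 1 := by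
      unfold Setup.hamBlock
      rw [if_neg hg, if_pos hd]
    have h2 : ((initial S).reach g : ℝ) ^ psi ≤ 1 :=
      Real.rpow_le_one (Nat.cast_nonneg _) (by exact_mod_cast hr.trans hr1) psi_pos.le
    have h3 : e ^ (-(4 * ((initial S).reach g : ℝ) ^ psi)) ≤ e ^ (-4 : ℝ) :=
      Real.rpow_le_rpow_of_exponent_ge he0 he1 (by linarith)
    rw [e1, norm_smul, norm_one, mul_one, Real.norm_of_nonneg hγ.le]
    have h4 : S.γ = e ^ (4 : ℝ) := by
      rw [← eps_pow_four hγ, he]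
      norm_cast
    calc _ ≤ S.γ * e ^ (-4 : ℝ) := by gcongr
      _ = 1 := by
        rw [h4, ← Real.rpow_add he0]
        norm_num
      _ ≤ 4 := by norm_num

theorem tsum_le_card_mul {α β : Type*} (s : Finset β) (f : α → β) (hf : Function.Injective f)
    (hm : ∀ a, f a ∈ s) (φ : α → ENNReal) (c : ENNReal) (h : ∀ a, φ a ≤ c) :
    ∑' a, φ a ≤ s.card * c := by
  have hf' : Function.Injective fun a => (⟨f a, hm a⟩ : {b // b ∈ s}) := fun a b hab =>
    hf (congrArg Subtype.val hab)
  refine (ENNReal.tsum_le_tsum h).trans ?_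
  refine (ENNReal.tsum_comp_le_tsum_of_injective hf' fun _ => c).trans ?_
  rw [tsum_fintype, Finset.sum_const, Finset.card_univ, Fintype.card_coe, nsmul_eq_mul]

/-- At most 3^d end points are possible, and H does not depend on λ, so the Lipschitz constant is 0
and M is arbitrary. -/
theorem initial_good (hγ : 0 < S.γ) (he : eps S.γ = e) (he1 : e ≤ 1)
    (hu : ∀ x ∈ S.box, |S.u x| ≤ 1) : (initial S).Good e l E M (4 * 3 ^ d) 0 := by
  refine ⟨fun x => ?_, fun x => ?_, initial_reversible, initial_reversible⟩
  · have hmem : ∀ g : {g : (initial S).Graph // (initial S).src g = x},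
        g.1.1.2 ∈ Finset.Icc (fun i => x i - 1) (fun i => x i + 1) := by
      rintro ⟨g, rfl⟩
      have hd := g.2.2.2
      unfold posDist at hd
      rw [Finset.mem_Icc]
      have hi : ∀ i, (g.1.1 i - g.1.2 i).natAbs ≤ 1 := fun i =>
        (Finset.single_le_sum (f := fun i => (g.1.1 i - g.1.2 i).natAbs) (fun _ _ => Nat.zero_le _)
          (Finset.mem_univ i)).trans hd
      constructor <;>
      · intro i
        have := hi i
        simp only [initial]
        omega
    have hf : Function.Injective fun g : {g : (initial S).Graph // (initial S).src g = x} =>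
        g.1.1.2 := by
      intro g g' h1
      have h2 : g.1.1.1 = g'.1.1.1 := Eq.trans g.2 (Eq.symm g'.2)
      exact Subtype.ext (Subtype.ext (Prod.ext h2 h1))
    refine (tsum_le_card_mul _ _ hf hmem _ _
      fun g => initial_gcost_le hγ he he1 hu g.1).trans ?_
    rw [Pi.card_Icc]
    have : ∀ i, (Finset.Icc (x i - 1) (x i + 1)).card = 3 := by
      intro i
      rw [Int.card_Icc]
      omega
    simp only [this, Finset.prod_const, Finset.card_univ, Fintype.card_fin]
    rw [mul_comm, ENNReal.ofReal_mul (by norm_num)]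
    gcongr
    rw [ENNReal.ofReal_pow (by norm_num)]
    simp
  · rw [ENNReal.ofReal_zero, nonpos_iff_eq_zero, ENNReal.tsum_eq_zero]
    intro g
    change ENNReal.ofReal ‖S.hamBlock _ _ - S.hamBlock _ _‖ = 0
    rw [sub_self, norm_zero, ENNReal.ofReal_zero]

/-- The smallness condition on `ε`. -/
def Small (e C : ℝ) : Prop :=
  ∀ k : ℕ, 1 ≤ k → 100000 * C ^ 2 * 4 ^ k * e ^ (0.2 * len k ^ psi) ≤ 1

theorem Small.le (h : Small e C) {k : ℕ} (hk : 1 ≤ k) :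
    100000 * C ^ 2 * 2 ^ k * e ^ (0.2 * len k ^ psi) ≤ (1 / 2) ^ k := by
  have h1 := h k hk
  have h2 : (4 : ℝ) ^ k = 2 ^ k * 2 ^ k := by rw [← mul_pow]; norm_num
  rw [h2] at h1
  rw [one_div, inv_pow, ← one_div, le_div_iff₀ (by positivity)]
  linarith

/-- The additional factor 40C allows the contraction to absorb the bound 160C for first-scale walks.
-/
theorem Small.contraction (h : Small e C) (he : 0 < e) (hC : 1 ≤ C) {k : ℕ} (hk : 1 ≤ k) :
    40 * C * (2 ^ k * (40 * e ^ (-(len k ^ psi)) * e ^ (1.2 * len k ^ psi)) * C) ≤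
      1 / 25 * (1 / 2) ^ k := by
  have h1 := h.le hk
  have e1 : e ^ (-(len k ^ psi)) * e ^ (1.2 * len k ^ psi) = e ^ (0.2 * len k ^ psi) := by
    rw [← Real.rpow_add he]
    congr 1
    ring
  have e2 : 40 * C * (2 ^ k * (40 * e ^ (-(len k ^ psi)) * e ^ (1.2 * len k ^ psi)) * C) =
      1600 * C ^ 2 * 2 ^ k * (e ^ (-(len k ^ psi)) * e ^ (1.2 * len k ^ psi)) := by ring
  rw [e2, e1]
  have p : 0 < C ^ 2 * 2 ^ k * e ^ (0.2 * len k ^ psi) := by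
    have := Real.rpow_pos_of_pos he (0.2 * len k ^ psi)
    positivity
  nlinarith

theorem Small.new (h : Small e C) (he : 0 < e) (he1 : e ≤ 1) (hC : 1 ≤ C) {k : ℕ} (hk : 1 ≤ k) :
    80 * 2 ^ k * C ^ 2 * e ^ (0.5 * len k ^ psi) ≤ 1 / 4 * (1 / 2) ^ k := by
  have h1 := h.le hk
  have h2 : e ^ (0.5 * len k ^ psi) ≤ e ^ (0.2 * len k ^ psi) := by
    refine Real.rpow_le_rpow_of_exponent_ge he he1 ?_
    have h4 : 0 ≤ len k ^ psi := Real.rpow_nonneg (zero_le_one.trans (one_le_len hk)) _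
    linarith
  have h3 : (0 : ℝ) < 2 ^ k * C ^ 2 := by positivity
  have := mul_le_mul_of_nonneg_left h2 h3.le
  have p : 0 < C ^ 2 * 2 ^ k * e ^ (0.2 * len k ^ psi) := by
    have := Real.rpow_pos_of_pos he (0.2 * len k ^ psi)
    positivity
  nlinarith

variable {T : Stage d}

/-- The constant is left free: the sharp one propagates the induction, and the uniform C is what is
exported. -/
theorem Good.step {k : ℕ} {C' c : ℝ} (hk : 1 ≤ k) (he : 0 < e) (hS : S.E = E)
    (hSe : eps S.γ = e) (hC : 1 ≤ C) (hsmall : Small e C) (he1 : e ≤ 1)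
    (hlE : |l - E| ≤ e ^ (len k ^ psi) / 2) (hM : e ^ (len k ^ psi) / |l - E| ≤ M)
    (hc : c ≤ |l - E| / 4) (h : T.Good e l E M C' c) :
    ∀ C'', C' ≤ C'' → C'' ≤ C → GoodStep S T k e l E C'' := by
  intro C'' h1 h2
  have hε : 0 < e ^ (len k ^ psi) := Real.rpow_pos_of_pos he _
  have hcost := h.cost.mono he hM h1
  have hconv := hcost.absConv he he1 (by positivity)
  obtain ⟨i1, i2, i3⟩ := invBound he hlE hS hSe hconv.1 hconv.2 h.rev_l h.rev_E
    fun a => (h.lip a).trans (ENNReal.ofReal_le_ofReal hc)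
  refine ⟨hcost, i1, i2, i3, ?_⟩
  have h3 := hsmall.contraction he hC hk
  have h4 : ((1 : ℝ) / 2) ^ k ≤ 1 := pow_le_one₀ (by norm_num) (by norm_num)
  have p := Real.rpow_pos_of_pos he (-(len k ^ psi))
  have p' := Real.rpow_pos_of_pos he (1.2 * len k ^ psi)
  set q := 2 ^ k * (40 * e ^ (-(len k ^ psi)) * e ^ (1.2 * len k ^ psi)) with hq
  have hq0 : 0 ≤ q := by positivity
  have h5 : q * C'' ≤ q * C := by gcongr
  have h6 : q * C ≤ C * (q * C) := le_mul_of_one_le_left (by positivity) hC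
  linarith

end Stage

theorem len_rpow_mono {i j : ℕ} (h : i ≤ j) : len i ^ psi ≤ len j ^ psi := by
  refine rpow_psi_mono (by unfold len; positivity) ?_
  unfold len
  exact zpow_le_zpow_right₀ (by norm_num) (by omega)

/-- The induction on the scales. -/
theorem good_stages (hγ : 0 < S.γ) (hSe : eps S.γ = e) (he1 : e ≤ 1) (hS : S.E = E)
    (hu : ∀ x ∈ S.box, |S.u x| ≤ 1) (hsmall : Stage.Small e (4 * 3 ^ d + 1)) {n : ℕ}
    (hl : |l - E| ≤ e ^ (len n ^ psi) / 2) :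
    ∀ j < n, Stage.GoodStep S (S.stage j) (j + 1) e l E (4 * 3 ^ d + 1) := by
  have he : 0 < e := hSe ▸ eps_pos hγ
  have hd : (0 : ℝ) ≤ 4 * 3 ^ d := by positivity
  have hC : (1 : ℝ) ≤ 4 * 3 ^ d + 1 := by linarith
  have hpow : ∀ j : ℕ, (0 : ℝ) < (1 / 2) ^ j := fun j => by positivity
  have hlE : ∀ j < n, |l - E| ≤ e ^ (len ((j + 1 : ℕ) : ℤ) ^ psi) / 2 := by
    intro j hj
    refine hl.trans ?_
    have := Real.rpow_le_rpow_of_exponent_ge he he1 (len_rpow_mono (show j + 1 ≤ n from hj))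
    linarith
  have hMj : ∀ j : ℕ, e ^ (len ((j + 1 : ℕ) : ℤ) ^ psi) / |l - E| ≤ e ^ (len j ^ psi) / |l - E| := by
    intro j
    have := Real.rpow_le_rpow_of_exponent_ge he he1 (len_rpow_mono (Nat.le_succ j))
    gcongr
  have hCj : ∀ j : ℕ, (4 * 3 ^ d + (1 - (1 / 2 : ℝ) ^ j)) ≤ 4 * 3 ^ d + 1 := by
    intro j
    linarith [hpow j]
  have hcj : ∀ j : ℕ, 1 / 4 * (1 - (1 / 2 : ℝ) ^ j) * |l - E| ≤ |l - E| / 4 := by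
    intro j
    have := mul_nonneg (hpow j).le (abs_nonneg (l - E))
    linarith
  -- The new contribution of step j + 1 is at most 2^(-(j+1))/4, so C grows by less than 1 and the
  -- Lipschitz constant stays below |l-E|/4. The factor M decreases with j, which only weakens the
  -- weighted norm.
  have key : ∀ j ≤ n, (S.stage j).Good e l E (e ^ (len j ^ psi) / |l - E|)
      (4 * 3 ^ d + (1 - (1 / 2) ^ j)) (1 / 4 * (1 - (1 / 2) ^ j) * |l - E|) := by
    intro j
    induction j with
    | zero =>
      intro _
      simpa [Setup.stage] using Stage.initial_good hγ hSe he1 hu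
    | succ j ih =>
      intro hj
      have hg := ih (by omega)
      have hle1 : (1 / 2 : ℝ) ^ j ≤ 1 := pow_le_one₀ (by norm_num) (by norm_num)
      have hst := hg.step (Nat.succ_le_succ (Nat.zero_le j)) he hS hSe hC hsmall he1 (hlE j hj) (hMj j)
        (hcj j) _ le_rfl (hCj j)
      have hCj0 : (0 : ℝ) ≤ 4 * 3 ^ d + (1 - (1 / 2) ^ j) := by linarith
      have hη : 80 * 2 ^ (j + 1) * (4 * 3 ^ d + (1 - (1 / 2 : ℝ) ^ j)) ^ 2 *
          e ^ (0.5 * len ((j + 1 : ℕ) : ℤ) ^ psi) ≤ 1 / 4 * (1 / 2) ^ (j + 1) := by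
        refine le_trans ?_ (hsmall.new he he1 hC (Nat.succ_le_succ (Nat.zero_le j)))
        have := Real.rpow_pos_of_pos he (0.5 * len ((j + 1 : ℕ) : ℤ) ^ psi)
        have := hCj j
        gcongr
      have hn := hst.good_next (Nat.succ_le_succ (Nat.zero_le j)) he he1 hCj0
        (by have := sub_nonneg.2 hle1; positivity) hg.lip hg.rev_l hg.rev_E hη
      refine ⟨hn.cost.mono he le_rfl ?_, fun a => (hn.lip a).trans
        (ENNReal.ofReal_le_ofReal (le_of_eq ?_)), hn.rev_l, hn.rev_E⟩
      · rw [pow_succ]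
        linarith [hpow j]
      · rw [pow_succ]
        ring
  intro j hj
  exact (key j hj.le).step (Nat.succ_le_succ (Nat.zero_le j)) he hS hSe hC hsmall he1 (hlE j hj)
    (hMj j) (hcj j) _ (hCj j) le_rfl

end Start

end

noncomputable section

open scoped Matrix.Norms.L2Operator

/-! ### Invertibility of D - λ and the Schur complement as a multigraph sum. -/

section Inverse
variable {d : ℕ} {S : Setup d} {T : Stage d} {k : ℕ} {e l E C : ℝ}

namespace Stage

theorem half_len_le_reach (hk : 1 ≤ k) {v : T.Graph} (hv : T.IsLong S k v) :
    1 / 2 * len k ≤ T.reach v := by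
  by_cases h : T.tgt v ∈ T.block k (T.src v)
  · exact len_le_reach_inside hv h
  · rcases hk.eq_or_lt with rfl | hk
    · have h1 : (1 : ℝ) ≤ T.reach v := by exact_mod_cast one_le_reach_long le_rfl hv
      rw [len_one]
      linarith
    · have h1 : ((4 * connLen k : ℕ) : ℝ) ≤ T.reach v := by exact_mod_cast reach_outside hk hv h
      rw [len_eq_connLen hk]
      push_cast at h1
      have : (0 : ℝ) ≤ connLen k := Nat.cast_nonneg _
      linarith

/-- The weight of a long step contains at least 4·(1/2)^ψ ≥ 2.5 units of L_k^ψ, more than 1.2; thus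
unweighted sums are dominated by those in `tsum_long_le`. -/
theorem one_le_gain (hk : 1 ≤ k) (he : 0 < e) (he1 : e ≤ 1) {v : T.Graph}
    (hv : T.IsLong S k v) :
    1 ≤ e ^ (1.2 * len k ^ psi) * e ^ (-(4 * (T.reach v : ℝ) ^ psi)) := by
  rw [← Real.rpow_add he]
  refine Real.one_le_rpow_of_pos_of_le_one_of_nonpos he he1 ?_
  have hL := zero_le_one.trans (one_le_len hk)
  have h1 := rpow_psi_mono (mul_nonneg (by norm_num) hL) (half_len_le_reach hk hv)
  rw [Real.mul_rpow (by norm_num) hL] at h1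
  have h2 := le_half_rpow_psi
  have h3 := Real.rpow_nonneg hL psi
  nlinarith

/-- The operator `(W - λ)⁻¹ V` is a contraction. -/
theorem GoodStep.contraction (hk : 1 ≤ k) (he : 0 < e) (he1 : e ≤ 1)
    (h : GoodStep S T k e l E C) {x : Pos d} (hx : x ∈ T.removed S k) :
    ∑ a ∈ T.block k x, ∑ b ∈ T.removed S k,
      ‖T.invBlock k l x a‖ * ‖vsum S T k Set.univ l a b‖ ≤ 1 / 2 := by
  have hε : 0 < e ^ (len k ^ psi) := Real.rpow_pos_of_pos he _
  have p0 := Real.rpow_pos_of_pos he (-(len k ^ psi))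
  have p1 := Real.rpow_pos_of_pos he (1.2 * len k ^ psi)
  have hM : 0 ≤ e ^ (len k ^ psi) / |l - E| := by positivity
  set β := 40 * e ^ (-(len k ^ psi)) with hβ
  have hβ0 : 0 ≤ β := by positivity
  have h1 := tsum_long_le (S := S) hk hβ0 he h.cost h.small x
  rw [← ENNReal.ofReal_le_ofReal_iff (by norm_num),
    ENNReal.ofReal_sum_of_nonneg fun _ _ => Finset.sum_nonneg fun _ _ => by positivity]
  refine le_trans ?_ h1
  set f : T.Graph → ENNReal := fun v => ENNReal.ofReal (β * e ^ (1.2 * len k ^ psi)) *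
    T.gcost e l E (e ^ (len k ^ psi) / |l - E|) v with hf
  have h2 : ∀ a ∈ T.block k x, ∀ b, ENNReal.ofReal (‖T.invBlock k l x a‖ *
      ‖vsum S T k Set.univ l a b‖) ≤
      ∑' v : T.Graph, pick (T.tgt v = b) (pick (T.src v = a ∧ T.IsLong S k v) (f v)) := by
    intro a ha b
    have hb : ‖T.invBlock k l x a‖ ≤ β := (norm_le_pairNorm hM _ _).trans (h.inv x hx a ha)
    rw [ENNReal.ofReal_mul (norm_nonneg _)]
    refine (mul_le_mul' (ENNReal.ofReal_le_ofReal hb) (ofReal_norm_tsum_le _)).trans ?_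
    rw [← ENNReal.tsum_mul_left]
    refine ENNReal.tsum_le_tsum fun v => ?_
    by_cases hv : T.src v = a ∧ T.tgt v = b ∧ T.Inside Set.univ v ∧ T.IsLong S k v
    · rw [pick_pos hv, pick_pos hv.2.1, pick_pos ⟨hv.1, hv.2.2.2⟩, hf]
      simp only [gcost]
      rw [← ENNReal.ofReal_mul hβ0, ← ENNReal.ofReal_mul (by positivity)]
      refine ENNReal.ofReal_le_ofReal ?_
      have g1 := one_le_gain hk he he1 hv.2.2.2
      have g2 := norm_le_pairNorm hM (T.val l v) (T.val E v)
      have g3 := pairNorm_nonneg hM (T.val l v) (T.val E v)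
      calc β * ‖T.val l v‖ ≤ β * pairNorm _ (T.val l v) (T.val E v) := by gcongr
        _ ≤ β * pairNorm _ (T.val l v) (T.val E v) *
          (e ^ (1.2 * len k ^ psi) * e ^ (-(4 * (T.reach v : ℝ) ^ psi))) :=
          le_mul_of_one_le_right (by positivity) g1
        _ = _ := by ring
    · rw [pick_neg hv, norm_zero, ENNReal.ofReal_zero, mul_zero]
      exact zero_le
  calc _ ≤ ∑ a ∈ T.block k x, ∑ b ∈ T.removed S k,
        ∑' v : T.Graph, pick (T.tgt v = b) (pick (T.src v = a ∧ T.IsLong S k v) (f v)) := by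
        refine Finset.sum_le_sum fun a ha => ?_
        rw [ENNReal.ofReal_sum_of_nonneg fun _ _ => by positivity]
        exact Finset.sum_le_sum fun b _ => h2 a ha b
    _ = ∑' v : T.Graph, ∑ a ∈ T.block k x, ∑ b ∈ T.removed S k,
        pick (T.tgt v = b) (pick (T.src v = a ∧ T.IsLong S k v) (f v)) := by
        rw [Summable.tsum_finsetSum fun _ _ => ENNReal.summable]
        refine Finset.sum_congr rfl fun a _ => ?_
        rw [Summable.tsum_finsetSum fun _ _ => ENNReal.summable]
    _ ≤ _ := by
        rw [tsum_subtype_pick _ f]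
        refine ENNReal.tsum_le_tsum fun v => ?_
        by_cases hv : T.src v ∈ T.block k x ∧ T.IsLong S k v
        · rw [pick_pos ⟨hx, hv⟩]
          refine le_of_eq ?_
          rw [Finset.sum_congr rfl fun a _ => sum_pick_eq fun _ => hv.2.2.1]
          simp only [pick_and, pick_pos hv.2]
          exact sum_pick_eq fun _ => hv.1
        · refine le_of_eq_of_le ?_ zero_le
          refine Finset.sum_eq_zero fun a ha => Finset.sum_eq_zero fun b _ => ?_
          have h' : ¬ (T.src v = a ∧ T.IsLong S k v) := fun h' => hv ⟨h'.1 ▸ ha, h'.2⟩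
          rw [pick_neg h', pick_zero]

/-- The matrix `D - λ` is injective. -/
theorem GoodStep.eq_zero (hk : 1 ≤ k) (he : 0 < e) (he1 : e ≤ 1)
    (h : GoodStep S T k e l E C) (Φ : Pos d → Mat2)
    (h0 : ∀ x ∈ T.removed S k, ∑ b ∈ T.removed S k, dsum S T k Set.univ l x b * Φ b = 0) :
    ∀ x ∈ T.removed S k, Φ x = 0 := by
  have hε : 0 < e ^ (len k ^ psi) := Real.rpow_pos_of_pos he _
  have hM : 0 ≤ e ^ (len k ^ psi) / |l - E| := by positivity
  have hT := (h.cost.absConv he he1 hM).1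
  have key : ∀ x ∈ T.removed S k, Φ x = -∑ a ∈ T.block k x, ∑ b ∈ T.removed S k,
      T.invBlock k l x a * (vsum S T k Set.univ l a b * Φ b) := by
    intro x hx
    have hxR := removed_subset hx
    have hxx := self_mem_block (k := k) hxR
    have h1 : ∑ a ∈ T.block k x, T.invBlock k l x a *
        ∑ b ∈ T.removed S k, dsum S T k Set.univ l a b * Φ b = 0 :=
      Finset.sum_eq_zero fun a ha => by rw [h0 a (removed_of_mem_block hx ha), mul_zero]
    have h2 : ∀ a ∈ T.block k x, ∑ b ∈ T.removed S k, dsum S T k Set.univ l a b * Φ b =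
        ∑ b ∈ T.block k x, (T.gsum (near k (T.block k x)) l a b - pick (a = b) (l • 1)) * Φ b +
        ∑ b ∈ T.removed S k, vsum S T k Set.univ l a b * Φ b := by
      intro a ha
      unfold dsum
      simp only [add_mul, Finset.sum_add_distrib, pick_mul, block_eq hxR ha]
      rw [sum_block_pick (fun b => (T.gsum (near k (T.block k x)) l a b - pick (a = b) (l • 1)) *
        Φ b) hx]
    rw [Finset.sum_congr rfl fun a ha => by rw [h2 a ha]] at h1
    simp only [mul_add, Finset.sum_add_distrib, Finset.mul_sum] at h1
    rw [Finset.sum_comm] at h1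
    simp only [← mul_assoc] at h1
    simp only [← Finset.sum_mul (T.block k x)] at h1
    rw [Finset.sum_congr rfl fun b hb => by rw [inv_mul_block hT h.inv_l hx hxx hb]] at h1
    simp only [pick_mul, one_mul] at h1
    rw [Finset.sum_eq_single x, pick_pos rfl] at h1
    · simp only [← mul_assoc]
      exact eq_neg_of_add_eq_zero_left h1
    · intro b _ hb
      exact pick_neg (Ne.symm hb) _
    · intro h'
      exact absurd hxx h'
  intro x hx
  -- At a maximum of ‖Φ‖ the relation Φ = -(W-λ)⁻¹VΦ and the contraction give ‖Φ m‖ ≤ ‖Φ m‖/2.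
  obtain ⟨m, hm, hmax⟩ := Finset.exists_max_image (T.removed S k) (fun y => ‖Φ y‖) ⟨x, hx⟩
  have h3 : ‖Φ m‖ ≤ 1 / 2 * ‖Φ m‖ := by
    conv_lhs => rw [key m hm, norm_neg]
    refine le_trans ?_ (mul_le_mul_of_nonneg_right (h.contraction hk he he1 hm) (norm_nonneg _))
    rw [Finset.sum_mul]
    refine (norm_sum_le _ _).trans (Finset.sum_le_sum fun a _ => ?_)
    rw [Finset.sum_mul]
    refine (norm_sum_le _ _).trans (Finset.sum_le_sum fun b hb => ?_)
    rw [mul_assoc]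
    refine (norm_mul_le _ _).trans (mul_le_mul_of_nonneg_left ?_ (norm_nonneg _))
    exact (norm_mul_le _ _).trans (mul_le_mul_of_nonneg_left (hmax b hb) (norm_nonneg _))
  have h4 := hmax x hx
  have h5 := norm_nonneg (Φ x)
  exact norm_eq_zero.1 (by linarith)

theorem sum_sites {B : Finset (Pos d)} (f : Pos d → Fin 2 → ℝ) :
    ∑ s : Sites B, f s.1 s.2 = ∑ b ∈ B, ∑ m, f b m := by
  rw [Fintype.sum_prod_type, Finset.univ_eq_attach, ← Finset.sum_attach B]

theorem sites_removed (s : Sites (T.R \ T.kept S k)) : s.1.1 ∈ T.removed S k :=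
  (Finset.ext_iff.1 sdiff_kept s.1.1).1 s.1.2

theorem sum_sites_removed (f : Pos d → Fin 2 → ℝ) :
    ∑ s : Sites (T.R \ T.kept S k), f s.1 s.2 = ∑ b ∈ T.removed S k, ∑ m, f b m :=
  (sum_sites f).trans (Finset.sum_congr sdiff_kept fun _ _ => rfl)

theorem gsum_sub_eq_dsum (hT : T.AbsConv l) {x y : Pos d} (hx : x ∈ T.removed S k)
    (hy : y ∈ T.removed S k) :
    T.gsum Set.univ l x y - pick (x = y) (l • 1) = dsum S T k Set.univ l x y := by
  unfold dsum
  rw [vsum_eq hT hx hy, Set.univ_inter]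
  by_cases h : y ∈ T.block k x
  · rw [pick_pos h, pick_pos h]
    abel
  · have hxy : x ≠ y := fun h' => h (h' ▸ self_mem_block (removed_subset hx))
    rw [pick_neg h, pick_neg h, pick_neg hxy]
    abel

variable {F : Matrix (Sites T.R) (Sites T.R) ℝ}

theorem cornerD_sub_apply (hT : T.AbsConv l)
    (hF : ∀ s t, F s t = T.gsum Set.univ l s.1 t.1 s.2 t.2) (s t : Sites (T.R \ T.kept S k)) :
    (cornerD F (T.kept S k) - l • 1) s t = dsum S T k Set.univ l s.1 t.1 s.2 t.2 := by
  rw [← gsum_sub_eq_dsum hT (sites_removed s) (sites_removed t), Matrix.sub_apply,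
    smul_one_apply_sites]
  refine congrArg₂ _ ?_ rfl
  exact hF _ _

theorem GoodStep.isUnit_cornerD (hk : 1 ≤ k) (he : 0 < e) (he1 : e ≤ 1)
    (h : GoodStep S T k e l E C) (hF : ∀ s t, F s t = T.gsum Set.univ l s.1 t.1 s.2 t.2) :
    IsUnit (cornerD F (T.kept S k) - l • 1) := by
  have hε : 0 < e ^ (len k ^ psi) := Real.rpow_pos_of_pos he _
  have hT := (h.cost.absConv he he1 (M := e ^ (len k ^ psi) / |l - E|) (by positivity)).1
  rw [← Matrix.mulVec_injective_iff_isUnit]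
  refine (injective_iff_map_eq_zero (Matrix.mulVecLin (cornerD F (T.kept S k) - l • 1))).2 ?_
  intro v hv
  classical
  let φ : Pos d → Fin 2 → ℝ := fun x i =>
    if hx : x ∈ T.R \ T.kept S k then v (⟨x, hx⟩, i) else 0
  have hφ : ∀ s : Sites (T.R \ T.kept S k), v s = φ s.1 s.2 := fun s => by
    simp only [φ]
    rw [dif_pos s.1.2]
  -- `eq_zero` concerns block-valued functions, so the vector is repeated in both columns.
  have hz := h.eq_zero hk he he1 (fun x => Matrix.of fun i _ => φ x i) (by
    intro x hx
    have hx' : x ∈ T.R \ T.kept S k := by rwa [sdiff_kept]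
    ext i j
    have h1 := congrFun hv (⟨x, hx'⟩, i)
    rw [Matrix.mulVecLin_apply, Matrix.mulVec, dotProduct] at h1
    rw [Finset.sum_congr rfl fun t _ => by rw [cornerD_sub_apply hT hF, hφ t],
      sum_sites_removed fun b m => dsum S T k Set.univ l x b i m * φ b m] at h1
    rw [Matrix.sum_apply]
    exact h1)
  funext s
  have h2 := congrFun (congrFun (hz s.1 (sites_removed s)) s.2) 0
  rw [hφ s]
  exact h2

/-- The walk sums solve the linear system for -(D-λ)⁻¹C, and invertibility makes the solution
unique. -/
theorem GoodStep.inv_mul_cornerC (hk : 1 ≤ k) (he : 0 < e) (he1 : e ≤ 1)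
    (h : GoodStep S T k e l E C) (hF : ∀ s t, F s t = T.gsum Set.univ l s.1 t.1 s.2 t.2)
    (hsub : T.kept S k ⊆ T.R) (s : Sites (T.R \ T.kept S k)) (t : Sites (T.kept S k)) :
    ((cornerD F (T.kept S k) - l • 1)⁻¹ * cornerC F hsub) s t =
      -wsum S T k Set.univ l s.1 t.1 s.2 t.2 := by
  have hε : 0 < e ^ (len k ^ psi) := Real.rpow_pos_of_pos he _
  have hT := (h.cost.absConv he he1 (M := e ^ (len k ^ psi) / |l - E|) (by positivity)).1
  have hW := (h.walkConv hk he he1).1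
  have hu := h.isUnit_cornerD hk he he1 hF
  let X : Matrix (Sites (T.R \ T.kept S k)) (Sites (T.kept S k)) ℝ :=
    fun s t => -wsum S T k Set.univ l s.1 t.1 s.2 t.2
  have hX : (cornerD F (T.kept S k) - l • 1) * X = cornerC F hsub := by
    ext s t
    rw [Matrix.mul_apply, Finset.sum_congr rfl fun b _ => by rw [cornerD_sub_apply hT hF],
      sum_sites_removed fun b m => dsum S T k Set.univ l s.1 b s.2 m *
        -wsum S T k Set.univ l b t.1 m t.2]
    have h1 := congrFun (congrFun (dsum_mul_wsum hT hW h.inv_l (sites_removed s)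
      (fun z _ => Set.mem_univ z) t.1.2) s.2) t.2
    rw [Matrix.sum_apply, Matrix.neg_apply] at h1
    simp only [mul_neg, Finset.sum_neg_distrib]
    rw [eq_comm, eq_neg_iff_add_eq_zero, ← eq_neg_iff_add_eq_zero.1 h1, add_comm]
    refine congrArg₂ _ ?_ ?_
    · exact Finset.sum_congr rfl fun b _ => (Matrix.mul_apply).symm
    · exact hF _ _
  rw [← hX, ← Matrix.mul_assoc, Matrix.nonsing_inv_mul _ ((Matrix.isUnit_iff_isUnit_det _).1 hu),
    Matrix.one_mul]

theorem GoodStep.schurStep_apply (hk : 1 ≤ k) (he : 0 < e) (he1 : e ≤ 1)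
    (h : GoodStep S T k e l E C) (hT' : (T.next S k).AbsConv l)
    (hF : ∀ s t, F s t = T.gsum Set.univ l s.1 t.1 s.2 t.2)
    (hsub : T.kept S k ⊆ T.R) (s t : Sites (T.kept S k)) :
    schurStep F hsub l s t = (T.next S k).gsum Set.univ l s.1 t.1 s.2 t.2 := by
  have hε : 0 < e ^ (len k ^ psi) := Real.rpow_pos_of_pos he _
  have hT := (h.cost.absConv he he1 (M := e ^ (len k ^ psi) / |l - E|) (by positivity)).1
  have hW := (h.walkConv hk he he1).1
  rw [gsum_next hT hW hT' s.1.2 t.1.2, schurStep, Matrix.sub_apply, Matrix.mul_assoc, Matrix.mul_apply,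
    Finset.sum_congr rfl fun b _ => by rw [h.inv_mul_cornerC hk he he1 hF hsub]]
  have h1 : ∀ b : Sites (T.R \ T.kept S k), cornerB F hsub s b =
    T.gsum Set.univ l s.1 b.1 s.2 b.2 := fun b => hF _ _
  rw [Finset.sum_congr rfl fun b _ => by rw [h1 b],
    sum_sites_removed fun b m => T.gsum Set.univ l s.1 b s.2 m *
      -wsum S T k Set.univ l b t.1 m t.2, Matrix.add_apply, Matrix.sum_apply]
  simp only [mul_neg, Finset.sum_neg_distrib, sub_neg_eq_add]
  refine congrArg₂ _ (hF _ _) ?_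
  exact Finset.sum_congr rfl fun b _ => (Matrix.mul_apply).symm

theorem GoodStep.extendStep_apply (hk : 1 ≤ k) (he : 0 < e) (he1 : e ≤ 1)
    (h : GoodStep S T k e l E C) (hF : ∀ s t, F s t = T.gsum Set.univ l s.1 t.1 s.2 t.2)
    (hsub : T.kept S k ⊆ T.R) (s : Sites T.R) (t : Sites (T.kept S k)) :
    extendStep F hsub l s t =
      (pick (s.1.1 = t.1.1) 1 + wsum S T k Set.univ l s.1 t.1 : Mat2) s.2 t.2 := by
  unfold extendStep
  rw [Matrix.add_apply]
  split_ifs with hs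
  · have h1 := smul_one_apply_sites (T.kept S k) 1 (⟨s.1.1, hs⟩, s.2) t
    rw [one_smul, one_smul] at h1
    rw [wsum_eq_zero_of_not_removed (fun h' => (mem_kept.1 hs).2 h'), h1]
    exact (add_zero _).symm
  · rw [Matrix.neg_apply, h.inv_mul_cornerC hk he he1 hF hsub, neg_neg,
      pick_neg fun h' => hs (by rw [h']; exact t.1.2)]
    exact (zero_add _).symm

end Stage

theorem Setup.ham_apply (s t : Sites S.box) :
    S.ham s t = (Stage.initial S).gsum Set.univ l s.1 t.1 s.2 t.2 := by
  change S.hamBlock s.1 t.1 s.2 t.2 = _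
  refine congrFun (congrFun (?_ : S.hamBlock s.1 t.1 = _) s.2) t.2
  unfold Stage.gsum
  by_cases h : posDist s.1.1 t.1.1 ≤ 1
  · obtain ⟨g₀, e₀⟩ : ∃ g : (Stage.initial S).Graph, g.1 = (s.1.1, t.1.1) :=
      ⟨⟨(s.1.1, t.1.1), s.1.2, t.1.2, h⟩, rfl⟩
    have h1 : (Stage.initial S).src g₀ = s.1 := congrArg Prod.fst e₀
    have h2 : (Stage.initial S).tgt g₀ = t.1 := congrArg Prod.snd e₀
    rw [tsum_eq_single g₀]
    · rw [pick_pos ⟨h1, h2, fun z _ => Set.mem_univ z⟩]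
      exact (congrArg₂ S.hamBlock h1 h2).symm
    · intro g hg
      refine pick_neg (fun h' => hg ?_) _
      exact Subtype.ext ((Prod.ext h'.1 h'.2.1 : g.1 = (s.1.1, t.1.1)).trans e₀.symm)
  · have h0 : S.hamBlock s.1.1 t.1.1 = 0 := by
      unfold Setup.hamBlock
      rw [if_neg, if_neg]
      · omega
      · intro h'
        rw [h', posDist_self] at h
        omega
    rw [h0]
    refine ((tsum_congr fun g => ?_).trans tsum_zero).symm
    refine pick_neg (fun h' => h ?_) _
    rw [← h'.1, ← h'.2.1]
    exact g.2.2.2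

end Inverse

end

noncomputable section

open scoped Matrix.Norms.L2Operator

/-! ### The kernel as a sum of multigraphs. -/

section KernelSum
variable {d : ℕ} {S : Setup d} {T : Stage d} {k n : ℕ} {e l E C : ℝ}

/-- The range stops at j < n because convergence at a stage is read off from the step that operates
on it. -/
theorem Setup.F_apply (he : 0 < e) (he1 : e ≤ 1)
    (hg : ∀ j < n, Stage.GoodStep S (S.stage j) (j + 1) e l E C) :
    ∀ j < n, ∀ s t, S.F l j s t = (S.stage j).gsum Set.univ l s.1 t.1 s.2 t.2 := by
  intro j
  induction j with
  | zero => exact fun _ => S.ham_apply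
  | succ j ih =>
    intro hj s t
    have hε : 0 < e ^ (len ((j + 1 + 1 : ℕ) : ℤ) ^ psi) := Real.rpow_pos_of_pos he _
    exact (hg j (by omega)).schurStep_apply (Nat.succ_le_succ (Nat.zero_le j)) he he1
      ((hg (j + 1) hj).cost.absConv he he1 (by positivity)).1 (ih (by omega))
      (S.R_succ_subset j) s t

theorem Setup.isUnit_D (he : 0 < e) (he1 : e ≤ 1)
    (hg : ∀ j < n, Stage.GoodStep S (S.stage j) (j + 1) e l E C) (j : ℕ) (hj : j < n) :
    IsUnit (S.D l j - l • 1) :=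
  (hg j hj).isUnit_cornerD (Nat.succ_le_succ (Nat.zero_le j)) he he1
    (S.F_apply he he1 hg j hj)

namespace GraphFamily

/-- The sum of the multigraphs from `x` to `y`. -/
def total (K : GraphFamily d) (l : ℝ) (x y : Pos d) : Mat2 :=
  ∑' g : K.Graph, pick (K.src g = x ∧ K.tgt g = y) (K.val l g)

/-- The sums of multigraphs from a given position converge absolutely. -/
def AbsConv (K : GraphFamily d) (l : ℝ) : Prop :=
  ∀ x, ∑' g : K.Graph, pick (K.src g = x) (ENNReal.ofReal ‖K.val l g‖) ≠ ⊤

theorem AbsConv.summable {K : GraphFamily d} (hK : K.AbsConv l) (x : Pos d) (p : K.Graph → Prop) :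
    Summable fun g => pick (K.src g = x ∧ p g) (K.val l g) := by
  refine summable_of_tsum_ofReal_norm ?_
  refine ne_top_of_le_ne_top (hK x) (ENNReal.tsum_le_tsum fun g => ?_)
  by_cases h1 : K.src g = x <;> by_cases h2 : p g <;> simp [h1, h2]

theorem AbsConv.hasSum {K : GraphFamily d} (hK : K.AbsConv l) (x y : Pos d) (i j : Fin 2) :
    HasSum (fun g : {g : K.Graph // K.src g = x ∧ K.tgt g = y} => K.val l g.1 i j)
      (K.total l x y i j) := by
  have h : HasSum _ (K.total l x y i j) :=
    Stage.hasSum_apply (hK.summable x fun g => K.tgt g = y) i j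
  refine (hasSum_subtype_iff_indicator (s := {g | K.src g = x ∧ K.tgt g = y})
    (f := fun g => K.val l g i j)).2 ?_
  convert h using 1
  funext g
  by_cases hg : K.src g = x ∧ K.tgt g = y
  · rw [Set.indicator_of_mem (by exact hg), pick_pos hg]
  · rw [Set.indicator_of_notMem (by exact hg), pick_neg hg]
    rfl

theorem tsum_walk_total {K : GraphFamily d} (hK : K.AbsConv l) (hW : Stage.WalkConv S T k l)
    (x y : Pos d)
    (hs : Summable fun p : Σ g : K.Graph, T.Walk S k (K.tgt g) =>
      pick (K.src p.1 = x ∧ p.2.tgt = y) (K.val l p.1 * p.2.val l)) :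
    ∑' p : Σ g : K.Graph, T.Walk S k (K.tgt g),
      pick (K.src p.1 = x ∧ p.2.tgt = y) (K.val l p.1 * p.2.val l) =
      ∑ b ∈ T.R, K.total l x b * Stage.wsum S T k Set.univ l b y := by
  have h1 : ∀ g : K.Graph, ∑' w : T.Walk S k (K.tgt g),
      pick (K.src g = x ∧ w.tgt = y) (K.val l g * w.val l) =
      pick (K.src g = x) (K.val l g * Stage.wsum S T k Set.univ l (K.tgt g) y) := by
    intro g
    by_cases hg : K.src g = x
    · rw [pick_pos hg, Stage.wsum, ← (hW.summable _ _).tsum_mul_left]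
      refine tsum_congr fun w => ?_
      by_cases hw : w.tgt = y
      · rw [pick_pos ⟨hg, hw⟩, pick_pos ⟨hw, fun z _ => Set.mem_univ z⟩]
      · rw [pick_neg fun h => hw h.2, pick_neg fun h => hw h.1, mul_zero]
    · rw [pick_neg hg]
      exact (tsum_congr fun w => pick_neg (fun h => hg h.1) _).trans tsum_zero
  have h2 : ∀ b, (fun g : K.Graph => pick (K.tgt g = b)
      (pick (K.src g = x) (K.val l g * Stage.wsum S T k Set.univ l (K.tgt g) y))) =
      fun g => pick (K.src g = x ∧ K.tgt g = b) (K.val l g) *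
        Stage.wsum S T k Set.univ l b y := by
    intro b
    funext g
    by_cases h : K.src g = x <;> by_cases h' : K.tgt g = b <;> simp [h, h']
  refine (hs.tsum_sigma.trans (tsum_congr h1)).trans ?_
  rw [tsum_fiber (K.tgt) T.R]
  · refine Finset.sum_congr rfl fun b _ => ?_
    rw [h2 b]
    exact (hK.summable x fun g => K.tgt g = b).tsum_mul_right _
  · intro g hg
    by_contra h
    refine hg ?_
    rw [Stage.wsum_eq_zero_of_not_removed fun h' => h (Stage.removed_subset h'), mul_zero,
      pick_zero]
  · intro b _
    rw [h2 b]
    exact (hK.summable x fun g => K.tgt g = b).mul_right _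

/-- This is (1 + K)(1 + X) - 1, with X the walk sums: keep K, append nothing but a walk, or append a
walk to K. -/
theorem total_next {K : GraphFamily d} (hK : K.AbsConv l) (hW : Stage.WalkConv S T k l)
    (hK' : (kernelNext S T k K).AbsConv l) (x : Pos d) {y : Pos d} (hy : y ∈ T.kept S k) :
    (kernelNext S T k K).total l x y = K.total l x y + (Stage.wsum S T k Set.univ l x y +
      ∑ b ∈ T.R, K.total l x b * Stage.wsum S T k Set.univ l b y) := by
  have hs := hK'.summable x fun g => (kernelNext S T k K).tgt g = y
  have hr := hs.comp_injective Sum.inr_injective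
  have hl := hr.comp_injective Sum.inl_injective
  have hrr := hr.comp_injective Sum.inr_injective
  refine (Summable.tsum_sum (hs.comp_injective Sum.inl_injective) hr).trans ?_
  refine congrArg₂ _ ?_ ((Summable.tsum_sum hl hrr).trans (congrArg₂ _ ?_ ?_))
  · refine (tsum_subtype_pick' (p := fun g => K.tgt g ∈ T.kept S k)
      (fun g => pick (K.src g = x ∧ K.tgt g = y) (K.val l g)) ?_)
    intro g hg
    by_contra h
    refine hg (pick_neg ?_ _)
    rintro ⟨-, rfl⟩
    exact h hy
  · refine hl.tsum_sigma.trans ((tsum_eq_single x ?_).trans (tsum_congr fun w => ?_))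
    · intro z hz
      exact (tsum_congr fun w => pick_neg (fun h => hz h.1) _).trans tsum_zero
    · refine pick_congr ?_ _
      exact ⟨fun h => ⟨h.2, fun z _ => Set.mem_univ z⟩, fun h => ⟨rfl, h.1⟩⟩
  · exact tsum_walk_total hK hW x y hrr

end GraphFamily

theorem Setup.G_apply (he : 0 < e) (he1 : e ≤ 1)
    (hg : ∀ j < n, Stage.GoodStep S (S.stage j) (j + 1) e l E C)
    (hK : ∀ j ≤ n, (S.kernelGraphs j).AbsConv l) :
    ∀ j ≤ n, ∀ (s : Sites (S.R 0)) (t : Sites (S.R j)), S.G l j s t =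
      (pick (s.1.1 = t.1.1) 1 + (S.kernelGraphs j).total l s.1 t.1 : Mat2) s.2 t.2 := by
  intro j
  induction j with
  | zero =>
    intro _ s t
    have h1 := Stage.smul_one_apply_sites (S.R 0) 1 s t
    rw [one_smul, one_smul] at h1
    have h0 : (S.kernelGraphs 0).total l s.1 t.1 = 0 :=
      tsum_empty (β := Empty)
    rw [h0, add_zero]
    exact h1
  | succ j ih =>
    intro hj s t
    have h := hg j hj
    have hW : Stage.WalkConv S (S.stage j) (j + 1) l := (h.walkConv (Nat.succ_le_succ (Nat.zero_le j)) he he1).1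
    have hF := S.F_apply he he1 hg j hj
    have ht : t.1.1 ∈ (S.stage j).kept S (j + 1) := t.1.2
    have htR : t.1.1 ∈ S.R j := S.R_succ_subset j t.1.2
    have e1 : (S.kernelGraphs (j + 1)).total l s.1 t.1 = _ :=
      GraphFamily.total_next (hK j (by omega)) hW (hK (j + 1) hj) s.1 ht
    rw [e1]
    change (S.G l j * extendStep (S.F l j) (S.R_succ_subset j) l) s t = _
    have hext : ∀ b : Sites (S.R j), extendStep (S.F l j) (S.R_succ_subset j) l b t =
        (pick (b.1.1 = t.1.1) 1 +
          Stage.wsum S (S.stage j) (j + 1) Set.univ l b.1 t.1 : Mat2) b.2 t.2 := fun b =>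
      h.extendStep_apply (Nat.succ_le_succ (Nat.zero_le j)) he he1 hF (S.R_succ_subset j) b t
    rw [Matrix.mul_apply, Finset.sum_congr rfl fun b _ =>
      congrArg₂ (fun p q : ℝ => p * q) (ih (by omega) s b) (hext b)]
    rw [Stage.sum_sites fun b m =>
      (pick (s.1.1 = b) 1 + (S.kernelGraphs j).total l s.1 b : Mat2) s.2 m *
      (pick (b = t.1.1) 1 + Stage.wsum S (S.stage j) (j + 1) Set.univ l b t.1 : Mat2) m t.2]
    have e2 : ∑ b ∈ S.R j, (pick (s.1.1 = b) 1 + (S.kernelGraphs j).total l s.1 b : Mat2) *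
        (pick (b = t.1.1) 1 + Stage.wsum S (S.stage j) (j + 1) Set.univ l b t.1) =
        pick (s.1.1 = t.1.1) 1 + ((S.kernelGraphs j).total l s.1 t.1 +
          (Stage.wsum S (S.stage j) (j + 1) Set.univ l s.1 t.1 +
          ∑ b ∈ S.R j, (S.kernelGraphs j).total l s.1 b *
            Stage.wsum S (S.stage j) (j + 1) Set.univ l b t.1)) := by
      have e3 : ∀ b, (pick (s.1.1 = b) 1 + (S.kernelGraphs j).total l s.1 b : Mat2) *
          (pick (b = t.1.1) 1 + Stage.wsum S (S.stage j) (j + 1) Set.univ l b t.1) =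
          pick (t.1.1 = b) (pick (s.1.1 = t.1.1) 1 + (S.kernelGraphs j).total l s.1 t.1) +
          (pick (s.1.1 = b) (Stage.wsum S (S.stage j) (j + 1) Set.univ l s.1 t.1) +
          (S.kernelGraphs j).total l s.1 b *
            Stage.wsum S (S.stage j) (j + 1) Set.univ l b t.1) := by
        intro b
        rw [add_mul, mul_add, mul_add]
        have a1 : (pick (s.1.1 = b) 1 * pick (b = t.1.1) 1 : Mat2) +
            (S.kernelGraphs j).total l s.1 b * pick (b = t.1.1) 1 =
            pick (t.1.1 = b) (pick (s.1.1 = t.1.1) 1 + (S.kernelGraphs j).total l s.1 t.1) := by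
          by_cases hb : b = t.1.1
          · subst hb
            simp
          · rw [pick_neg hb, pick_neg (Ne.symm hb), mul_zero, mul_zero, add_zero]
        have a2 : (pick (s.1.1 = b) 1 * Stage.wsum S (S.stage j) (j + 1) Set.univ l b t.1 : Mat2) =
            pick (s.1.1 = b) (Stage.wsum S (S.stage j) (j + 1) Set.univ l s.1 t.1) := by
          by_cases hb : s.1.1 = b
          · subst hb
            simp
          · rw [pick_neg hb, pick_neg hb, zero_mul]
        rw [← a1, ← a2]
        abel
      rw [Finset.sum_congr rfl fun b _ => e3 b, Finset.sum_add_distrib, Finset.sum_add_distrib,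
        sum_pick_eq fun _ => htR, sum_pick_eq, add_assoc]
      -- If the source is outside R^(j), no walk starts there and the corresponding sum vanishes.
      intro hne
      by_contra h'
      exact hne (Stage.wsum_eq_zero_of_not_removed (fun h2 => h' (Stage.removed_subset h2)) _)
    refine Eq.trans ?_ (congrFun (congrFun e2 s.2) t.2)
    rw [Matrix.sum_apply]
    exact Finset.sum_congr rfl fun b _ => (Matrix.mul_apply).symm

theorem Setup.hasSum_kernelGraphs (he : 0 < e) (he1 : e ≤ 1)
    (hg : ∀ j < n, Stage.GoodStep S (S.stage j) (j + 1) e l E C)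
    (hK : ∀ j ≤ n, (S.kernelGraphs j).AbsConv l) (s : Sites (S.R 0)) (t : Sites (S.R n)) :
    HasSum (fun g : {g : (S.kernelGraphs n).Graph //
        (S.kernelGraphs n).src g = s.1 ∧ (S.kernelGraphs n).tgt g = t.1} =>
        (S.kernelGraphs n).val l g.1 s.2 t.2)
      (S.G l n s t - if s.1.1 = t.1.1 ∧ s.2 = t.2 then 1 else 0) := by
  have h := (hK n le_rfl).hasSum s.1 t.1 s.2 t.2
  convert h using 1
  rw [S.G_apply he he1 hg hK n le_rfl s t, Matrix.add_apply]
  by_cases h1 : s.1.1 = t.1.1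
  · by_cases h2 : s.2 = t.2
    · rw [if_pos ⟨h1, h2⟩, pick_pos h1, h2, Matrix.one_apply_eq]
      ring
    · rw [if_neg fun h => h2 h.2, pick_pos h1, Matrix.one_apply_ne h2]
      ring
  · rw [if_neg fun h => h1 h.1, pick_neg h1, Matrix.zero_apply]
    ring

end KernelSum

end

noncomputable section

open scoped Matrix.Norms.L2Operator

/-! ### Weighted sums for the kernel. -/

section KernelCost
variable {d : ℕ} {S : Setup d} {T : Stage d} {k n : ℕ} {e l E M C : ℝ}

namespace GraphFamily

/-- The weighted sum of the multigraphs of a kernel that start at `x`. -/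
def cost (K : GraphFamily d) (e l : ℝ) (x : Pos d) : ENNReal :=
  ∑' g : K.Graph, pick (K.src g = x)
    (ENNReal.ofReal (‖K.val l g‖ * e ^ (-(3 * (posDist x (K.tgt g) : ℝ) ^ psi))))

/-- The weighted sum of the multigraphs of a kernel that start at `x`, where the weights do not see
distances below the scale `L_k`. -/
def newCost (K : GraphFamily d) (k : ℕ) (e l : ℝ) (x : Pos d) : ENNReal :=
  ∑' g : K.Graph, pick (K.src g = x)
    (ENNReal.ofReal (‖K.val l g‖ * e ^ (-(3 * max (posDist x (K.tgt g) : ℝ) (len k) ^ psi))))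

theorem absConv_of_cost {K : GraphFamily d} (he : 0 < e) (he1 : e ≤ 1)
    (h : ∀ x, K.cost e l x ≠ ⊤) : K.AbsConv l := by
  intro x
  refine ne_top_of_le_ne_top (h x) (ENNReal.tsum_le_tsum fun g => ?_)
  by_cases hg : K.src g = x
  · rw [pick_pos hg, pick_pos hg]
    refine ENNReal.ofReal_le_ofReal (le_mul_of_one_le_right (norm_nonneg _) ?_)
    refine Real.one_le_rpow_of_pos_of_le_one_of_nonpos he he1 ?_
    have : 0 ≤ (posDist x (K.tgt g) : ℝ) ^ psi := by positivity
    linarith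
  · rw [pick_neg hg]
    exact zero_le

theorem cost_le_newCost (K : GraphFamily d) (he : 0 < e) (he1 : e ≤ 1) (x : Pos d) :
    K.cost e l x ≤ K.newCost k e l x := by
  refine ENNReal.tsum_le_tsum fun g => ?_
  by_cases hg : K.src g = x
  · rw [pick_pos hg, pick_pos hg]
    refine ENNReal.ofReal_le_ofReal (mul_le_mul_of_nonneg_left ?_ (norm_nonneg _))
    refine Real.rpow_le_rpow_of_exponent_ge he he1 ?_
    have := rpow_psi_mono (Nat.cast_nonneg (posDist x (K.tgt g))) (le_max_left _ (len k))
    linarith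
  · rw [pick_neg hg, pick_neg hg]

theorem absSum_le_newCost (K : GraphFamily d) (he : 0 < e) (x y : Pos d) :
    K.absSum l x y ≤ ENNReal.ofReal (e ^ (3 * max (posDist x y : ℝ) (len k) ^ psi)) *
      K.newCost k e l x := by
  unfold absSum newCost
  rw [tsum_subtype_pick (fun g => K.src g = x ∧ K.tgt g = y)
    fun g => ENNReal.ofReal (blockNorm (K.val l g)), ← ENNReal.tsum_mul_left]
  refine ENNReal.tsum_le_tsum fun g => ?_
  by_cases hg : K.src g = x ∧ K.tgt g = y
  · have hp := Real.rpow_pos_of_pos he (3 * max (posDist x y : ℝ) (len k) ^ psi)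
    rw [pick_pos hg, pick_pos hg.1, ← ENNReal.ofReal_mul hp.le, hg.2, Real.rpow_neg he.le,
      blockNorm_eq]
    refine ENNReal.ofReal_le_ofReal (le_of_eq ?_)
    field_simp
  · rw [pick_neg hg]
    exact zero_le

/-- A walk is at least as long as both |x - y| and L_k, so its own weight controls the distance
weight truncated at L_k. -/
theorem weight_le_cost (hk : 1 ≤ k) (he : 0 < e) (he1 : e ≤ 1) (hM : 0 ≤ M) {x : Pos d}
    (w : T.Walk S k x) :
    ENNReal.ofReal (‖w.val l‖ * e ^ (-(3 * max (posDist x w.tgt : ℝ) (len k) ^ psi))) ≤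
      w.cost e l E M 3 := by
  have hx := w.posDist_le_wlen hk x (Stage.self_mem_block (Stage.removed_subset w.start_removed))
  have h1 : max (posDist x w.tgt : ℝ) (len k) ≤ w.wlen :=
    max_le (by exact_mod_cast hx) (w.len_le_wlen hk)
  have h2 := rpow_psi_mono (le_max_of_le_left (Nat.cast_nonneg _)) h1
  have h3 := Real.rpow_le_rpow_of_exponent_ge he he1
    (show -(3 * (w.wlen : ℝ) ^ psi) ≤ -(3 * max (posDist x w.tgt : ℝ) (len k) ^ psi) by linarith)
  have h4 := norm_le_pairNorm hM (w.val l) (w.val E)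
  have h5 := Real.rpow_pos_of_pos he (-(3 * max (posDist x w.tgt : ℝ) (len k) ^ psi))
  refine ENNReal.ofReal_le_ofReal ?_
  exact mul_le_mul h4 h3 h5.le (pairNorm_nonneg hM _ _)

/-- Plain subadditivity suffices: no resolvent is spent where a walk is appended to a kernel
multigraph. -/
theorem weight_mul_le_cost (hk : 1 ≤ k) (he : 0 < e) (he1 : e ≤ 1) (hM : 0 ≤ M) (x : Pos d)
    {z : Pos d} (A : Mat2) (w : T.Walk S k z) :
    ENNReal.ofReal (‖A * w.val l‖ * e ^ (-(3 * max (posDist x w.tgt : ℝ) (len k) ^ psi))) ≤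
      ENNReal.ofReal (‖A‖ * e ^ (-(3 * (posDist x z : ℝ) ^ psi))) * w.cost e l E M 3 := by
  have hz := w.posDist_le_wlen hk z (Stage.self_mem_block (Stage.removed_subset w.start_removed))
  have h0 := posDist_triangle x z w.tgt
  have h1 : max (posDist x w.tgt : ℝ) (len k) ≤ posDist x z + w.wlen := by
    refine max_le (by exact_mod_cast h0.trans (Nat.add_le_add_left hz _)) ?_
    have := w.len_le_wlen hk
    have := Nat.cast_nonneg (α := ℝ) (posDist x z)
    linarith
  have h2 := rpow_psi_mono (le_max_of_le_left (Nat.cast_nonneg _)) h1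
  have h2' := rpow_psi_add_le (Nat.cast_nonneg (α := ℝ) (posDist x z))
    (Nat.cast_nonneg (α := ℝ) w.wlen)
  have h3 := Real.rpow_le_rpow_of_exponent_ge he he1
    (show -(3 * (posDist x z : ℝ) ^ psi) + -(3 * (w.wlen : ℝ) ^ psi) ≤
      -(3 * max (posDist x w.tgt : ℝ) (len k) ^ psi) by linarith)
  rw [Real.rpow_add he] at h3
  have h4 := norm_le_pairNorm hM (w.val l) (w.val E)
  have p1 := Real.rpow_pos_of_pos he (-(3 * (posDist x z : ℝ) ^ psi))
  have p2 := Real.rpow_pos_of_pos he (-(3 * (w.wlen : ℝ) ^ psi))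
  have p3 := Real.rpow_pos_of_pos he (-(3 * max (posDist x w.tgt : ℝ) (len k) ^ psi))
  rw [Stage.Walk.cost, ← ENNReal.ofReal_mul (by positivity)]
  refine ENNReal.ofReal_le_ofReal ?_
  calc _ ≤ (‖A‖ * ‖w.val l‖) * (e ^ (-(3 * (posDist x z : ℝ) ^ psi)) *
        e ^ (-(3 * (w.wlen : ℝ) ^ psi))) :=
        mul_le_mul (norm_mul_le _ _) h3 p3.le (by positivity)
    _ ≤ (‖A‖ * pairNorm M (w.val l) (w.val E)) * (e ^ (-(3 * (posDist x z : ℝ) ^ psi)) *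
        e ^ (-(3 * (w.wlen : ℝ) ^ psi))) := by gcongr
    _ = _ := by ring

/-- Sums over the new multigraphs of the kernel that start at a given position. -/
theorem tsum_kernelNew_le (K : GraphFamily d) (x : Pos d)
    (f : (kernelNew S T k K).Graph → ENNReal) (f0 : K.Graph → ENNReal) {A Θ : ENNReal}
    (h1 : ∑' w : T.Walk S k x, f (Sum.inl ⟨x, w⟩) ≤ A)
    (h2 : ∀ g, K.src g = x → ∑' w : T.Walk S k (K.tgt g), f (Sum.inr ⟨g, w⟩) ≤ f0 g * Θ) :
    ∑' g, pick ((kernelNew S T k K).src g = x) (f g) ≤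
      A + (∑' g, pick (K.src g = x) (f0 g)) * Θ := by
  refine (Summable.tsum_sum ENNReal.summable ENNReal.summable).trans_le (add_le_add ?_ ?_)
  · refine le_of_eq_of_le (ENNReal.tsum_sigma' _) ?_
    refine le_of_eq_of_le (tsum_eq_single x fun z hz => ?_) (le_of_eq_of_le ?_ h1)
    · exact (tsum_congr fun w => pick_neg (fun h => hz h) _).trans tsum_zero
    · exact tsum_congr fun w => pick_pos rfl _
  · refine le_of_eq_of_le (ENNReal.tsum_sigma' _) ?_
    rw [← ENNReal.tsum_mul_right]
    refine ENNReal.tsum_le_tsum fun g => ?_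
    by_cases hg : K.src g = x
    · rw [pick_pos hg]
      exact le_of_eq_of_le (tsum_congr fun w => pick_pos hg _) (h2 g hg)
    · exact le_of_eq_of_le ((tsum_congr fun w => pick_neg (fun h => hg h) _).trans tsum_zero)
        zero_le

theorem newCost_kernelNew_le (hk : 1 ≤ k) (he : 0 < e) (he1 : e ≤ 1) (hM : 0 ≤ M)
    (K : GraphFamily d) {Θ : ENNReal} (hΘ : ∀ x, ∑' w : T.Walk S k x, w.cost e l E M 3 ≤ Θ)
    (x : Pos d) : (kernelNew S T k K).newCost k e l x ≤ Θ + K.cost e l x * Θ := by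
  refine tsum_kernelNew_le K x (fun g => ENNReal.ofReal (‖(kernelNew S T k K).val l g‖ *
    e ^ (-(3 * max (posDist x ((kernelNew S T k K).tgt g) : ℝ) (len k) ^ psi)))) _ ?_ ?_
  · exact (ENNReal.tsum_le_tsum fun w => weight_le_cost hk he he1 hM w).trans (hΘ x)
  · intro g _
    refine (ENNReal.tsum_le_tsum fun w => 
      weight_mul_le_cost (E := E) hk he he1 hM x (K.val l g) w).trans ?_
    rw [ENNReal.tsum_mul_left]
    exact mul_le_mul_right (hΘ _) _

theorem cost_kernelNext_le (he : 0 < e) (he1 : e ≤ 1) (K : GraphFamily d) (x : Pos d) :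
    (kernelNext S T k K).cost e l x ≤ K.cost e l x + (kernelNew S T k K).newCost k e l x := by
  refine (Summable.tsum_sum ENNReal.summable ENNReal.summable).trans_le (add_le_add ?_ ?_)
  · exact ENNReal.tsum_comp_le_tsum_of_injective
      (f := fun g : {g : K.Graph // K.tgt g ∈ T.kept S k} => g.1) Subtype.val_injective
      fun g => pick (K.src g = x)
        (ENNReal.ofReal (‖K.val l g‖ * e ^ (-(3 * (posDist x (K.tgt g) : ℝ) ^ psi))))
  · exact (kernelNew S T k K).cost_le_newCost he he1 x

end GraphFamily

end KernelCost

end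

noncomputable section

open scoped Matrix.Norms.L2Operator

/-! ### Bounds for the kernel, uniform in the scale. -/

section KernelBound
variable {d : ℕ} {S : Setup d} {T : Stage d} {k n : ℕ} {e l E C : ℝ}

namespace Stage

/-- The exit gain cancels the resolvent exactly, so only the constant 2·2·40·C remains, with no
small factor. -/
theorem GoodStep.tsum_cost_one (he : 0 < e) (he1 : e ≤ 1) (h : GoodStep S T 1 e l E C)
    (x : Pos d) : ∑' w : T.Walk S 1 x,
      w.cost e l E (e ^ (len ((1 : ℕ) : ℤ) ^ psi) / |l - E|) 3 ≤ ENNReal.ofReal (160 * C) := by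
  have hε : 0 < e ^ (len ((1 : ℕ) : ℤ) ^ psi) := Real.rpow_pos_of_pos he _
  have p0 := Real.rpow_pos_of_pos he (-(len ((1 : ℕ) : ℤ) ^ psi))
  refine (tsum_cost_le le_rfl he he1 (by positivity) (by positivity) h.inv h.cost h.small le_rfl
    (by norm_num) (δ := 1) (fun x c hx hj hc => exit_gain_one c hx hj hc) x).trans
    (ENNReal.ofReal_le_ofReal (le_of_eq ?_))
  rw [len_one, Real.one_rpow, Real.rpow_neg_one, Real.rpow_one]
  field_simp
  ring

theorem GoodStep.tsum_cost (hk : 2 ≤ k) (he : 0 < e) (he1 : e ≤ 1) (h : GoodStep S T k e l E C)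
    (x : Pos d) : ∑' w : T.Walk S k x, w.cost e l E (e ^ (len k ^ psi) / |l - E|) 3 ≤
      ENNReal.ofReal (80 * 2 ^ k * C * e ^ (0.3 * len k ^ psi)) := by
  have hε : 0 < e ^ (len k ^ psi) := Real.rpow_pos_of_pos he _
  have p0 := Real.rpow_pos_of_pos he (-(len k ^ psi))
  refine (tsum_cost_le (by omega) he he1 (by positivity) (by positivity) h.inv h.cost h.small le_rfl
    (by norm_num) (fun x c hx hj hc => exit_gain hk c hx hj hc) x).trans
    (ENNReal.ofReal_le_ofReal (le_of_eq ?_))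
  have e1 : e ^ (0.3 * len k ^ psi) = e ^ (-(len k ^ psi)) * e ^ (1.3 * len k ^ psi) := by
    rw [← Real.rpow_add he]
    congr 1
    ring
  rw [e1]
  ring

/-- Since 1250·80 = 100000, this is the smallness condition; the surplus 1250C absorbs the kernel
bound 2(1 + 160C). -/
theorem Small.theta (h : Small e C) (he : 0 < e) (he1 : e ≤ 1) (hC : 1 ≤ C) (hk : 1 ≤ k) :
    1250 * C * (80 * 2 ^ k * C * e ^ (0.3 * len k ^ psi)) ≤ (1 / 2) ^ k := by
  refine le_trans ?_ (h.le hk)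
  have h2 : e ^ (0.3 * len k ^ psi) ≤ e ^ (0.2 * len k ^ psi) := by
    refine Real.rpow_le_rpow_of_exponent_ge he he1 ?_
    have h4 : 0 ≤ len k ^ psi := Real.rpow_nonneg (zero_le_one.trans (one_le_len hk)) _
    linarith
  have h3 : (0 : ℝ) < 100000 * C ^ 2 * 2 ^ k := by positivity
  have := mul_le_mul_of_nonneg_left h2 h3.le
  linarith

/-- The sum of the walks with at least two steps in the first step. -/
theorem GoodStep.tsum_cost_step_one (he : 0 < e) (he1 : e ≤ 1) (hC : 1 ≤ C) (hsmall : Small e C)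
    (h : GoodStep S T 1 e l E C) (x : Pos d) :
    ∑' v : {v : T.Graph // x ∈ T.removed S 1 ∧ T.src v ∈ T.block 1 x ∧ T.IsLong S 1 v},
      ∑' w : T.Walk S 1 (T.tgt v.1), (Walk.step v.1 v.2.1 v.2.2.1 v.2.2.2 w).cost e l E
        (e ^ (len ((1 : ℕ) : ℤ) ^ psi) / |l - E|) 3 ≤ ENNReal.ofReal (1 / 2) := by
  have hε : 0 < e ^ (len ((1 : ℕ) : ℤ) ^ psi) := Real.rpow_pos_of_pos he _
  have p0 := Real.rpow_pos_of_pos he (-(len ((1 : ℕ) : ℤ) ^ psi))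
  have p1 := Real.rpow_pos_of_pos he (1.2 * len ((1 : ℕ) : ℤ) ^ psi)
  refine (tsum_walk_step_le (fun x w => w.cost e l E
    (e ^ (len ((1 : ℕ) : ℤ) ^ psi) / |l - E|) 3) _ _ _
    (fun x v hx hj hv w => cost_step_le le_rfl he he1 (by positivity) (by positivity) h.inv le_rfl
      (by norm_num) v hx hj hv w) (fun x => tsum_long_le (S := S) le_rfl (by positivity) he h.cost le_rfl x)
    (fun x => h.tsum_cost_one he he1 x) x).trans ?_
  rw [← ENNReal.ofReal_mul (by positivity)]
  refine ENNReal.ofReal_le_ofReal ?_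
  have := hsmall.contraction he hC le_rfl
  linarith

end Stage

/-- A bound for the kernel that is uniform in the scale. -/
theorem Setup.cost_kernelGraphs_le (he : 0 < e) (he1 : e ≤ 1) (hC : 1 ≤ C)
    (hsmall : Stage.Small e C)
    (hg : ∀ j < n, Stage.GoodStep S (S.stage j) (j + 1) e l E C) :
    ∀ j ≤ n, ∀ x, 1 + (S.kernelGraphs j).cost e l x ≤
      ENNReal.ofReal ((1 + 160 * C) * (2 - (1 / 2) ^ j)) := by
  have h0 : ∀ x, (S.kernelGraphs 0).cost e l x = 0 := fun x => tsum_empty (β := Empty)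
  have hstep : ∀ j < n, ∀ θ, (∀ x, ∑' w : (S.stage j).Walk S (j + 1) x,
      w.cost e l E (e ^ (len ((j + 1 : ℕ) : ℤ) ^ psi) / |l - E|) 3 ≤ θ) → ∀ x,
      1 + (S.kernelGraphs (j + 1)).cost e l x ≤ (1 + (S.kernelGraphs j).cost e l x) * (1 + θ) := by
    intro j hj θ hθ x
    have hε : 0 < e ^ (len ((j + 1 : ℕ) : ℤ) ^ psi) := Real.rpow_pos_of_pos he _
    have h1 := GraphFamily.newCost_kernelNew_le (Nat.succ_le_succ (Nat.zero_le j)) he he1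
      (by positivity) (S.kernelGraphs j) hθ x
    have h2 := GraphFamily.cost_kernelNext_le (S := S) (T := S.stage j) (k := j + 1) (l := l) he he1
      (S.kernelGraphs j) x
    calc _ ≤ 1 + ((S.kernelGraphs j).cost e l x + (θ + (S.kernelGraphs j).cost e l x * θ)) :=
          add_le_add le_rfl (h2.trans (add_le_add le_rfl h1))
      _ = _ := by ring
  intro j
  induction j with
  | zero =>
    intro _ x
    rw [h0, add_zero, ENNReal.one_le_ofReal]
    norm_num
    linarith
  | succ j ih =>
    intro hj x
    -- The first scale contributes the factor 1 + 160C once; later factors 1 + θ_j are absorbed by 2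
    -- - 2^(-j).
    rcases Nat.eq_zero_or_pos j with rfl | hj0
    · refine (hstep 0 (by omega) _ ((hg 0 (by omega)).tsum_cost_one he he1) x).trans ?_
      rw [h0, add_zero, one_mul, ← ENNReal.ofReal_one, ← ENNReal.ofReal_add (by norm_num)
        (by linarith)]
      refine ENNReal.ofReal_le_ofReal ?_
      norm_num
      linarith
    · refine (hstep j (by omega) _ ((hg j (by omega)).tsum_cost (by omega) he he1) x).trans ?_
      have hth := hsmall.theta he he1 hC (Nat.succ_le_succ (Nat.zero_le j))
      have p0 := Real.rpow_pos_of_pos he (0.3 * len ((j + 1 : ℕ) : ℤ) ^ psi)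
      set θ := 80 * 2 ^ (j + 1) * C * e ^ (0.3 * len ((j + 1 : ℕ) : ℤ) ^ psi) with hθ
      have hθ0 : 0 ≤ θ := by positivity
      refine (mul_le_mul' (ih (by omega) x) le_rfl).trans ?_
      have hle1 : (1 / 2 : ℝ) ^ j ≤ 1 := pow_le_one₀ (by norm_num) (by norm_num)
      have hp : (0 : ℝ) < (1 / 2) ^ j := by positivity
      rw [← ENNReal.ofReal_one, ← ENNReal.ofReal_add (by norm_num) hθ0,
        ← ENNReal.ofReal_mul (mul_nonneg (by linarith) (by linarith))]
      refine ENNReal.ofReal_le_ofReal ?_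
      rw [mul_assoc]
      refine mul_le_mul_of_nonneg_left ?_ (by linarith)
      have h1 : 1250 * θ ≤ (1 / 2) ^ (j + 1) := by
        refine le_trans ?_ hth
        have := mul_le_mul_of_nonneg_right hC hθ0
        linarith
      rw [pow_succ] at h1 ⊢
      nlinarith [mul_nonneg hp.le hθ0]

theorem Setup.absConv_kernelGraphs (he : 0 < e) (he1 : e ≤ 1) (hC : 1 ≤ C)
    (hsmall : Stage.Small e C)
    (hg : ∀ j < n, Stage.GoodStep S (S.stage j) (j + 1) e l E C) (j : ℕ) (hj : j ≤ n) :
    (S.kernelGraphs j).AbsConv l :=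
  GraphFamily.absConv_of_cost he he1 fun x => ne_top_of_le_ne_top ENNReal.ofReal_ne_top
    (le_add_self.trans (S.cost_kernelGraphs_le he he1 hC hsmall hg j hj x))

theorem Setup.newCost_newKernelGraphs_le (he : 0 < e) (he1 : e ≤ 1) (hC : 1 ≤ C)
    (hsmall : Stage.Small e C)
    (hg : ∀ j < n, Stage.GoodStep S (S.stage j) (j + 1) e l E C) {j : ℕ} (hj0 : 2 ≤ j)
    (hj : j ≤ n) (x : Pos d) :
    (S.newKernelGraphs j).newCost j e l x ≤ ENNReal.ofReal ((1 / 2) ^ j) := by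
  obtain ⟨i, rfl⟩ : ∃ i, j = i + 1 := ⟨j - 1, by omega⟩
  have hε : 0 < e ^ (len ((i + 1 : ℕ) : ℤ) ^ psi) := Real.rpow_pos_of_pos he _
  have h1 := GraphFamily.newCost_kernelNew_le (Nat.succ_le_succ (Nat.zero_le i)) he he1
    (by positivity) (S.kernelGraphs i) ((hg i (by omega)).tsum_cost hj0 he he1) x
  refine h1.trans ?_
  have hth := hsmall.theta he he1 hC (Nat.succ_le_succ (Nat.zero_le i))
  have hK := S.cost_kernelGraphs_le he he1 hC hsmall hg i (by omega) x
  have p0 := Real.rpow_pos_of_pos he (0.3 * len ((i + 1 : ℕ) : ℤ) ^ psi)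
  set θ := 80 * 2 ^ (i + 1) * C * e ^ (0.3 * len ((i + 1 : ℕ) : ℤ) ^ psi) with hθ
  have hθ0 : 0 ≤ θ := by positivity
  calc _ = (1 + (S.kernelGraphs i).cost e l x) * ENNReal.ofReal θ := by ring
    _ ≤ ENNReal.ofReal ((1 + 160 * C) * (2 - (1 / 2) ^ i)) * ENNReal.ofReal θ := by gcongr
    _ = ENNReal.ofReal ((1 + 160 * C) * (2 - (1 / 2) ^ i) * θ) :=
        (ENNReal.ofReal_mul' hθ0).symm
    _ ≤ _ := by
        refine ENNReal.ofReal_le_ofReal (le_trans ?_ hth)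
        refine mul_le_mul_of_nonneg_right ?_ hθ0
        have hp : (0 : ℝ) < (1 / 2) ^ i := by positivity
        nlinarith

theorem Setup.newCost_newKernelGraphs_one_le (he : 0 < e) (he1 : e ≤ 1)
    (h : Stage.GoodStep S (S.stage 0) 1 e l E C) (x : Pos d) :
    (S.newKernelGraphs 1).newCost 1 e l x ≤ ENNReal.ofReal (160 * C) := by
  have hε : 0 < e ^ (len ((1 : ℕ) : ℤ) ^ psi) := Real.rpow_pos_of_pos he _
  have h1 := GraphFamily.newCost_kernelNew_le le_rfl he he1
    (by positivity) (S.kernelGraphs 0) (h.tsum_cost_one he he1) x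
  have h0 : (S.kernelGraphs 0).cost e l x = 0 := tsum_empty (β := Empty)
  rw [h0, zero_mul, add_zero] at h1
  exact h1

end KernelBound

end

noncomputable section

open scoped Matrix.Norms.L2Operator

/-! ### Pointwise decay and the exceptional nearest neighbours. -/

section Decay
variable {d : ℕ} {S : Setup d} {n : ℕ} {e l E C : ℝ}

namespace Setup

theorem last_of_initial {x : Pos d} {c : (S.stage 0).Graph} (hx : x ∈ (S.stage 0).removed S 1)
    (hj : (S.stage 0).src c ∈ (S.stage 0).block 1 x)
    (hc : (S.stage 0).tgt c ∈ (S.stage 0).kept S 1) :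
    posDist x ((S.stage 0).tgt c) = 1 := by
  have hj := Stage.block_one hj
  have h1 : posDist ((S.stage 0).src c) ((S.stage 0).tgt c) ≤ 1 := c.2.2.2
  have h2 : posDist x ((S.stage 0).tgt c) ≠ 0 := fun h =>
    (Stage.mem_kept.1 hc).2 (posDist_eq_zero.1 h ▸ hx)
  rw [hj] at h1
  omega

/-- Walks of a single hop do not occur away from nearest neighbours, and every longer walk carries a
contraction factor, which beats 160C. -/
theorem kernelSum_one_le (he : 0 < e) (he1 : e ≤ 1) (hC : 1 ≤ C) (hsmall : Stage.Small e C)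
    (h : Stage.GoodStep S (S.stage 0) 1 e l E C) {x y : Pos d} (hxy : posDist x y ≠ 1) :
    S.kernelSum l 1 x y ≤ ENNReal.ofReal
      (e ^ (3 * max (posDist x y : ℝ) (len ((1 : ℕ) : ℤ)) ^ psi)) * ENNReal.ofReal (1 / 2) := by
  have hε : 0 < e ^ (len ((1 : ℕ) : ℤ) ^ psi) := Real.rpow_pos_of_pos he _
  have hM : 0 ≤ e ^ (len ((1 : ℕ) : ℤ) ^ psi) / |l - E| := by positivity
  have hp := Real.rpow_pos_of_pos he (3 * max (posDist x y : ℝ) (len ((1 : ℕ) : ℤ)) ^ psi)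
  have hw : ∀ w : (S.stage 0).Walk S 1 x, pick (w.tgt = y) (ENNReal.ofReal ‖w.val l‖) ≤
      ENNReal.ofReal (e ^ (3 * max (posDist x y : ℝ) (len ((1 : ℕ) : ℤ)) ^ psi)) *
        w.cost e l E (e ^ (len ((1 : ℕ) : ℤ) ^ psi) / |l - E|) 3 := by
    intro w
    by_cases hwy : w.tgt = y
    · rw [pick_pos hwy]
      refine le_trans (le_of_eq ?_)
        (mul_le_mul_right (GraphFamily.weight_le_cost le_rfl he he1 hM w) _)
      rw [← ENNReal.ofReal_mul hp.le, hwy, Real.rpow_neg he.le]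
      congr 1
      field_simp
    · rw [pick_neg hwy]
      exact zero_le
  have h0 : S.kernelSum l 1 x y = ∑' g : (S.newKernelGraphs 1).Graph,
      pick ((S.newKernelGraphs 1).src g = x) (pick ((S.newKernelGraphs 1).tgt g = y)
        (ENNReal.ofReal ‖(S.newKernelGraphs 1).val l g‖)) := by
    refine (tsum_subtype_pick (fun g => (S.newKernelGraphs 1).src g = x ∧
      (S.newKernelGraphs 1).tgt g = y)
      fun g => ENNReal.ofReal (blockNorm ((S.newKernelGraphs 1).val l g))).trans ?_
    exact tsum_congr fun g => pick_and _ _ _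
  have h1 := GraphFamily.tsum_kernelNew_le (S := S) (T := S.stage 0) (k := 1) (S.kernelGraphs 0) x
    (fun g => pick ((S.newKernelGraphs 1).tgt g = y)
      (ENNReal.ofReal ‖(S.newKernelGraphs 1).val l g‖)) (fun _ => 0) (Θ := 0) le_rfl
    fun g => g.elim
  rw [mul_zero, add_zero] at h1
  refine (h0.trans_le h1).trans ?_
  change ∑' w : (S.stage 0).Walk S 1 x, pick (w.tgt = y) (ENNReal.ofReal ‖w.val l‖) ≤ _
  -- One-step walks end at distance exactly 1 by `last_of_initial`, so their part of the sum is
  -- zero.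
  rw [Stage.tsum_walk, ENNReal.tsum_eq_zero.2 fun c => pick_neg (fun h' => ?_) _, zero_add]
  · refine le_trans ?_ (mul_le_mul_right (h.tsum_cost_step_one he he1 hC hsmall x) _)
    rw [← ENNReal.tsum_mul_left]
    refine ENNReal.tsum_le_tsum fun v => ?_
    rw [← ENNReal.tsum_mul_left]
    exact ENNReal.tsum_le_tsum fun w => hw _
  · exact hxy (h' ▸ last_of_initial c.2.1 c.2.2.1 c.2.2.2)

theorem kernelSum_le (he : 0 < e) (he1 : e ≤ 1) (hC : 1 ≤ C) (hsmall : Stage.Small e C)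
    (hg : ∀ j < n, Stage.GoodStep S (S.stage j) (j + 1) e l E C) {j : ℕ} (hj0 : 1 ≤ j)
    (hj : j ≤ n) (x y : Pos d) :
    S.kernelSum l j x y ≤ ENNReal.ofReal ((if j = 1 ∧ posDist x y = 1 then 320 * C else 1) *
      (e ^ (3 * max (posDist x y : ℝ) (len j) ^ psi) * (1 / 2) ^ j)) := by
  have hp := Real.rpow_pos_of_pos he (3 * max (posDist x y : ℝ) (len j) ^ psi)
  have h1 : S.kernelSum l j x y ≤ _ :=
    GraphFamily.absSum_le_newCost (k := j) (l := l) (S.newKernelGraphs j) he x y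
  rcases hj0.eq_or_lt with rfl | hj1
  · have hg1 : Stage.GoodStep S (S.stage 0) 1 e l E C := hg 0 hj
    split_ifs with h
    · refine (h1.trans (mul_le_mul_right (newCost_newKernelGraphs_one_le he he1 hg1 x) _)).trans ?_
      rw [← ENNReal.ofReal_mul hp.le]
      refine ENNReal.ofReal_le_ofReal (le_of_eq ?_)
      ring
    · refine (kernelSum_one_le he he1 hC hsmall hg1 fun h' => h ⟨rfl, h'⟩).trans ?_
      rw [← ENNReal.ofReal_mul hp.le, one_mul, pow_one]
  · rw [if_neg fun h => hj1.ne' h.1, one_mul, ENNReal.ofReal_mul hp.le]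
    exact h1.trans (mul_le_mul_right (newCost_newKernelGraphs_le he he1 hC hsmall hg hj1 hj x) _)

theorem sum_half_pow (n : ℕ) : ∑ j ∈ Finset.Icc 1 n, (1 / 2 : ℝ) ^ j = 1 - (1 / 2) ^ n := by
  induction n with
  | zero => simp
  | succ n ih =>
    rw [Finset.sum_Icc_succ_top (by omega), ih, pow_succ]
    ring

/-- Since e ≤ 1, replacing L_j by 1 in the exponent only weakens each bound; the factors 2^(-j) then
sum to less than 1. -/
theorem sum_kernelSum_le (he : 0 < e) (he1 : e ≤ 1) (hC : 1 ≤ C) (hsmall : Stage.Small e C)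
    (hg : ∀ j < n, Stage.GoodStep S (S.stage j) (j + 1) e l E C) (x y : Pos d) :
    ∑ j ∈ Finset.Icc 1 n, S.kernelSum l j x y ≤ ENNReal.ofReal
      ((if posDist x y = 1 then 320 * C else 1) *
        e ^ (3 * max (posDist x y : ℝ) 1 ^ psi)) := by
  have hp := Real.rpow_pos_of_pos he (3 * max (posDist x y : ℝ) 1 ^ psi)
  set c : ℝ := if posDist x y = 1 then 320 * C else 1 with hc
  have hc0 : 0 ≤ c := by
    rw [hc]
    split_ifs <;> linarith
  calc _ ≤ ∑ j ∈ Finset.Icc 1 n, ENNReal.ofReal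
        (c * e ^ (3 * max (posDist x y : ℝ) 1 ^ psi) * (1 / 2) ^ j) := by
        refine Finset.sum_le_sum fun j hj => ?_
        obtain ⟨hj1, hjn⟩ := Finset.mem_Icc.1 hj
        refine (kernelSum_le he he1 hC hsmall hg hj1 hjn x y).trans (ENNReal.ofReal_le_ofReal ?_)
        have h1 : (if j = 1 ∧ posDist x y = 1 then 320 * C else 1) ≤ c := by
          rw [hc]
          split_ifs with h1 h2 h2
          · exact le_rfl
          · exact absurd h1.2 h2
          · linarith
          · exact le_rfl
        have h2 := rpow_psi_mono (zero_le_one.trans (le_max_right (posDist x y : ℝ) 1))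
          (max_le_max_left (posDist x y : ℝ) (Stage.one_le_len hj1))
        have h3 := Real.rpow_le_rpow_of_exponent_ge he he1 (mul_le_mul_of_nonneg_left h2 zero_le_three)
        rw [mul_assoc]
        refine mul_le_mul h1 (mul_le_mul_of_nonneg_right h3 (by positivity)) ?_ hc0
        have := Real.rpow_pos_of_pos he (3 * max (posDist x y : ℝ) (len j) ^ psi)
        positivity
    _ = ENNReal.ofReal (∑ j ∈ Finset.Icc 1 n,
        c * e ^ (3 * max (posDist x y : ℝ) 1 ^ psi) * (1 / 2) ^ j) :=
        (ENNReal.ofReal_sum_of_nonneg fun j _ => by positivity).symm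
    _ ≤ _ := by
        refine ENNReal.ofReal_le_ofReal ?_
        rw [← Finset.mul_sum, sum_half_pow]
        refine mul_le_of_le_one_right (by positivity) ?_
        have : (0 : ℝ) < (1 / 2) ^ n := by positivity
        linarith

end Setup

theorem div_eps_rpow {γ : ℝ} (hγ : 0 < γ) (p : ℝ) : (γ / eps γ) ^ p = eps γ ^ (3 * p) := by
  have he := eps_pos hγ
  have h : γ / eps γ = eps γ ^ (3 : ℝ) := by
    conv_lhs => rw [← eps_pow_four hγ]
    rw [eps_pow_four hγ, div_eq_iff he.ne']
    conv_lhs => rw [← eps_pow_four hγ]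
    norm_cast
  rw [h, ← Real.rpow_mul he.le]

end Decay

end

/-! ### The main theorem. -/

theorem mainTheorem10 (d : ℕ) :
    ∃ c : ℝ, 0 < c ∧ ∃ γ₀ : ℝ, 0 < γ₀ ∧
      ∀ S : Setup d, 0 < S.γ → S.γ ≤ γ₀ → (∀ x ∈ S.box, |S.u x| ≤ 1) →
        ∀ (k : ℕ) (l : ℝ), 1 ≤ k → |l - S.E| ≤ epsAt S.γ k / 2 →
          -- the inverses in the definition of the kernel exist
          (∀ j < k, IsUnit (S.D l j - l • 1)) ∧
          -- the multigraphs sum up to the kernel, minus its identity block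
          (∀ (s : Sites (S.R 0)) (t : Sites (S.R k)),
            HasSum
              (fun g : {g : (S.kernelGraphs k).Graph //
                  (S.kernelGraphs k).src g = s.1 ∧ (S.kernelGraphs k).tgt g = t.1} =>
                (S.kernelGraphs k).val l g.1 s.2 t.2)
              (S.G l k s t - if s.1.1 = t.1.1 ∧ s.2 = t.2 then 1 else 0)) ∧
          -- decay of the multigraphs of one scale
          (∀ x y : Pos d,
            S.kernelSum l k x y ≤
              ENNReal.ofReal ((if k = 1 ∧ posDist x y = 1 then c else 1) *
                ((S.γ / eps S.γ) ^ (max (posDist x y : ℝ) (len k) ^ psi) * (1 / 2) ^ k))) ∧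
          -- decay of the sum over all scales
          (∀ x y : Pos d,
            ∑ j ∈ Finset.Icc 1 k, S.kernelSum l j x y ≤
              ENNReal.ofReal ((if posDist x y = 1 then c else 1) *
                (S.γ / eps S.γ) ^ (max (posDist x y : ℝ) 1 ^ psi))) := by
  have hC : (1 : ℝ) ≤ 4 * 3 ^ d + 1 := by
    have : (0 : ℝ) < 3 ^ d := by positivity
    linarith
  obtain ⟨e₀, he₀, he₀1, hsmall⟩ := exists_small (K := 100000 * (4 * 3 ^ d + 1) ^ 2) (by nlinarith)
  -- The constant 320C is 160C divided by the factor 1/2 in the first-scale bound; γ₀ = e₀^4 because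
  -- γ = ε^4.
  refine ⟨320 * (4 * 3 ^ d + 1), by positivity, e₀ ^ 4, by positivity, ?_⟩
  intro S hγ hγ₀ hu k l hk hl
  have he := eps_pos hγ
  have hle : eps S.γ ≤ e₀ := by
    refine le_of_pow_le_pow_left₀ (n := 4) (by norm_num) he₀.le ?_
    rwa [eps_pow_four hγ]
  have he1 := hle.trans he₀1
  have hs : Stage.Small (eps S.γ) (4 * 3 ^ d + 1) := hsmall _ he hle
  have hg := good_stages hγ rfl he1 rfl hu hs hl
  refine ⟨S.isUnit_D he he1 hg, ?_, ?_, ?_⟩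
  · exact S.hasSum_kernelGraphs he he1 hg (S.absConv_kernelGraphs he he1 hC hs hg)
  · intro x y
    rw [div_eps_rpow hγ]
    exact Setup.kernelSum_le he he1 hC hs hg hk le_rfl x y
  · intro x y
    rw [div_eps_rpow hγ]
    exact Setup.sum_kernelSum_le he he1 hC hs hg x y
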